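/- Let $K$ be a field and let $\mathcal T$ be a proper $K$-linear triangulated category, i.e. $\sum_{i\in\mathbb Z}\dim_K \mathrm{Hom}(X,Y[i])<\infty$ for all objects $X,Y$. Subcategories of $\mathcal T$ are full triangulated subcategories closed under isomorphism, ordered by inclusion of their classes of objects; $\langle S\rangle$ is the smallest one containing $S$. For a family $\mathcal J$ of $K$-linear triangulated categories, $C_{\mathcal J,K}(\mathcal T)$ is the partially ordered set of subcategories $\mathcal B\subset\mathcal T$ for which there is a $K$-linear exact equivalence $\mathcal A\to\mathcal B$ with $\mathcal A\in\mathcal J$. For an acyclic quiver $Q$, $D^b(Q)$ denotes the bounded derived category of finite-dimensional representations of $Q$ over $K$; $A_1$ is the quiver with one vertex and no arrows, $K(n)$ is the quiver with two vertices and $n$ parallel arrows, and $A_2=K(1)$. For an integer $l\ge -1$, a non-commutative (nc) curve of genus $l$ in $\mathcal T$ is an element of $C_{\{D^b(K(l+1))\},K}(\mathcal T)$. A derived point of $\mathcal T$ is a subcategory $\langle E\rangle$ generated by an exceptional object $E$ (that is, $\mathrm{Hom}(E,E)=K$ and $\mathrm{Hom}(E,E[i])=0$ for $i\neq 0$). The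 intersection of two subcategories is the full subcategory on the objects lying in both. Then: 1. Every nc curve $\mathcal A$ of genus $0$ in $\mathcal T$ contains exactly three elements of $C_{\{D^b(A_1)\},K}(\mathcal T)$; these are exactly the derived points of $\mathcal T$ contained in $\mathcal A$; and any two different ones among them generate $\mathcal A$. 2. Let $\mathcal A\ne\mathcal B$ be nc curves in $\mathcal T$ of genera $l_1,l_2\ge -1$, with $l_1\le 0$ or $l_2\le 0$. Then $\mathcal A\cap\mathcal B$ either consists of the zero objects only, or is a derived point of $\mathcal T$ (and an element of $C_{\{D^b(A_1)\},K}(\mathcal T)$). 3. Let $\mathcal J=\{0,\,D^b(A_1),\,D^b(A_2)\}$ or $\mathcal J=\{0,\,D^b(A_1),\,D^b(A_1)\oplus D^b(A_1),\,D^b(A_2)\}$, where $0$ is a trivial triangulated category. For any $x,y\in C_{\mathcal J,K}(\mathcal T)$ the intersection $x\cap y$ is an element of $C_{\mathcal J,K}(\mathcal T)$ and is the greatest lower bound of $x$ and $y$ in $C_{\mathcal J,K}(\mathcal T)$. -/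

import Mathlib

open CategoryTheory CategoryTheory.Limits CategoryTheory.Pretriangulated

universe w v u v' u'

/-! ### The product (direct sum) of two triangulated categories -/

namespace ProdTri

section

variable {C : Type u} [Category.{v} C] {D : Type u'} [Category.{v'} D]

section preadd
variable [Preadditive C] [Preadditive D]

instance preadditive : Preadditive (C × D) where
  homGroup X Y := inferInstanceAs (AddCommGroup ((X.1 ⟶ Y.1) × (X.2 ⟶ Y.2)))
  add_comp _ _ _ _ _ _ :=
    Prod.ext (Preadditive.add_comp _ _ _ _ _ _) (Preadditive.add_comp _ _ _ _ _ _)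
  comp_add _ _ _ _ _ _ :=
    Prod.ext (Preadditive.comp_add _ _ _ _ _ _) (Preadditive.comp_add _ _ _ _ _ _)

instance linear (K : Type w) [Field K] [Linear K C] [Linear K D] : Linear K (C × D) where
  homModule X Y := inferInstanceAs (Module K ((X.1 ⟶ Y.1) × (X.2 ⟶ Y.2)))
  smul_comp _ _ _ _ _ _ := Prod.ext (Linear.smul_comp _ _ _ _ _ _) (Linear.smul_comp _ _ _ _ _ _)
  comp_smul _ _ _ _ _ _ := Prod.ext (Linear.comp_smul _ _ _ _ _ _) (Linear.comp_smul _ _ _ _ _ _)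

end preadd

instance hasZeroObject [HasZeroObject C] [HasZeroObject D] : HasZeroObject (C × D) := by
  obtain ⟨X, hX⟩ := ‹HasZeroObject C›
  obtain ⟨Y, hY⟩ := ‹HasZeroObject D›
  refine ⟨(X, Y), ⟨fun Z => ⟨⟨⟨(hX.to_ Z.1, hY.to_ Z.2)⟩, fun f => ?_⟩⟩,
    fun Z => ⟨⟨⟨(hX.from_ Z.1, hY.from_ Z.2)⟩, fun f => ?_⟩⟩⟩⟩
  · exact Prod.ext (hX.eq_of_src _ _) (hY.eq_of_src _ _)
  · exact Prod.ext (hX.eq_of_tgt _ _) (hY.eq_of_tgt _ _)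

lemma isZero_fst [Preadditive C] [Preadditive D] {X : C × D} (hX : IsZero X) : IsZero X.1 :=
  (IsZero.iff_id_eq_zero _).2 (congrArg Prod.fst ((IsZero.iff_id_eq_zero _).1 hX))

lemma isZero_snd [Preadditive C] [Preadditive D] {X : C × D} (hX : IsZero X) : IsZero X.2 :=
  (IsZero.iff_id_eq_zero _).2 (congrArg Prod.snd ((IsZero.iff_id_eq_zero _).1 hX))

variable [HasShift C ℤ] [HasShift D ℤ]

/-- The componentwise shift on a product. -/
instance hasShift : HasShift (C × D) ℤ :=
  hasShiftMk (C × D) ℤ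
    { F := fun n => (shiftFunctor C n).prod (shiftFunctor D n)
      zero := NatIso.prod (shiftFunctorZero C ℤ) (shiftFunctorZero D ℤ)
      add := fun n m => NatIso.prod (shiftFunctorAdd C n m) (shiftFunctorAdd D n m)
      assoc_hom_app := fun a b c X => by
        ext
        · simpa [shiftFunctorAdd'] using shiftFunctorAdd_assoc_hom_app (C := C) a b c X.1
        · simpa [shiftFunctorAdd'] using shiftFunctorAdd_assoc_hom_app (C := D) a b c X.2
      zero_add_hom_app := fun n X => by
        ext
        · simpa using shiftFunctorAdd_zero_add_hom_app (C := C) n X.1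
        · simpa using shiftFunctorAdd_zero_add_hom_app (C := D) n X.2
      add_zero_hom_app := fun n X => by
        ext
        · simpa using shiftFunctorAdd_add_zero_hom_app (C := C) n X.1
        · simpa using shiftFunctorAdd_add_zero_hom_app (C := D) n X.2 }

variable [Preadditive C] [Preadditive D]

instance shiftAdditive [∀ n : ℤ, (shiftFunctor C n).Additive]
    [∀ n : ℤ, (shiftFunctor D n).Additive] (n : ℤ) : (shiftFunctor (C × D) n).Additive where
  map_add {_ _ f g} := Prod.ext ((shiftFunctor C n).map_add (f := f.1) (g := g.1))
    ((shiftFunctor D n).map_add (f := f.2) (g := g.2))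

instance shiftLinear (K : Type w) [Field K] [Linear K C] [Linear K D]
    [∀ n : ℤ, (shiftFunctor C n).Linear K] [∀ n : ℤ, (shiftFunctor D n).Linear K]
    (n : ℤ) : (shiftFunctor (C × D) n).Linear K where
  map_smul f r := Prod.ext (Functor.Linear.map_smul (F := shiftFunctor C n) f.1 r)
    (Functor.Linear.map_smul (F := shiftFunctor D n) f.2 r)

/-- The first component of a triangle in a product. -/
abbrev fstTriangle (T : Triangle (C × D)) : Triangle C :=
  Triangle.mk (T.mor₁.1) (T.mor₂.1) (show T.obj₃.1 ⟶ (T.obj₁.1)⟦(1 : ℤ)⟧ from T.mor₃.1)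

/-- The second component of a triangle in a product. -/
abbrev sndTriangle (T : Triangle (C × D)) : Triangle D :=
  Triangle.mk (T.mor₁.2) (T.mor₂.2) (show T.obj₃.2 ⟶ (T.obj₁.2)⟦(1 : ℤ)⟧ from T.mor₃.2)

/-- The first component of an isomorphism in a product. -/
def fstIso {X Y : C × D} (e : X ≅ Y) : X.1 ≅ Y.1 :=
  ⟨e.hom.1, e.inv.1, congrArg Prod.fst e.hom_inv_id, congrArg Prod.fst e.inv_hom_id⟩

/-- The second component of an isomorphism in a product. -/
def sndIso {X Y : C × D} (e : X ≅ Y) : X.2 ≅ Y.2 :=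
  ⟨e.hom.2, e.inv.2, congrArg Prod.snd e.hom_inv_id, congrArg Prod.snd e.inv_hom_id⟩

variable [HasZeroObject C] [HasZeroObject D]
  [∀ n : ℤ, (shiftFunctor C n).Additive] [∀ n : ℤ, (shiftFunctor D n).Additive]
  [Pretriangulated C] [Pretriangulated D]

/-- A triangle in a product is distinguished if and only if both components are. -/
instance pretriangulated : Pretriangulated (C × D) where
  distinguishedTriangles := {T | fstTriangle T ∈ distTriang C ∧ sndTriangle T ∈ distTriang D}
  isomorphic_distinguished T₁ hT₁ T₂ e :=
    ⟨isomorphic_distinguished _ hT₁.1 _ (Triangle.isoMk _ _ (fstIso (Triangle.π₁.mapIso e))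
        (fstIso (Triangle.π₂.mapIso e)) (fstIso (Triangle.π₃.mapIso e))
        (congrArg Prod.fst e.hom.comm₁) (congrArg Prod.fst e.hom.comm₂)
        (congrArg Prod.fst e.hom.comm₃)),
     isomorphic_distinguished _ hT₁.2 _ (Triangle.isoMk _ _ (sndIso (Triangle.π₁.mapIso e))
        (sndIso (Triangle.π₂.mapIso e)) (sndIso (Triangle.π₃.mapIso e))
        (congrArg Prod.snd e.hom.comm₁) (congrArg Prod.snd e.hom.comm₂)
        (congrArg Prod.snd e.hom.comm₃))⟩
  contractible_distinguished X :=
    ⟨isomorphic_distinguished _ (contractible_distinguished X.1) _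
      (Triangle.isoMk _ _ (Iso.refl _) (Iso.refl _) ((isZero_fst (isZero_zero (C × D))).iso (isZero_zero C))
        rfl ((isZero_zero C).eq_of_tgt _ _) ((isZero_fst (isZero_zero (C × D))).eq_of_src _ _)),
     isomorphic_distinguished _ (contractible_distinguished X.2) _
      (Triangle.isoMk _ _ (Iso.refl _) (Iso.refl _) ((isZero_snd (isZero_zero (C × D))).iso (isZero_zero D))
        rfl ((isZero_zero D).eq_of_tgt _ _) ((isZero_snd (isZero_zero (C × D))).eq_of_src _ _))⟩
  distinguished_cocone_triangle {X Y} f := by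
    obtain ⟨Z, g, h, H⟩ := distinguished_cocone_triangle f.1
    obtain ⟨Z', g', h', H'⟩ := distinguished_cocone_triangle f.2
    exact ⟨(Z, Z'), (g, g'), (h, h'), H, H'⟩
  rotate_distinguished_triangle T :=
    and_congr (rotate_distinguished_triangle (fstTriangle T))
      (rotate_distinguished_triangle (sndTriangle T))
  complete_distinguished_triangle_morphism T₁ T₂ hT₁ hT₂ a b comm := by
    obtain ⟨c, hc, hc'⟩ := complete_distinguished_triangle_morphism _ _ hT₁.1 hT₂.1 a.1 b.1
      (congrArg Prod.fst comm)
    obtain ⟨d, hd, hd'⟩ := complete_distinguished_triangle_morphism _ _ hT₁.2 hT₂.2 a.2 b.2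
      (congrArg Prod.snd comm)
    exact ⟨(c, d), Prod.ext hc hd, Prod.ext hc' hd'⟩

lemma mk_mem_distTriang_iff {X Y Z : C × D} (f : X ⟶ Y) (g : Y ⟶ Z) (h : Z ⟶ X⟦(1 : ℤ)⟧) :
    Triangle.mk f g h ∈ distTriang (C × D) ↔
      fstTriangle (Triangle.mk f g h) ∈ distTriang C ∧
        sndTriangle (Triangle.mk f g h) ∈ distTriang D := Iff.rfl

instance isTriangulated [IsTriangulated C] [IsTriangulated D] : IsTriangulated (C × D) where
  octahedron_axiom {X₁ X₂ X₃ Z₁₂ Z₂₃ Z₁₃ u₁₂ u₂₃ u₁₃} comm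
      {v₁₂ w₁₂} h₁₂ {v₂₃ w₂₃} h₂₃ {v₁₃ w₁₃} h₁₃ := by
    rw [mk_mem_distTriang_iff] at h₁₂ h₂₃ h₁₃
    have o := Triangulated.someOctahedron (congrArg Prod.fst comm) h₁₂.1 h₂₃.1 h₁₃.1
    have o' := Triangulated.someOctahedron (congrArg Prod.snd comm) h₁₂.2 h₂₃.2 h₁₃.2
    exact ⟨{
      m₁ := (o.m₁, o'.m₁)
      m₃ := (o.m₃, o'.m₃)
      comm₁ := Prod.ext o.comm₁ o'.comm₁
      comm₂ := Prod.ext o.comm₂ o'.comm₂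
      comm₃ := Prod.ext o.comm₃ o'.comm₃
      comm₄ := Prod.ext o.comm₄ o'.comm₄
      mem := ⟨o.mem, o'.mem⟩ }⟩

end

end ProdTri

/-! ### Full triangulated subcategories -/

section
variable {T : Type u} [Category.{v} T]

/-- If the shift of a linear category is linear, so is the shift of a full subcategory. -/
instance fullSubcategoryShiftLinear (K : Type w) [Field K] [Preadditive T] [Linear K T]
    [HasShift T ℤ] [∀ n : ℤ, (shiftFunctor T n).Linear K] (P : ObjectProperty T)
    [P.IsStableUnderShift ℤ] (n : ℤ) : (shiftFunctor P.FullSubcategory n).Linear K where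
  map_smul {X Y} f r := by
    have hι : ∀ {A B : P.FullSubcategory} (g : A ⟶ B), P.ι.map (r • g) = r • P.ι.map g :=
      fun _ => rfl
    apply P.ι.map_injective
    rw [hι, ← cancel_mono ((P.ι.commShiftIso n).hom.app Y), Linear.smul_comp]
    have h1 := (P.ι.commShiftIso n).hom.naturality (r • f)
    have h2 := (P.ι.commShiftIso n).hom.naturality f
    simp only [Functor.comp_map] at h1 h2
    rw [h1, h2, hι, Functor.Linear.map_smul, Linear.comp_smul]

open ZeroObject in
/-- The zero objects form a triangulated subcategory. -/
instance isZeroIsTriangulated [HasZeroObject T] [HasShift T ℤ] [Preadditive T]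
    [∀ n : ℤ, (shiftFunctor T n).Additive] [Pretriangulated T] :
    ObjectProperty.IsTriangulated (IsZero (C := T)) where
  exists_zero := ⟨0, isZero_zero T, isZero_zero T⟩
  isStableUnderShiftBy n := ⟨fun X hX => (shiftFunctor T n).map_isZero hX⟩
  ext₂' _ hX h₁ h₃ := ObjectProperty.le_isoClosure _ _
    (Triangle.isZero₂_of_isZero₁₃ _ hX h₁ h₃)

end



/-! ### `K`-linear triangulated categories -/

/-- A `K`-linear triangulated category, as a bundled object. -/
structure LinTriCat (K : Type w) [Field K] where
  /-- the underlying category -/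
  carrier : Type u
  [category : Category.{v} carrier]
  [hasZeroObject : HasZeroObject carrier]
  [hasShift : HasShift carrier ℤ]
  [preadditive : Preadditive carrier]
  [linear : Linear K carrier]
  [shiftAdditive : ∀ n : ℤ, (shiftFunctor carrier n).Additive]
  [shiftLinear : ∀ n : ℤ, (shiftFunctor carrier n).Linear K]
  [pretriangulated : Pretriangulated carrier]
  [isTriangulated : IsTriangulated carrier]

attribute [instance] LinTriCat.category LinTriCat.hasZeroObject LinTriCat.hasShift
  LinTriCat.preadditive LinTriCat.linear LinTriCat.shiftAdditive LinTriCat.shiftLinear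
  LinTriCat.pretriangulated LinTriCat.isTriangulated

/-- There is a `K`-linear exact equivalence from `A` to `B`. -/
def ExactLinearEquivalent (K : Type w) [Field K]
    (A : Type u) [Category.{v} A] [HasZeroObject A] [HasShift A ℤ] [Preadditive A] [Linear K A]
    [∀ n : ℤ, (shiftFunctor A n).Additive] [Pretriangulated A]
    (B : Type u') [Category.{v'} B] [HasZeroObject B] [HasShift B ℤ] [Preadditive B] [Linear K B]
    [∀ n : ℤ, (shiftFunctor B n).Additive] [Pretriangulated B] : Prop :=
  ∃ (F : A ⥤ B) (_ : F.CommShift ℤ), F.IsTriangulated ∧ F.Linear K ∧ F.IsEquivalence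

/-! ### Bounded derived categories of quivers -/

/-- The two vertices of the Kronecker quiver with `n` arrows. -/
inductive KroneckerVertex (n : ℕ) : Type
  | source : KroneckerVertex n
  | target : KroneckerVertex n

/-- The arrows of the Kronecker quiver: `n` arrows from `source` to `target`. -/
inductive KroneckerArrow (n : ℕ) : KroneckerVertex n → KroneckerVertex n → Type
  | arrow (i : Fin n) : KroneckerArrow n KroneckerVertex.source KroneckerVertex.target

/-- The Kronecker quiver `K(n)` with two vertices and `n` parallel arrows. -/
instance kroneckerQuiver (n : ℕ) : Quiver.{0} (KroneckerVertex n) where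
  Hom := KroneckerArrow n

/-- The category of finite-dimensional representations over `K` of the quiver `Q`: functors from
the path category of `Q` to finite-dimensional vector spaces. -/
abbrev QuiverRep (K : Type w) [Field K] (Q : Type) [Quiver.{0} Q] : Type (w + 1) :=
  Paths Q ⥤ FGModuleCat.{w} K

noncomputable instance quiverRepHasDerivedCategory (K : Type w) [Field K]
    (Q : Type) [Quiver.{0} Q] : HasDerivedCategory.{w + 1} (QuiverRep K Q) :=
  HasDerivedCategory.standard _

/-- The bounded derived category `D^b(Rep_K(Q))` as a `K`-linear triangulated category. -/
noncomputable def Db (K : Type w) [Field K] (Q : Type) [Quiver.{0} Q] :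
    LinTriCat.{w, w + 1, w + 1} K where
  carrier := DerivedCategory.Bounded (QuiverRep K Q)

/-- `D^b(A₁)`, where `A₁` is the quiver with one vertex and no arrows. -/
noncomputable def DbA₁ (K : Type w) [Field K] : LinTriCat.{w, w + 1, w + 1} K :=
  Db K (Quiver.Empty Unit)

/-- `NP^l = D^b(K(l+1))`, used for `l ≥ -1`. -/
noncomputable def NP (K : Type w) [Field K] (l : ℤ) : LinTriCat.{w, w + 1, w + 1} K :=
  Db K (KroneckerVertex (l + 1).toNat)

/-- `D^b(A₂)`, where `A₂ = K(1)` is the quiver with two vertices and one arrow between them. -/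
noncomputable def DbA₂ (K : Type w) [Field K] : LinTriCat.{w, w + 1, w + 1} K :=
  Db K (KroneckerVertex 1)

/-- The direct sum `A ⊕ B` of two `K`-linear triangulated categories: objects and morphisms are
pairs, and shift and distinguished triangles are componentwise. -/
def LinTriCat.directSum {K : Type w} [Field K] (A B : LinTriCat.{w, v, u} K) :
    LinTriCat.{w, v, u} K where
  carrier := A.carrier × B.carrier

/-- A trivial `K`-linear triangulated category (the one formed by the zero objects of
`D^b(A₁)`): it has only zero objects. -/
noncomputable def trivialCat (K : Type w) [Field K] : LinTriCat.{w, w + 1, w + 1} K where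
  carrier := ObjectProperty.FullSubcategory (IsZero (C := (DbA₁ K).carrier))

/-! ### Subcategories of a `K`-linear triangulated category -/

section

variable (K : Type w) [Field K] (T : Type u) [Category.{v} T] [HasZeroObject T] [HasShift T ℤ]
  [Preadditive T] [Linear K T] [∀ n : ℤ, (shiftFunctor T n).Additive]

/-- `T` is proper: `∑_{i ∈ ℤ} dim Hom(X, Y[i]) < ∞` for all objects `X`, `Y`. -/
def IsProperCat : Prop :=
  ∀ X Y : T, (∀ i : ℤ, FiniteDimensional K (X ⟶ Y⟦i⟧)) ∧
    {i : ℤ | Module.finrank K (X ⟶ Y⟦i⟧) ≠ 0}.Finite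

variable {T} in
/-- `E` is an exceptional object: `Hom(E, E[i]) = 0` for `i ≠ 0` and `Hom(E, E) = K`. -/
def IsExceptional (E : T) : Prop :=
  (∀ i : ℤ, i ≠ 0 → Subsingleton (E ⟶ E⟦i⟧)) ∧ Module.finrank K (E ⟶ E) = 1

variable [Pretriangulated T]

/-- `P` is (the class of objects of) a full triangulated subcategory, closed under isomorphisms. -/
def IsTriSubcat {T : Type u} [Category.{v} T] [HasZeroObject T] [HasShift T ℤ]
    [Preadditive T] [∀ n : ℤ, (shiftFunctor T n).Additive] [Pretriangulated T]
    (P : ObjectProperty T) : Prop :=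
  P.IsTriangulated ∧ P.IsClosedUnderIsomorphisms

/-- The triangulated subcategory `⟨S⟩` generated by a class of objects `S`. -/
def triGenerated {T : Type u} [Category.{v} T] [HasZeroObject T] [HasShift T ℤ]
    [Preadditive T] [∀ n : ℤ, (shiftFunctor T n).Additive] [Pretriangulated T]
    (S : ObjectProperty T) : ObjectProperty T :=
  fun X => ∀ P : ObjectProperty T, IsTriSubcat P → S ≤ P → P X

/-- For a family `J` of `K`-linear triangulated categories, the set `C_{J,K}(T)` of full
triangulated subcategories `B` of `T` such that there is a `K`-linear exact equivalence `A → B`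
for some `A` in `J`. It is ordered by inclusion of the classes of objects. -/
def subcatsOfType (J : Set (LinTriCat.{w, w + 1, w + 1} K)) : Set (ObjectProperty T) :=
  {B | B.IsClosedUnderIsomorphisms ∧ ∃ _ : B.IsTriangulated, ∃ A ∈ J,
    ExactLinearEquivalent K A.carrier B.FullSubcategory}

/-- The non-commutative curves in `T` of non-commutative genus `l` (for `l ≥ -1`), as
subcategories of `T`. -/
def ncCurves (l : ℤ) : Set (ObjectProperty T) := subcatsOfType K T {NP K l}

variable {T} in
/-- A derived point of `T`: a triangulated subcategory generated by an exceptional object. -/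
def IsDerivedPoint (P : ObjectProperty T) : Prop :=
  ∃ E : T, IsExceptional K E ∧ P = triGenerated (fun X => X = E)

end

set_option linter.unusedSectionVars false

namespace LinTri

open scoped ZeroObject

section

variable {T : Type u} [Category.{v} T] [HasZeroObject T] [HasShift T ℤ]
  [Preadditive T] [∀ n : ℤ, (shiftFunctor T n).Additive] [Pretriangulated T]

/-! ### Generated triangulated subcategories -/

/-! All nontrivial categories involved are generated by one or two exceptional objects. In D^b(K(n))
the projectives E₁ at the target and E₂ at the source form an exceptional pair with morphisms in
degree zero only (`HeredPair`), and fully faithful exact functors carry it into `T`. Approximating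
first by E₂ and then by E₁ shows that ⟨E₁, E₂⟩ is right admissible, hence closed under retracts, and
that each of its objects is the cone of a map from a sum of shifts of E₁ to a sum of shifts of E₂.

If all maps E₁ ⟶ E₂ are multiples of one map h, such cones are a matter of linear algebra: a kernel
vector splits off a shift of E₁, a cokernel vector a shift of E₂, and otherwise a copy of h splits
off, giving a shift of its cone E₃. So every object is a finite sum of shifts of E₁, E₂ and, if h ≠
0, E₃ (`HeredPair.finiteSum`). Here E₃ is again exceptional, and the triangle on h shows that any
two of the three generate everything (`HeredPair.isDiscrete`). With h ≠ 0 these are the three points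
of a curve of genus 0; h = 0 covers genus -1 and D^b(A₁) ⊕ D^b(A₁).

Let A be such a discrete subcategory and P any triangulated subcategory closed under retracts. The
objects of A ⊓ P are sums of shifts of the generators of A lying in P. If there are none, the
intersection is zero; if one, it is a point; if two, A ≤ P (`IsDiscrete.inf_eq`). Statement 3
follows directly.

For statement 2 a proper inclusion A < B must be excluded, where B may have any genus and need not
be discrete. An exceptional pair in ⟨E₁, E₂⟩ has a Gram matrix of determinant 1 for the Euler form,
so an object right orthogonal to it has zero Euler characteristics against E₁ and E₂. The cone
presentation splits by degree, and within one degree Euler characteristics are dimensions up to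
sign, so the object vanishes (`HeredPair.span_eq`).

Membership of the points in the D^b(A₁)-type also needs an actual functor: for a representation M it
is derived from V ↦ V ⊗ M (`exists_functor_from_DbA₁`). -/

lemma le_triGenerated (S : ObjectProperty T) : S ≤ triGenerated S :=
  fun _ hX _ _ h => h _ hX

lemma triGenerated_le {S P : ObjectProperty T} (hP : IsTriSubcat P) (h : S ≤ P) :
    triGenerated S ≤ P :=
  fun _ hX => hX P hP h

lemma isTriSubcat_triGenerated (S : ObjectProperty T) : IsTriSubcat (triGenerated S) := by
  have hiso : (triGenerated S).IsClosedUnderIsomorphisms :=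
    ⟨fun e hX P hP h => by
      have := hP.2
      exact P.prop_of_iso e (hX P hP h)⟩
  refine ⟨?_, hiso⟩
  exact
    { exists_zero := ⟨_, isZero_zero T, fun P hP _ => by
        have := hP.1; have := hP.2; exact P.prop_zero⟩
      isStableUnderShiftBy := fun n => ⟨fun X hX P hP h => by
        have := hP.1; exact P.le_shift n _ (hX P hP h)⟩
      toIsTriangulatedClosed₂ := .mk' fun D hD h₁ h₃ P hP h => by
        have := hP.1; have := hP.2
        exact P.ext_of_isTriangulatedClosed₂ D hD (h₁ P hP h) (h₃ P hP h) }

instance (S : ObjectProperty T) : (triGenerated S).IsTriangulated :=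
  (isTriSubcat_triGenerated S).1

instance (S : ObjectProperty T) : (triGenerated S).IsClosedUnderIsomorphisms :=
  (isTriSubcat_triGenerated S).2

lemma prop_biprod (P : ObjectProperty T) [P.IsTriangulated] [P.IsClosedUnderIsomorphisms]
    {X Y : T} (hX : P X) (hY : P Y) : P (X ⊞ Y) :=
  P.ext_of_isTriangulatedClosed₂ _ (binaryBiproductTriangle_distinguished X Y) hX hY

lemma prop_of_isZero (P : ObjectProperty T) [P.IsTriangulated] [P.IsClosedUnderIsomorphisms]
    {X : T} (hX : IsZero X) : P X :=
  P.prop_of_iso (hX.iso (isZero_zero T)).symm P.prop_zero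

lemma prop_shift_iff (P : ObjectProperty T) [P.IsTriangulated] [P.IsClosedUnderIsomorphisms]
    (X : T) (n : ℤ) : P (X⟦n⟧) ↔ P X :=
  P.prop_shift_iff_of_isStableUnderShift X n

/-- The full subcategory on the objects whose iterated shifts receive no nonzero map from `E`. -/
def rightPerp (E : T) : ObjectProperty T := fun X => ∀ (n : ℤ) (f : E⟦n⟧ ⟶ X), f = 0

lemma isTriSubcat_rightPerp (E : T) : IsTriSubcat (rightPerp E) := by
  have hiso : (rightPerp E).IsClosedUnderIsomorphisms := ⟨fun e hX n f => by
    rw [← cancel_mono e.inv, hX n (f ≫ e.inv), zero_comp]⟩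
  refine ⟨?_, hiso⟩
  exact
    { exists_zero := ⟨_, isZero_zero T, fun n f => (isZero_zero T).eq_of_tgt _ _⟩
      isStableUnderShiftBy := fun a => ⟨fun X hX n f => by
        have e : E⟦n⟧ ≅ (E⟦n - a⟧)⟦a⟧ := (shiftFunctorAdd' T (n - a) a n (by lia)).app E
        rw [← cancel_epi e.inv, comp_zero]
        obtain ⟨g, hg⟩ := (shiftFunctor T a).map_surjective (e.inv ≫ f)
        rw [← hg, hX _ g, Functor.map_zero]⟩
      toIsTriangulatedClosed₂ := .mk' fun D hD h₁ h₃ n f => by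
        obtain ⟨g, rfl⟩ := D.coyoneda_exact₂ hD f (h₃ n _)
        rw [h₁ n g, zero_comp] }

/-- The full subcategory on the objects `Y` without nonzero maps to any shift of `Z`. -/
def leftPerp (Z : T) : ObjectProperty T := fun Y => ∀ (n : ℤ) (f : Y ⟶ Z⟦n⟧), f = 0

lemma isTriSubcat_leftPerp (Z : T) : IsTriSubcat (leftPerp Z) := by
  have hiso : (leftPerp Z).IsClosedUnderIsomorphisms := ⟨fun e hX n f => by
    rw [← cancel_epi e.hom, hX n (e.hom ≫ f), comp_zero]⟩
  refine ⟨?_, hiso⟩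
  exact
    { exists_zero := ⟨_, isZero_zero T, fun n f => (isZero_zero T).eq_of_src _ _⟩
      isStableUnderShiftBy := fun a => ⟨fun X hX n f => by
        have e : Z⟦n⟧ ≅ (Z⟦n - a⟧)⟦a⟧ := (shiftFunctorAdd' T (n - a) a n (by lia)).app Z
        rw [← cancel_mono e.hom, zero_comp]
        obtain ⟨g, hg⟩ := (shiftFunctor T a).map_surjective (f ≫ e.hom)
        rw [← hg, hX _ g, Functor.map_zero]⟩
      toIsTriangulatedClosed₂ := .mk' fun D hD h₁ h₃ n f => by
        obtain ⟨g, rfl⟩ := D.yoneda_exact₂ hD f (h₁ n _)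
        rw [h₃ n g, comp_zero] }

/-- Maps from the subcategory generated by `S` to an object right orthogonal to `S` vanish. -/
lemma eq_zero_of_triGenerated {S : ObjectProperty T} {Y Z : T} (hY : triGenerated S Y)
    (h : ∀ E, S E → rightPerp E Z) (f : Y ⟶ Z) : f = 0 := by
  -- The left orthogonal of `Z` is triangulated and contains `S`, hence contains `Y`; the claim is
  -- its degree-zero case.
  have : leftPerp Z Y := by
    refine hY _ (isTriSubcat_leftPerp Z) fun E hE n g => ?_
    obtain ⟨⟨h₁, -, -⟩, h₂⟩ := And.intro (isTriSubcat_rightPerp E).1 (isTriSubcat_rightPerp E).2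
    have := (isTriSubcat_rightPerp E).1
    have h3 : rightPerp E (Z⟦n⟧) := (rightPerp E).le_shift n _ (h E hE)
    have := h3 0 ((shiftFunctorZero T ℤ).hom.app E ≫ g)
    rw [← cancel_epi ((shiftFunctorZero T ℤ).hom.app E), this, comp_zero]
  have := this 0 (f ≫ (shiftFunctorZero T ℤ).inv.app Z)
  rw [← cancel_mono ((shiftFunctorZero T ℤ).inv.app Z), this, zero_comp]

/-! ### Finite direct sums -/

/-- Finite direct sums of objects of `S`. -/
inductive FiniteSum (S : ObjectProperty T) : T → Prop
  | zero {X : T} (hX : IsZero X) : FiniteSum S X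
  | add {E X Y : T} (hE : S E) (hX : FiniteSum S X) (e : Y ≅ E ⊞ X) : FiniteSum S Y

lemma FiniteSum.of_iso {S : ObjectProperty T} {X Y : T} (e : X ≅ Y) (h : FiniteSum S X) :
    FiniteSum S Y := by
  cases h with
  | zero hX => exact .zero (hX.of_iso e.symm)
  | add hE hX e' => exact .add hE hX (e.symm ≪≫ e')

lemma FiniteSum.mono {S S' : ObjectProperty T} (h : S ≤ S') {X : T} (hX : FiniteSum S X) :
    FiniteSum S' X := by
  induction hX with
  | zero hX => exact .zero hX
  | add hE _ e ih => exact .add (h _ hE) ih e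

lemma FiniteSum.le {S P : ObjectProperty T} (hP : IsTriSubcat P) (h : S ≤ P) {X : T}
    (hX : FiniteSum S X) : P X := by
  have := hP.1
  have := hP.2
  induction hX with
  | zero hX => exact prop_of_isZero P hX
  | add hE _ e ih => exact P.prop_of_iso e.symm (prop_biprod P (h _ hE) ih)

lemma FiniteSum.from_eq_zero {S : ObjectProperty T} {X Z : T} (hX : FiniteSum S X)
    (h : ∀ E, S E → ∀ f : E ⟶ Z, f = 0) (f : X ⟶ Z) : f = 0 := by
  induction hX with
  | zero hX => exact hX.eq_of_src _ _
  | add hE _ e ih =>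
    rw [← cancel_epi e.inv, comp_zero]
    ext
    · rw [h _ hE (biprod.inl ≫ e.inv ≫ f), comp_zero]
    · rw [ih (biprod.inr ≫ e.inv ≫ f), comp_zero]

lemma FiniteSum.to_eq_zero {S : ObjectProperty T} {X Z : T} (hX : FiniteSum S X)
    (h : ∀ E, S E → ∀ f : Z ⟶ E, f = 0) (f : Z ⟶ X) : f = 0 := by
  induction hX with
  | zero hX => exact hX.eq_of_tgt _ _
  | add hE _ e ih =>
    rw [← cancel_mono e.hom, zero_comp]
    ext
    · rw [h _ hE ((f ≫ e.hom) ≫ biprod.fst), zero_comp]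
    · rw [ih ((f ≫ e.hom) ≫ biprod.snd), zero_comp]

/-- The last map of a triangle on a split monomorphism vanishes, so the triangle is a biproduct; the
complement is the cone. -/
lemma exists_iso_biprod_of_comp_eq_id {E X : T} (f : E ⟶ X) (r : X ⟶ E) (h : f ≫ r = 𝟙 E) :
    ∃ X', Nonempty (X ≅ E ⊞ X') := by
  obtain ⟨Z, g, δ, hT⟩ := distinguished_cocone_triangle f
  have : Mono f := by
    have : IsSplitMono f := ⟨⟨⟨r, h⟩⟩⟩
    infer_instance
  obtain ⟨e, -⟩ := exists_iso_binaryBiproduct_of_distTriang _ hT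
    ((Triangle.mk f g δ).mor₃_eq_zero_of_mono₁ hT this)
  exact ⟨Z, ⟨e⟩⟩

/-- The shifts of `E` by integers in `J`. -/
def shiftsIn (E : T) (J : Set ℤ) : ObjectProperty T := fun Y => ∃ n ∈ J, Nonempty (Y ≅ E⟦n⟧)

/-- The shifts of objects of `S`. -/
def shiftsOf (S : ObjectProperty T) : ObjectProperty T :=
  fun Y => ∃ E, S E ∧ ∃ n : ℤ, Nonempty (Y ≅ E⟦n⟧)

lemma shiftsIn_mono (E : T) {J J' : Set ℤ} (h : J ⊆ J') : shiftsIn E J ≤ shiftsIn E J' :=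
  fun _ ⟨n, hn, e⟩ => ⟨n, h hn, e⟩

lemma shiftsIn_le {P : ObjectProperty T} (hP : IsTriSubcat P) {E : T} (hE : P E) (J : Set ℤ) :
    shiftsIn E J ≤ P := by
  rintro X ⟨n, -, ⟨e⟩⟩
  have := hP.1
  have := hP.2
  exact P.prop_of_iso e.symm (P.le_shift n _ hE)

lemma shiftsOf_le {P S : ObjectProperty T} (hP : IsTriSubcat P) (h : S ≤ P) :
    shiftsOf S ≤ P := by
  rintro X ⟨E, hE, n, ⟨e⟩⟩
  have := hP.1
  have := hP.2
  exact P.prop_of_iso e.symm (P.le_shift n _ (h _ hE))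

/-- Summands are sorted by their shift. The case of a singleton `J` isolates one degree in
`HeredPair.isZero_of_rightPerp`. -/
lemma FiniteSum.split {E : T} (J : Set ℤ) {X : T} (hX : FiniteSum (shiftsIn E Set.univ) X) :
    ∃ X₁ X₂, FiniteSum (shiftsIn E J) X₁ ∧ FiniteSum (shiftsIn E Jᶜ) X₂ ∧
      Nonempty (X ≅ X₁ ⊞ X₂) := by
  induction hX with
  | zero hX =>
    refine ⟨_, _, .zero hX, .zero hX, ⟨hX.iso ((IsZero.iff_id_eq_zero _).2 ?_)⟩⟩
    ext <;> exact hX.eq_of_src _ _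
  | @add E' X Y hE _ e ih =>
    obtain ⟨X₁, X₂, h₁, h₂, ⟨e'⟩⟩ := ih
    obtain ⟨n, -, i⟩ := hE
    by_cases hn : n ∈ J
    · refine ⟨E' ⊞ X₁, X₂, .add ⟨n, hn, i⟩ h₁ (Iso.refl _), h₂,
        ⟨e ≪≫ biprod.mapIso (Iso.refl _) e' ≪≫ (biprod.associator _ _ _).symm⟩⟩
    · refine ⟨X₁, E' ⊞ X₂, h₁, .add ⟨n, hn, i⟩ h₂ (Iso.refl _),
        ⟨e ≪≫ biprod.mapIso (Iso.refl _) e' ≪≫ (biprod.associator _ _ _).symm ≪≫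
          biprod.mapIso (biprod.braiding _ _) (Iso.refl _) ≪≫ biprod.associator _ _ _⟩⟩

end


section

variable (K : Type w) [Field K] {T : Type u} [Category.{v} T] [HasZeroObject T] [HasShift T ℤ]
  [Preadditive T] [Linear K T] [∀ n : ℤ, (shiftFunctor T n).Additive]

/-! ### Exceptional objects -/

/-- Moving a shift from the source of a morphism to its target. -/
noncomputable def shiftHomEquiv [∀ n : ℤ, (shiftFunctor T n).Linear K] (E X : T) (a b : ℤ)
    (h : a + b = 0) : (E⟦a⟧ ⟶ X) ≃ₗ[K] (E ⟶ X⟦b⟧) :=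
  LinearEquiv.ofBijective
    (Linear.leftComp K (X⟦b⟧) ((shiftFunctorCompIsoId T a b h).inv.app E) ∘ₗ
      (shiftFunctor T b).mapLinearMap K) <| by
    rw [LinearMap.coe_comp]
    refine Function.Bijective.comp ⟨fun f g hfg => ?_, fun f => ?_⟩
      ⟨(shiftFunctor T b).map_injective, (shiftFunctor T b).map_surjective⟩
    · exact (cancel_epi ((shiftFunctorCompIsoId T a b h).inv.app E)).1 hfg
    · exact ⟨(shiftFunctorCompIsoId T a b h).hom.app E ≫ f, by simp⟩

/-- An exceptional object, described by the morphisms between its shifts. -/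
structure IsExc (E : T) : Prop where
  eq_zero : ∀ a b : ℤ, a ≠ b → ∀ f : E⟦a⟧ ⟶ E⟦b⟧, f = 0
  exists_smul : ∀ (a : ℤ) (f : E⟦a⟧ ⟶ E⟦a⟧), ∃ c : K, f = c • 𝟙 _
  id_ne_zero : 𝟙 E ≠ 0

variable {K}

/-- A form of Schur's lemma: the graded endomorphism ring is `K` in degree zero, so a nonzero map is
an invertible scalar. All later splittings rest on this. -/
lemma IsExc.isIso {E : T} (hE : IsExc K E) {a b : ℤ} (f : E⟦a⟧ ⟶ E⟦b⟧) (hf : f ≠ 0) :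
    a = b ∧ IsIso f := by
  have hab : a = b := by
    by_contra h
    exact hf (hE.eq_zero a b h f)
  subst hab
  obtain ⟨c, rfl⟩ := hE.exists_smul a f
  have hc : c ≠ 0 := by
    rintro rfl
    exact hf (zero_smul _ _)
  exact ⟨rfl, ⟨c⁻¹ • 𝟙 _, by simp [smul_smul, hc], by simp [smul_smul, hc]⟩⟩

lemma isExc_of_isExceptional [∀ n : ℤ, (shiftFunctor T n).Linear K] {E : T}
    (hE : IsExceptional K E) : IsExc K E where
  eq_zero a b hab f := by
    have := hE.1 (b - a) (by lia)
    apply (shiftHomEquiv K E (E⟦b⟧) a (-a) (by lia)).injective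
    rw [← cancel_mono ((shiftFunctorAdd' T b (-a) (b - a) (by lia)).inv.app E)]
    exact Subsingleton.elim _ _
  exists_smul a f := by
    obtain ⟨g, rfl⟩ := (shiftFunctor T a).map_surjective f
    have h1 : 𝟙 E ≠ 0 := fun h => by
      have : Subsingleton (E ⟶ E) := ⟨fun x y => by
        rw [← Category.comp_id x, ← Category.comp_id y, h, comp_zero, comp_zero]⟩
      have := Module.finrank_zero_of_subsingleton (R := K) (M := E ⟶ E)
      have := hE.2
      lia
    obtain ⟨c, hc⟩ := (finrank_eq_one_iff_of_nonzero' _ h1).1 hE.2 g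
    exact ⟨c, by rw [← hc, Functor.Linear.map_smul, CategoryTheory.Functor.map_id]⟩
  id_ne_zero h := by
    have : Subsingleton (E ⟶ E) := ⟨fun x y => by
      rw [← Category.comp_id x, ← Category.comp_id y, h, comp_zero, comp_zero]⟩
    have := Module.finrank_zero_of_subsingleton (R := K) (M := E ⟶ E)
    have := hE.2
    lia

lemma IsExc.isExceptional [∀ n : ℤ, (shiftFunctor T n).Linear K] {E : T}
    (hE : IsExc K E) : IsExceptional K E where
  left i hi := ⟨fun f g => by
    rw [← cancel_epi ((shiftFunctorZero T ℤ).hom.app E)]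
    exact (hE.eq_zero _ _ hi.symm _).trans (hE.eq_zero _ _ hi.symm _).symm⟩
  right := by
    refine (finrank_eq_one_iff_of_nonzero' _ hE.id_ne_zero).2 fun g => ?_
    obtain ⟨c, hc⟩ := hE.exists_smul 0 (g⟦0⟧')
    refine ⟨c, (shiftFunctor T (0 : ℤ)).map_injective ?_⟩
    rw [hc, Functor.Linear.map_smul, CategoryTheory.Functor.map_id]

lemma IsExc.id_shift_ne_zero {E : T} (hE : IsExc K E) (a : ℤ) : 𝟙 (E⟦a⟧) ≠ 0 := by
  rw [← CategoryTheory.Functor.map_id]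
  exact fun h => hE.id_ne_zero ((Functor.map_eq_zero_iff _).1 h)

lemma IsExc.of_iso {E E' : T} (hE : IsExc K E) (e : E ≅ E') : IsExc K E' where
  eq_zero a b hab f := by
    have := hE.eq_zero a b hab (e.hom⟦a⟧' ≫ f ≫ e.inv⟦b⟧')
    rwa [Preadditive.IsIso.comp_left_eq_zero, Preadditive.IsIso.comp_right_eq_zero] at this
  exists_smul a f := by
    obtain ⟨c, hc⟩ := hE.exists_smul a (e.hom⟦a⟧' ≫ f ≫ e.inv⟦a⟧')
    refine ⟨c, ?_⟩
    rw [← cancel_epi (e.hom⟦a⟧'), ← cancel_mono (e.inv⟦a⟧'), Category.assoc, hc]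
    simp [← Functor.map_comp]
  id_ne_zero h := hE.id_ne_zero (by
    rw [← e.hom_inv_id, ← Category.id_comp e.inv, h, zero_comp, comp_zero])

variable [Pretriangulated T]

/-- Some component of `f` is nonzero, hence invertible by `IsExc.isIso`, and its inverse gives the
retraction. -/
lemma FiniteSum.exists_retraction {E X : T} (hE : IsExc K E)
    (hX : FiniteSum (shiftsIn E Set.univ) X) {a : ℤ} (f : E⟦a⟧ ⟶ X) (hf : f ≠ 0) :
    ∃ r : X ⟶ E⟦a⟧, f ≫ r = 𝟙 _ := by
  induction hX with
  | zero hX => exact (hf (hX.eq_of_tgt _ _)).elim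
  | add h _ e ih =>
    obtain ⟨n, -, ⟨i⟩⟩ := h
    by_cases h1 : (f ≫ e.hom) ≫ biprod.fst = 0
    · obtain ⟨r, hr⟩ := ih ((f ≫ e.hom) ≫ biprod.snd) fun h2 => hf <| by
        rw [← cancel_mono e.hom, zero_comp]
        ext
        · rw [h1, zero_comp]
        · rw [h2, zero_comp]
      exact ⟨e.hom ≫ biprod.snd ≫ r, by simpa using hr⟩
    · have := (hE.isIso (((f ≫ e.hom) ≫ biprod.fst) ≫ i.hom)
        (by rwa [Ne, Preadditive.IsIso.comp_right_eq_zero])).2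
      exact ⟨e.hom ≫ biprod.fst ≫ i.hom ≫ inv (((f ≫ e.hom) ≫ biprod.fst) ≫ i.hom), by
        rw [← IsIso.hom_inv_id (((f ≫ e.hom) ≫ biprod.fst) ≫ i.hom)]
        simp only [Category.assoc]⟩

lemma FiniteSum.exists_section {E X : T} (hE : IsExc K E)
    (hX : FiniteSum (shiftsIn E Set.univ) X) {a : ℤ} (f : X ⟶ E⟦a⟧) (hf : f ≠ 0) :
    ∃ s : E⟦a⟧ ⟶ X, s ≫ f = 𝟙 _ := by
  induction hX with
  | zero hX => exact (hf (hX.eq_of_src _ _)).elim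
  | add h _ e ih =>
    obtain ⟨n, -, ⟨i⟩⟩ := h
    by_cases h1 : biprod.inl ≫ e.inv ≫ f = 0
    · obtain ⟨r, hr⟩ := ih (biprod.inr ≫ e.inv ≫ f) fun h2 => hf <| by
        rw [← cancel_epi e.inv, comp_zero]
        ext
        · rw [h1, comp_zero]
        · rw [h2, comp_zero]
      exact ⟨r ≫ biprod.inr ≫ e.inv, by simpa using hr⟩
    · have := (hE.isIso (i.inv ≫ biprod.inl ≫ e.inv ≫ f)
        (by rwa [Ne, Preadditive.IsIso.comp_left_eq_zero])).2
      exact ⟨inv (i.inv ≫ biprod.inl ≫ e.inv ≫ f) ≫ i.inv ≫ biprod.inl ≫ e.inv, by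
        simp⟩

/-! ### Finiteness of morphism spaces and approximation -/

variable (K)

/-- The graded space of morphisms from `E` to `X` has finite total dimension. -/
def HomFinite (E X : T) : Prop :=
  (∀ n : ℤ, FiniteDimensional K (E⟦n⟧ ⟶ X)) ∧ {n : ℤ | Module.finrank K (E⟦n⟧ ⟶ X) ≠ 0}.Finite

/-- The total dimension of the graded space of morphisms from `E` to `X`. -/
noncomputable def totalDim (E X : T) : ℕ := ∑ᶠ n : ℤ, Module.finrank K (E⟦n⟧ ⟶ X)

omit [Pretriangulated T] in
lemma _root_.IsProperCat.homFinite [∀ n : ℤ, (shiftFunctor T n).Linear K] (hT : IsProperCat K T)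
    (E X : T) : HomFinite K E X := by
  have e (n : ℤ) := shiftHomEquiv K E X n (-n) (by lia)
  refine ⟨fun n => ?_, ?_⟩
  · have := (hT E X).1 (-n)
    exact (e n).symm.finiteDimensional
  · refine ((hT E X).2.preimage (f := fun n : ℤ => -n) neg_injective.injOn).subset fun n hn => ?_
    simpa [← (e n).finrank_eq] using hn

variable {K}

lemma HomFinite.of_surjective {E X X' : T} (h : HomFinite K E X) (g : X ⟶ X')
    (hg : ∀ (n : ℤ) (u : E⟦n⟧ ⟶ X'), ∃ u', u = u' ≫ g) : HomFinite K E X' := by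
  have hs (n : ℤ) : Function.Surjective (Linear.rightComp K (E⟦n⟧) g) := fun u =>
    (hg n u).imp fun _ h => h.symm
  have := h.1
  refine ⟨fun n => .of_surjective _ (hs n), h.2.subset fun n hn => ?_⟩
  have := LinearMap.finrank_le_finrank_of_surjective (hs n)
  simp only [Set.mem_ofPred_eq, ne_eq] at hn ⊢
  lia

/-- Composition with `g` is onto in every degree and kills `f` in degree `a`, so the dimension drops
there. This measure drives the inductions below. -/
lemma HomFinite.totalDim_lt {E X X' : T} (h : HomFinite K E X) (g : X ⟶ X')
    (hg : ∀ (n : ℤ) (u : E⟦n⟧ ⟶ X'), ∃ u', u = u' ≫ g) {a : ℤ} (f : E⟦a⟧ ⟶ X) (hf : f ≠ 0)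
    (hfg : f ≫ g = 0) : totalDim K E X' < totalDim K E X := by
  have hs (n : ℤ) : Function.Surjective (Linear.rightComp K (E⟦n⟧) g) := fun u =>
    (hg n u).imp fun _ h => h.symm
  have := h.1
  have hle (n : ℤ) := LinearMap.finrank_le_finrank_of_surjective (hs n)
  have hlt : Module.finrank K (E⟦a⟧ ⟶ X') < Module.finrank K (E⟦a⟧ ⟶ X) := by
    refine lt_of_le_of_ne (hle a) fun heq => hf ?_
    have := (h.of_surjective g hg).1
    have hi := (LinearMap.injective_iff_surjective_of_finrank_eq_finrank heq.symm).2 (hs a)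
    exact hi (by simpa using hfg)
  have ha : a ∈ h.2.toFinset := by simpa using (by lia : Module.finrank K (E⟦a⟧ ⟶ X) ≠ 0)
  have hsub (n : ℤ) (hn : Module.finrank K (E⟦n⟧ ⟶ X') ≠ 0) :
      Module.finrank K (E⟦n⟧ ⟶ X) ≠ 0 := by
    have := hle n
    lia
  rw [totalDim, totalDim, finsum_eq_sum_of_support_subset (s := h.2.toFinset) _
      (fun n hn => by simpa using hsub n hn),
    finsum_eq_sum_of_support_subset (s := h.2.toFinset) _ (fun n hn => by simpa using hn)]
  exact Finset.sum_lt_sum (fun n _ => hle n) ⟨a, ha, hlt⟩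

variable [IsTriangulated T]

/-- Nonzero maps from shifts of `E` are removed one at a time by passing to cones. The total
dimension drops, so this ends at an object orthogonal to `E`; the octahedral axiom assembles the
removed pieces into `Y`. -/
lemma exists_approximation {E : T} (hE : IsExc K E) (X : T) (hX : HomFinite K E X) :
    ∃ (Y Z : T) (f : Y ⟶ X) (g : X ⟶ Z) (h : Z ⟶ Y⟦(1 : ℤ)⟧), Triangle.mk f g h ∈ distTriang T ∧
      FiniteSum (shiftsIn E Set.univ) Y ∧ rightPerp E Z := by
  obtain ⟨N, hN⟩ : ∃ N, totalDim K E X = N := ⟨_, rfl⟩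
  induction N using Nat.strong_induction_on generalizing X with
  | _ N ih =>
  by_cases hperp : rightPerp E X
  · refine ⟨0, X, 0, 𝟙 X, 0, ?_, .zero (isZero_zero T), hperp⟩
    exact contractible_distinguished₁ X
  obtain ⟨a, f, hf⟩ : ∃ (a : ℤ) (f : E⟦a⟧ ⟶ X), f ≠ 0 := by
    simpa [rightPerp] using hperp
  obtain ⟨X', g, δ, hT⟩ := distinguished_cocone_triangle f
  have hfg : f ≫ g = 0 := comp_distTriang_mor_zero₁₂ _ hT
  have hδ : δ ≫ f⟦1⟧' = 0 := comp_distTriang_mor_zero₃₁ _ hT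
  let i : E⟦a + 1⟧ ≅ E⟦a⟧⟦(1 : ℤ)⟧ := (shiftFunctorAdd T a 1).app E
  -- The obstruction to lifting `u` is a map `E⟦n⟧ ⟶ E⟦a⟧⟦1⟧`. If nonzero it is invertible, and then
  -- `δ ≫ f⟦1⟧' = 0` forces `f = 0`.
  have hg : ∀ (n : ℤ) (u : E⟦n⟧ ⟶ X'), ∃ u', u = u' ≫ g := fun n u => by
    refine Triangle.coyoneda_exact₃ _ hT u ?_
    by_contra hu
    have hi : IsIso ((u ≫ δ) ≫ i.inv) := (hE.isIso ((u ≫ δ) ≫ i.inv) (by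
      rw [Ne, Preadditive.IsIso.comp_right_eq_zero]
      exact hu)).2
    have : IsIso (u ≫ δ) := IsIso.of_isIso_comp_right _ i.inv
    have h0 : (u ≫ δ) ≫ f⟦1⟧' = 0 := by rw [Category.assoc, hδ, comp_zero]
    rw [Preadditive.IsIso.comp_left_eq_zero, Functor.map_eq_zero_iff] at h0
    exact hf h0
  obtain ⟨Y', Z, p, q, r, hT', hY', hZ⟩ := ih _ (hN ▸ hX.totalDim_lt g hg f hf hfg) X'
    (hX.of_surjective g hg) rfl
  obtain ⟨Y, y, s, hT''⟩ := distinguished_cocone_triangle₁ (g ≫ q)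
  have o := Triangulated.someOctahedron' rfl hT hT' hT''
  refine ⟨Y, Z, _, _, _, hT'', ?_, hZ⟩
  -- The same contradiction, now through a section of `p ≫ δ`. Vanishing of this map splits the
  -- octahedral triangle, so `Y` is `E⟦a⟧ ⊞ Y'`.
  have hpδ : p ≫ δ = 0 := by
    by_contra h
    obtain ⟨s, hs⟩ := hY'.exists_section hE ((p ≫ δ) ≫ i.inv)
      (by rwa [Ne, Preadditive.IsIso.comp_right_eq_zero])
    have h1 : i.hom = s ≫ p ≫ δ := by
      rw [← cancel_mono i.inv, i.hom_inv_id, ← hs]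
      simp only [Category.assoc]
    have h0 : i.hom ≫ f⟦1⟧' = 0 := by
      rw [h1]
      simp only [Category.assoc, hδ, comp_zero]
    rw [Preadditive.IsIso.comp_left_eq_zero, Functor.map_eq_zero_iff] at h0
    exact hf h0
  obtain ⟨e, -⟩ := exists_iso_binaryBiproduct_of_distTriang _ o.mem hpδ
  exact .add ⟨a, trivial, ⟨Iso.refl _⟩⟩ hY' e

end


section

variable {K : Type w} [Field K] {T : Type u} [Category.{v} T] [HasZeroObject T] [HasShift T ℤ]
  [Preadditive T] [Linear K T] [∀ n : ℤ, (shiftFunctor T n).Additive] [Pretriangulated T]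

/-! ### Admissible subcategories -/

/-- The subcategory `P` is right admissible: every object is an extension of an object right
orthogonal to `P` by an object of `P`. -/
def RightAdmissible (P : ObjectProperty T) : Prop :=
  ∀ X : T, ∃ (Y Z : T) (f : Y ⟶ X) (g : X ⟶ Z) (h : Z ⟶ Y⟦(1 : ℤ)⟧),
    Triangle.mk f g h ∈ distTriang T ∧ P Y ∧ ∀ W, P W → ∀ u : W ⟶ Z, u = 0

/-- If `X` is a retract of `W` in `P`, then `X ⟶ Z` factors through a map `W ⟶ Z` and vanishes.
Hence `𝟙 Z` factors through `Y⟦1⟧`, which lies in `P`, and so `Z = 0`. -/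
lemma RightAdmissible.isStableUnderRetracts {P : ObjectProperty T} (h : RightAdmissible P)
    (hP : IsTriSubcat P) : P.IsStableUnderRetracts where
  of_retract {X W} e hW := by
    have := hP.2
    obtain ⟨Y, Z, f, g, δ, hT, hY, hZ⟩ := h X
    have hg : g = 0 := by
      rw [← Category.id_comp g, ← e.retract, Category.assoc, hZ W hW (e.r ≫ g), comp_zero]
    have := hP.1
    have hz : IsZero Z := by
      obtain ⟨y, hy⟩ := Triangle.yoneda_exact₂ _ (rot_of_distTriang _ hT) (𝟙 Z)
        (show g ≫ 𝟙 Z = 0 by rw [hg, zero_comp])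
      rw [IsZero.iff_id_eq_zero, hy, hZ (Y⟦(1 : ℤ)⟧) (P.le_shift 1 _ hY) y]
      exact comp_zero
    have : IsIso f := (Triangle.isZero₃_iff_isIso₁ _ hT).1 hz
    exact P.prop_of_iso (asIso f) hY

lemma RightAdmissible.le_of_perp {P Q : ObjectProperty T} (h : RightAdmissible P)
    (hP : IsTriSubcat P) (hQ : IsTriSubcat Q) (hPQ : P ≤ Q)
    (hz : ∀ Z, Q Z → (∀ W, P W → ∀ u : W ⟶ Z, u = 0) → IsZero Z) : Q ≤ P := by
  intro X hX
  have := hQ.1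
  have := hQ.2
  have := hP.2
  obtain ⟨Y, Z, f, g, δ, hT, hY, hZ⟩ := h X
  have hz := hz Z (Q.ext_of_isTriangulatedClosed₃ _ hT (hPQ _ hY) hX) hZ
  have : IsIso f := (Triangle.isZero₃_iff_isIso₁ _ hT).1 hz
  exact P.prop_of_iso (asIso f) hY

lemma FiniteSum.shift {E X : T} (hX : FiniteSum (shiftsIn E Set.univ) X) (n : ℤ) :
    FiniteSum (shiftsIn E Set.univ) (X⟦n⟧) := by
  induction hX with
  | zero hX => exact .zero ((shiftFunctor T n).map_isZero hX)
  | add hE _ e ih =>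
    obtain ⟨m, -, ⟨i⟩⟩ := hE
    have := preservesBinaryBiproducts_of_preservesBiproducts (shiftFunctor T n)
    exact .add ⟨m + n, trivial, ⟨(shiftFunctor T n).mapIso i ≪≫
      ((shiftFunctorAdd T m n).app _).symm⟩⟩ ih ((shiftFunctor T n).mapIso e ≪≫
        (shiftFunctor T n).mapBiprod _ _)

lemma FiniteSum.triGenerated {E X : T} (hX : FiniteSum (shiftsIn E Set.univ) X) :
    triGenerated (fun Y => Y = E) X :=
  hX.le (isTriSubcat_triGenerated _) (shiftsIn_le (isTriSubcat_triGenerated _)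
    (le_triGenerated (fun Y => Y = E) _ rfl) _)

lemma FiniteSum.isZero_of_rightPerp {E X : T} (hX : FiniteSum (shiftsIn E Set.univ) X)
    (h : rightPerp E X) : IsZero X := by
  rw [IsZero.iff_id_eq_zero]
  refine hX.from_eq_zero ?_ _
  rintro E' ⟨n, -, ⟨i⟩⟩ f
  rw [← cancel_epi i.inv, h n (i.inv ≫ f), comp_zero]

/-- The orthogonal part of the approximation lies in ⟨E⟩ and is orthogonal to it, hence is zero. -/
lemma finiteSum_of_triGenerated [IsTriangulated T] {E : T} (hE : IsExc K E) {X : T}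
    (hf : HomFinite K E X) (hX : triGenerated (fun Y => Y = E) X) :
    FiniteSum (shiftsIn E Set.univ) X := by
  obtain ⟨Y, Z, f, g, δ, hT, hY, hZ⟩ := exists_approximation hE X hf
  have hg : g = 0 := eq_zero_of_triGenerated hX (by rintro _ rfl; exact hZ) g
  have hZ' : IsZero Z := by
    rw [IsZero.iff_id_eq_zero]
    exact eq_zero_of_triGenerated ((triGenerated (fun Y => Y = E)).ext_of_isTriangulatedClosed₃
      _ hT hY.triGenerated hX) (by rintro _ rfl; exact hZ) _
  have : IsIso f := (Triangle.isZero₃_iff_isIso₁ _ hT).1 hZ'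
  exact hY.of_iso (asIso f)

lemma rightAdmissible_of_isExc [IsTriangulated T] {E : T} (hE : IsExc K E)
    (hf : ∀ X, HomFinite K E X) : RightAdmissible (triGenerated (fun Y : T => Y = E)) := by
  intro X
  obtain ⟨Y, Z, f, g, δ, hT, hY, hZ⟩ := exists_approximation hE X (hf X)
  exact ⟨Y, Z, f, g, δ, hT, hY.triGenerated, fun W hW u =>
    eq_zero_of_triGenerated hW (by rintro _ rfl; exact hZ) u⟩

/-! ### Exceptional pairs -/

variable (K) in
/-- An exceptional pair. -/
structure ExcPair (E₁ E₂ : T) : Prop where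
  exc₁ : IsExc K E₁
  exc₂ : IsExc K E₂
  eq_zero : ∀ (a b : ℤ) (f : E₂⟦a⟧ ⟶ E₁⟦b⟧), f = 0

/-- The subcategory generated by two objects. -/
abbrev span (E₁ E₂ : T) : ObjectProperty T := triGenerated (fun X => X = E₁ ∨ X = E₂)

lemma span_left (E₁ E₂ : T) : span E₁ E₂ E₁ := le_triGenerated _ _ (Or.inl rfl)

lemma span_right (E₁ E₂ : T) : span E₁ E₂ E₂ := le_triGenerated _ _ (Or.inr rfl)

lemma span_le {P : ObjectProperty T} (hP : IsTriSubcat P) {E₁ E₂ : T} (h₁ : P E₁) (h₂ : P E₂) :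
    span E₁ E₂ ≤ P :=
  triGenerated_le hP (by rintro _ (rfl | rfl) <;> assumption)

lemma eq_zero_of_span {E₁ E₂ Y Z : T} (hY : span E₁ E₂ Y) (h₁ : rightPerp E₁ Z)
    (h₂ : rightPerp E₂ Z) (f : Y ⟶ Z) : f = 0 :=
  eq_zero_of_triGenerated hY (by rintro _ (rfl | rfl) <;> assumption) f

lemma ExcPair.rightPerp_of_finiteSum {E₁ E₂ : T} (h : ExcPair K E₁ E₂) {X : T}
    (hX : FiniteSum (shiftsIn E₁ Set.univ) X) : rightPerp E₂ X := by
  refine hX.le (isTriSubcat_rightPerp E₂) ?_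
  rintro X ⟨n, -, ⟨e⟩⟩ a f
  rw [← cancel_mono e.hom, h.eq_zero a n (f ≫ e.hom), zero_comp]

variable [IsTriangulated T] {E₁ E₂ : T}

/-- The order of the two steps matters: since nothing maps from shifts of `E₂` to shifts of `E₁`,
removing the `E₁`-part afterwards keeps the remainder orthogonal to `E₂`. -/
lemma ExcPair.exists_approximation (h : ExcPair K E₁ E₂) (hf₁ : ∀ X, HomFinite K E₁ X)
    (hf₂ : ∀ X, HomFinite K E₂ X) (X : T) :
    ∃ (B Z₂ A Z : T) (f₂ : B ⟶ X) (g₂ : X ⟶ Z₂) (δ₂ : Z₂ ⟶ B⟦(1 : ℤ)⟧)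
      (f₁ : A ⟶ Z₂) (g₁ : Z₂ ⟶ Z) (δ₁ : Z ⟶ A⟦(1 : ℤ)⟧),
      Triangle.mk f₂ g₂ δ₂ ∈ distTriang T ∧ Triangle.mk f₁ g₁ δ₁ ∈ distTriang T ∧
      FiniteSum (shiftsIn E₁ Set.univ) A ∧ FiniteSum (shiftsIn E₂ Set.univ) B ∧
      rightPerp E₁ Z ∧ rightPerp E₂ Z := by
  obtain ⟨B, Z₂, f₂, g₂, δ₂, hT₂, hB, hZ₂⟩ := LinTri.exists_approximation h.exc₂ X (hf₂ X)
  obtain ⟨A, Z, f₁, g₁, δ₁, hT₁, hA, hZ⟩ := LinTri.exists_approximation h.exc₁ Z₂ (hf₁ Z₂)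
  have := (isTriSubcat_rightPerp E₂).1
  have := (isTriSubcat_rightPerp E₂).2
  exact ⟨B, Z₂, A, Z, f₂, g₂, δ₂, f₁, g₁, δ₁, hT₂, hT₁, hA, hB, hZ,
    (rightPerp E₂).ext_of_isTriangulatedClosed₃ _ hT₁ (h.rightPerp_of_finiteSum hA) hZ₂⟩

lemma finiteSum_span_left {X : T} (hX : FiniteSum (shiftsIn E₁ Set.univ) X) : span E₁ E₂ X :=
  hX.le (isTriSubcat_triGenerated _)
    (shiftsIn_le (isTriSubcat_triGenerated _) (span_left E₁ E₂) _)

lemma finiteSum_span_right {X : T} (hX : FiniteSum (shiftsIn E₂ Set.univ) X) : span E₁ E₂ X :=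
  hX.le (isTriSubcat_triGenerated _)
    (shiftsIn_le (isTriSubcat_triGenerated _) (span_right E₁ E₂) _)

lemma ExcPair.rightAdmissible (h : ExcPair K E₁ E₂) (hf₁ : ∀ X, HomFinite K E₁ X)
    (hf₂ : ∀ X, HomFinite K E₂ X) : RightAdmissible (span E₁ E₂) := by
  intro X
  obtain ⟨B, Z₂, A, Z, f₂, g₂, δ₂, f₁, g₁, δ₁, hT₂, hT₁, hA, hB, hZ₁, hZ₂⟩ :=
    h.exists_approximation hf₁ hf₂ X
  obtain ⟨Y, y, s, hT⟩ := distinguished_cocone_triangle₁ (g₂ ≫ g₁)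
  have o := Triangulated.someOctahedron' rfl hT₂ hT₁ hT
  exact ⟨Y, Z, _, _, _, hT, (span E₁ E₂).ext_of_isTriangulatedClosed₂ _ o.mem
    (finiteSum_span_right hB) (finiteSum_span_left hA), fun W hW u => eq_zero_of_span hW hZ₁ hZ₂ u⟩

/-- The remainder of the two-step approximation lies in the span and is orthogonal to both
generators, so it vanishes. Rotating `B ⟶ X ⟶ Z₂` backwards then makes `X` a cone; the `E₁`-part
gets shifted by -1. -/
lemma ExcPair.exists_triangle (h : ExcPair K E₁ E₂) (hf₁ : ∀ X, HomFinite K E₁ X)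
    (hf₂ : ∀ X, HomFinite K E₂ X) {X : T} (hX : span E₁ E₂ X) :
    ∃ (A B : T) (φ : A ⟶ B) (ψ : B ⟶ X) (δ : X ⟶ A⟦(1 : ℤ)⟧), Triangle.mk φ ψ δ ∈ distTriang T ∧
      FiniteSum (shiftsIn E₁ Set.univ) A ∧ FiniteSum (shiftsIn E₂ Set.univ) B := by
  obtain ⟨B, Z₂, A, Z, f₂, g₂, δ₂, f₁, g₁, δ₁, hT₂, hT₁, hA, hB, hZ₁, hZ₂⟩ :=
    h.exists_approximation hf₁ hf₂ X
  have hZ : IsZero Z := by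
    rw [IsZero.iff_id_eq_zero]
    refine eq_zero_of_span ?_ hZ₁ hZ₂ _
    refine (span E₁ E₂).ext_of_isTriangulatedClosed₃ _ hT₁ (finiteSum_span_left hA) ?_
    exact (span E₁ E₂).ext_of_isTriangulatedClosed₃ _ hT₂ (finiteSum_span_right hB) hX
  have : IsIso f₁ := (Triangle.isZero₃_iff_isIso₁ _ hT₁).1 hZ
  exact ⟨_, _, _, _, _, inv_rot_of_distTriang _ hT₂, (hA.of_iso (asIso f₁)).shift (-1), hB⟩

end

/-- A retraction of morphisms induces a retraction of their cones. -/
lemma exists_retract_cone {T : Type u} [Category.{v} T] [HasZeroObject T] [HasShift T ℤ]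
    [Preadditive T] [∀ n : ℤ, (shiftFunctor T n).Additive] [Pretriangulated T]
    {A B C A' B' C' : T} {u : A ⟶ B} {v : B ⟶ C} {w : C ⟶ A⟦(1 : ℤ)⟧} {u' : A' ⟶ B'}
    {v' : B' ⟶ C'} {w' : C' ⟶ A'⟦(1 : ℤ)⟧} (hD : Triangle.mk u v w ∈ distTriang T)
    (hD' : Triangle.mk u' v' w' ∈ distTriang T) (a : A ⟶ A') (b : B ⟶ B') (a' : A' ⟶ A)
    (b' : B' ⟶ B) (h : u ≫ b = a ≫ u') (h' : u' ≫ b' = a' ≫ u)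
    (ha : a ≫ a' = 𝟙 _) (hb : b ≫ b' = 𝟙 _) : Nonempty (Retract C C') := by
  let F := completeDistinguishedTriangleMorphism _ _ hD hD' a b h
  let G := completeDistinguishedTriangleMorphism _ _ hD' hD a' b' h'
  let c : C ⟶ C' := F.hom₃
  let c' : C' ⟶ C := G.hom₃
  have : IsIso (c ≫ c') := isIso₃_of_isIso₁₂ (F ≫ G) hD hD
    (by change IsIso (a ≫ a'); rw [ha]; infer_instance)
    (by change IsIso (b ≫ b'); rw [hb]; infer_instance)
  exact ⟨⟨c, c' ≫ inv (c ≫ c'), by rw [← Category.assoc, IsIso.hom_inv_id]⟩⟩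


/-! ### Hereditary exceptional pairs: splitting objects into indecomposables -/

section

variable {K : Type w} [Field K] {T : Type u} [Category.{v} T] [HasZeroObject T] [HasShift T ℤ]
  [Preadditive T] [Linear K T] [∀ n : ℤ, (shiftFunctor T n).Additive] [Pretriangulated T]

/-- Only the summands of `B` with shift `a` receive nonzero maps from `E₁⟦a⟧`, and each such
component is a multiple of `u`. -/
lemma FiniteSum.exists_lift {E₁ E₂ B : T} (hB : FiniteSum (shiftsIn E₂ Set.univ) B) {a : ℤ}
    (u : E₁⟦a⟧ ⟶ E₂⟦a⟧) (hne : ∀ b, a ≠ b → ∀ f : E₁⟦a⟧ ⟶ E₂⟦b⟧, f = 0)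
    (hu : ∀ f : E₁⟦a⟧ ⟶ E₂⟦a⟧, ∃ c : K, f = c • u) (f : E₁⟦a⟧ ⟶ B) :
    ∃ g : E₂⟦a⟧ ⟶ B, f = u ≫ g := by
  induction hB with
  | zero hX => exact ⟨0, hX.eq_of_tgt _ _⟩
  | add h _ e ih =>
    obtain ⟨n, -, ⟨i⟩⟩ := h
    obtain ⟨g₂, hg₂⟩ := ih (f ≫ e.hom ≫ biprod.snd)
    obtain ⟨g₁, hg₁⟩ : ∃ g, f ≫ e.hom ≫ biprod.fst = u ≫ g := by
      by_cases hn : a = n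
      · subst hn
        obtain ⟨c, hc⟩ := hu ((f ≫ e.hom ≫ biprod.fst) ≫ i.hom)
        refine ⟨c • i.inv, ?_⟩
        rw [← cancel_mono i.hom, hc]
        simp
      · refine ⟨0, ?_⟩
        rw [← cancel_mono i.hom, hne n hn ((f ≫ e.hom ≫ biprod.fst) ≫ i.hom)]
        simp
    refine ⟨biprod.lift g₁ g₂ ≫ e.inv, ?_⟩
    rw [← cancel_mono e.hom]
    ext
    · simpa using hg₁
    · simpa using hg₂

lemma FiniteSum.exists_desc {E₁ E₂ A : T} (hA : FiniteSum (shiftsIn E₁ Set.univ) A) {a : ℤ}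
    (u : E₁⟦a⟧ ⟶ E₂⟦a⟧) (hne : ∀ b, b ≠ a → ∀ f : E₁⟦b⟧ ⟶ E₂⟦a⟧, f = 0)
    (hu : ∀ f : E₁⟦a⟧ ⟶ E₂⟦a⟧, ∃ c : K, f = c • u) (f : A ⟶ E₂⟦a⟧) :
    ∃ g : A ⟶ E₁⟦a⟧, f = g ≫ u := by
  induction hA with
  | zero hX => exact ⟨0, hX.eq_of_src _ _⟩
  | add h _ e ih =>
    obtain ⟨n, -, ⟨i⟩⟩ := h
    obtain ⟨g₂, hg₂⟩ := ih (biprod.inr ≫ e.inv ≫ f)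
    obtain ⟨g₁, hg₁⟩ : ∃ g, biprod.inl ≫ e.inv ≫ f = g ≫ u := by
      by_cases hn : n = a
      · subst hn
        obtain ⟨c, hc⟩ := hu (i.inv ≫ biprod.inl ≫ e.inv ≫ f)
        refine ⟨c • i.hom, ?_⟩
        rw [← cancel_epi i.inv, hc]
        simp
      · refine ⟨0, ?_⟩
        rw [← cancel_epi i.inv, hne n hn (i.inv ≫ biprod.inl ≫ e.inv ≫ f)]
        simp
    refine ⟨e.hom ≫ biprod.desc g₁ g₂, ?_⟩
    rw [← cancel_epi e.inv]
    ext
    · simpa using hg₁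
    · simpa using hg₂

variable (K) in
/-- An exceptional pair whose morphisms are concentrated in degree zero. -/
structure HeredPair (E₁ E₂ : T) : Prop extends ExcPair K E₁ E₂ where
  hom_eq_zero : ∀ (a b : ℤ), a ≠ b → ∀ f : E₁⟦a⟧ ⟶ E₂⟦b⟧, f = 0

lemma FiniteSum.exists_ne_zero {E X : T} (hX : FiniteSum (shiftsIn E Set.univ) X)
    (h : ¬ IsZero X) : ∃ (a : ℤ) (f : E⟦a⟧ ⟶ X), f ≠ 0 := by
  by_contra! h'
  exact h (hX.isZero_of_rightPerp h')

lemma FiniteSum.exists_ne_zero' {E X : T} (hX : FiniteSum (shiftsIn E Set.univ) X)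
    (h : ¬ IsZero X) : ∃ (a : ℤ) (f : X ⟶ E⟦a⟧), f ≠ 0 := by
  by_contra! h'
  refine h ((IsZero.iff_id_eq_zero X).2 (hX.to_eq_zero ?_ _))
  rintro E' ⟨n, -, ⟨i⟩⟩ f
  rw [← cancel_mono i.hom, h' n (f ≫ i.hom), zero_comp]

/-- The members of the family `E₁, E₂, E₃`, where `E₃` is discarded if `h` vanishes. -/
def tripleOf {E₁ E₂ : T} (h : E₁ ⟶ E₂) (E₃ : T) : ObjectProperty T :=
  fun X => X = E₁ ∨ X = E₂ ∨ (h ≠ 0 ∧ X = E₃)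

/-- Normal form of the matrix `φ`: a kernel vector, a cokernel vector, or else an identity block.
The three cases yield `E₁`, `E₂` and `E₃` as retracts up to shift. -/
lemma HeredPair.exists_retract {E₁ E₂ E₃ : T} (hE : HeredPair K E₁ E₂) {h : E₁ ⟶ E₂}
    {g : E₂ ⟶ E₃} {d : E₃ ⟶ E₁⟦(1 : ℤ)⟧} (hh : Triangle.mk h g d ∈ distTriang T)
    (hspan : ∀ (a : ℤ) (f : E₁⟦a⟧ ⟶ E₂⟦a⟧), ∃ c : K, f = c • h⟦a⟧')
    {A B X : T} {φ : A ⟶ B} {ψ : B ⟶ X} {δ : X ⟶ A⟦(1 : ℤ)⟧}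
    (hT : Triangle.mk φ ψ δ ∈ distTriang T) (hA : FiniteSum (shiftsIn E₁ Set.univ) A)
    (hB : FiniteSum (shiftsIn E₂ Set.univ) B) (hX : ¬ IsZero X) :
    ∃ E, tripleOf h E₃ E ∧ ∃ a : ℤ, Nonempty (Retract (E⟦a⟧) X) := by
  by_cases h₁ : ∃ (a : ℤ) (f : E₁⟦a⟧ ⟶ A), f ≠ 0 ∧ f ≫ φ = 0
  · obtain ⟨a, f, hf, hfφ⟩ := h₁
    obtain ⟨r, hr⟩ := hA.exists_retraction hE.exc₁ f hf
    obtain ⟨t, ht⟩ : ∃ t : E₁⟦a⟧⟦(1 : ℤ)⟧ ⟶ X, f⟦1⟧' = t ≫ δ :=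
      -- A kernel vector of `φ` lifts along `δ`, so the summand of `X` is `E₁` shifted by `a + 1`,
      -- not by `a`.
      Triangle.coyoneda_exact₁ _ hT (f⟦1⟧') (by
        change f⟦1⟧' ≫ φ⟦1⟧' = 0
        rw [← CategoryTheory.Functor.map_comp, hfφ, Functor.map_zero])
    let i : E₁⟦a + 1⟧ ≅ E₁⟦a⟧⟦(1 : ℤ)⟧ := (shiftFunctorAdd T a 1).app E₁
    refine ⟨E₁, Or.inl rfl, a + 1, ⟨i.hom ≫ t, δ ≫ r⟦1⟧' ≫ i.inv, ?_⟩⟩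
    rw [Category.assoc, ← Category.assoc t, ← ht, ← Category.assoc (f⟦1⟧'),
      ← CategoryTheory.Functor.map_comp, hr]
    simp
  by_cases h₂ : ∃ (a : ℤ) (f : B ⟶ E₂⟦a⟧), f ≠ 0 ∧ φ ≫ f = 0
  · obtain ⟨a, f, hf, hfφ⟩ := h₂
    obtain ⟨s, hs⟩ := hB.exists_section hE.exc₂ f hf
    obtain ⟨t, ht⟩ : ∃ t : X ⟶ E₂⟦a⟧, f = ψ ≫ t := Triangle.yoneda_exact₂ _ hT f hfφ
    exact ⟨E₂, Or.inr (Or.inl rfl), a, ⟨s ≫ ψ, t, by rw [Category.assoc, ← ht, hs]⟩⟩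
  push Not at h₁ h₂
  -- In the remaining case `φ` has neither kernel nor cokernel vectors; were `A` zero, `X` would be
  -- `B` and any nonzero map from `B` to a shift of `E₂` would be a cokernel vector.
  have hAz : ¬ IsZero A := by
    intro hAz
    have : IsIso ψ := (Triangle.isZero₁_iff_isIso₂ _ hT).1 hAz
    have hBz : ¬ IsZero B := fun hB => hX (hB.of_iso (asIso ψ).symm)
    obtain ⟨a, f, hf⟩ := hB.exists_ne_zero' hBz
    exact h₂ a f hf (hAz.eq_of_src _ _)
  obtain ⟨a, f, hf⟩ := hA.exists_ne_zero hAz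
  -- Shifting a triangle by `a` multiplies its maps by the sign of `a`. The sign is absorbed into
  -- the scalar of `hspan`.
  let D : Triangle T := (Triangle.shiftFunctor T a).obj (Triangle.mk h g d)
  have hD : D ∈ distTriang T := Triangle.shift_distinguished _ hh a
  let u : E₁⟦a⟧ ⟶ E₂⟦a⟧ := D.mor₁
  have hu (f : E₁⟦a⟧ ⟶ E₂⟦a⟧) : ∃ c : K, f = c • u := by
    obtain ⟨c, hc⟩ := hspan a f
    have : u = a.negOnePow • h⟦a⟧' := rfl
    rcases Int.even_or_odd a with ha | ha
    · exact ⟨c, by rw [hc, this, Int.negOnePow_even a ha, one_smul]⟩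
    · exact ⟨-c, by rw [hc, this, Int.negOnePow_odd a ha]; simp [Units.smul_def]⟩
  obtain ⟨b, hb⟩ := hB.exists_lift u (fun n hn => hE.hom_eq_zero a n hn) hu (f ≫ φ)
  have hfφ := h₁ a f hf
  have hb0 : b ≠ 0 := by
    rintro rfl
    exact hfφ (by rw [hb, comp_zero])
  have hu0 : u ≠ 0 := by
    intro h0
    exact hfφ (by rw [hb, h0, zero_comp])
  obtain ⟨r, hr⟩ := hB.exists_retraction hE.exc₂ b hb0
  obtain ⟨q, hq⟩ := hA.exists_desc u (fun n hn => hE.hom_eq_zero n a hn) hu (φ ≫ r)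
  -- Comparing `u = u ≫ b ≫ r = f ≫ φ ≫ r = (f ≫ q) ≫ u` shows that the scalar `f ≫ q` is 1. Thus
  -- `u` is a retract of `φ`, and so is its cone.
  have hfq : f ≫ q = 𝟙 _ := by
    obtain ⟨c, hc⟩ := hE.exc₁.exists_smul a (f ≫ q)
    have h1 : u = c • u := by
      calc u = u ≫ b ≫ r := by rw [hr, Category.comp_id]
        _ = f ≫ φ ≫ r := by rw [← Category.assoc, ← hb, Category.assoc]
        _ = c • u := by rw [hq, ← Category.assoc, hc, Linear.smul_comp, Category.id_comp]
    have h2 : c = 1 := by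
      by_contra hne
      have h3 : (1 - c) • u = 0 := by rw [sub_smul, one_smul, ← h1, sub_self]
      rcases smul_eq_zero.1 h3 with h4 | h4
      · exact hne (sub_eq_zero.1 h4).symm
      · exact hu0 h4
    rw [hc, h2, one_smul]
  have hh0 : h ≠ 0 := by
    rintro rfl
    refine hu0 (?_ : a.negOnePow • (0 : E₁ ⟶ E₂)⟦a⟧' = 0)
    rw [Functor.map_zero, smul_zero]
  obtain ⟨R⟩ := exists_retract_cone (u := u) hD hT f b q r hb.symm hq hfq hr
  exact ⟨E₃, Or.inr (Or.inr ⟨hh0, rfl⟩), a, ⟨R⟩⟩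

lemma exists_iso_biprod_of_retract {E X : T} (R : Retract E X) :
    ∃ X', Nonempty (X ≅ E ⊞ X') :=
  exists_iso_biprod_of_comp_eq_id R.i R.r R.retract

lemma exists_ne_zero_of_span {E₁ E₂ X : T} (hX : span E₁ E₂ X) (h : ¬ IsZero X) :
    (∃ (a : ℤ) (f : E₁⟦a⟧ ⟶ X), f ≠ 0) ∨ ∃ (a : ℤ) (f : E₂⟦a⟧ ⟶ X), f ≠ 0 := by
  by_contra! h'
  exact h ((IsZero.iff_id_eq_zero X).2 (eq_zero_of_span hX h'.1 h'.2 _))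

lemma totalDim_le_of_surjective {E X X' : T} (h : HomFinite K E X) (g : X ⟶ X')
    (hg : ∀ (n : ℤ) (u : E⟦n⟧ ⟶ X'), ∃ u', u = u' ≫ g) :
    totalDim K E X' ≤ totalDim K E X := by
  by_cases hf : ∃ (a : ℤ) (f : E⟦a⟧ ⟶ X), f ≠ 0 ∧ f ≫ g = 0
  · obtain ⟨a, f, hf, hfg⟩ := hf
    exact (h.totalDim_lt g hg f hf hfg).le
  · push Not at hf
    refine (finsum_congr fun n => ?_).le
    refine (LinearEquiv.finrank_eq (LinearEquiv.ofBijective (Linear.rightComp K (E⟦n⟧) g)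
      ⟨?_, fun u => (hg n u).imp fun _ h => h.symm⟩)).symm
    refine (injective_iff_map_eq_zero _).2 fun f hfg => ?_
    by_contra hne
    exact hf n f hne hfg

variable [IsTriangulated T]

/-- Otherwise `h` would be invertible, but every map `E₂ ⟶ E₁` is zero. -/
lemma ExcPair.not_isZero_cone {E₁ E₂ E₃ : T} (hE : ExcPair K E₁ E₂) {h : E₁ ⟶ E₂}
    {g : E₂ ⟶ E₃} {d : E₃ ⟶ E₁⟦(1 : ℤ)⟧} (hh : Triangle.mk h g d ∈ distTriang T) :
    ¬ IsZero E₃ := by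
  intro h3
  have : IsIso h := (Triangle.isZero₃_iff_isIso₁ _ hh).1 h3
  have h0 : (inv h)⟦(0 : ℤ)⟧' = 0 := hE.eq_zero 0 0 _
  have h1 : inv h = 0 := (Functor.map_eq_zero_iff _).1 h0
  exact hE.exc₁.id_ne_zero (by rw [← IsIso.hom_inv_id h, h1, comp_zero])

lemma tripleOf_le {P : ObjectProperty T} (hP : IsTriSubcat P) {E₁ E₂ E₃ : T} {h : E₁ ⟶ E₂}
    {g : E₂ ⟶ E₃} {d : E₃ ⟶ E₁⟦(1 : ℤ)⟧} (hh : Triangle.mk h g d ∈ distTriang T)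
    (h₁ : P E₁) (h₂ : P E₂) : tripleOf h E₃ ≤ P := by
  have := hP.1
  have := hP.2
  rintro X (rfl | rfl | ⟨-, rfl⟩)
  · exact h₁
  · exact h₂
  · exact P.ext_of_isTriangulatedClosed₃ _ hh h₁ h₂

/-- Induction on the total dimension of maps from `E₁` and `E₂`. A split-off summand is nonzero and
lies in the span, so it receives a nonzero map from a shift of one of them, and the complement has
smaller dimension. -/
lemma HeredPair.finiteSum {E₁ E₂ E₃ : T} (hE : HeredPair K E₁ E₂)
    (hf₁ : ∀ X, HomFinite K E₁ X) (hf₂ : ∀ X, HomFinite K E₂ X) {h : E₁ ⟶ E₂}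
    {g : E₂ ⟶ E₃} {d : E₃ ⟶ E₁⟦(1 : ℤ)⟧} (hh : Triangle.mk h g d ∈ distTriang T)
    (hspan : ∀ (a : ℤ) (f : E₁⟦a⟧ ⟶ E₂⟦a⟧), ∃ c : K, f = c • h⟦a⟧')
    {X : T} (hX : span E₁ E₂ X) : FiniteSum (shiftsOf (tripleOf h E₃)) X := by
  obtain ⟨N, hN⟩ : ∃ N, totalDim K E₁ X + totalDim K E₂ X = N := ⟨_, rfl⟩
  induction N using Nat.strong_induction_on generalizing X with
  | _ N ih =>
  by_cases hz : IsZero X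
  · exact .zero hz
  obtain ⟨A, B, φ, ψ, δ, hT, hA, hB⟩ := hE.exists_triangle hf₁ hf₂ hX
  obtain ⟨E, hEm, a, ⟨R⟩⟩ := hE.exists_retract hh hspan hT hA hB hz
  obtain ⟨X', ⟨e⟩⟩ := exists_iso_biprod_of_retract R
  refine .add ⟨E, hEm, a, ⟨Iso.refl _⟩⟩ ?_ e
  have := (hE.rightAdmissible hf₁ hf₂).isStableUnderRetracts (isTriSubcat_triGenerated _)
  have hX' : span E₁ E₂ X' :=
    (span E₁ E₂).prop_of_retract ⟨biprod.inr ≫ e.inv, e.hom ≫ biprod.snd, by simp⟩ hX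
  have hEs : span E₁ E₂ E := tripleOf_le (isTriSubcat_triGenerated _) hh (span_left _ _)
    (span_right _ _) _ hEm
  have hEz : ¬ IsZero (E⟦a⟧) := by
    intro h0
    have h1 : 𝟙 E = 0 := by
      apply (shiftFunctor T a).map_injective
      exact h0.eq_of_src _ _
    rcases hEm with rfl | rfl | ⟨-, rfl⟩
    · exact hE.exc₁.id_ne_zero h1
    · exact hE.exc₂.id_ne_zero h1
    · exact hE.not_isZero_cone hh ((IsZero.iff_id_eq_zero _).2 h1)
  have hsurj (F : T) (n : ℤ) (u : F⟦n⟧ ⟶ X') : ∃ u', u = u' ≫ e.hom ≫ biprod.snd :=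
    ⟨u ≫ biprod.inr ≫ e.inv, by simp⟩
  refine ih _ ?_ hX' rfl
  have le₁ := totalDim_le_of_surjective (hf₁ X) _ (hsurj E₁)
  have le₂ := totalDim_le_of_surjective (hf₂ X) _ (hsurj E₂)
  have hlt {F : T} (hF : HomFinite K F X) {b : ℤ} (f : F⟦b⟧ ⟶ E⟦a⟧) (hf : f ≠ 0) :=
    hF.totalDim_lt _ (hsurj F) (f ≫ biprod.inl ≫ e.inv)
      (fun h => hf (by simpa using h =≫ (e.hom ≫ biprod.fst))) (by simp)
  rcases exists_ne_zero_of_span ((span E₁ E₂).le_shift a _ hEs) hEz with ⟨b, f, hf⟩ | ⟨b, f, hf⟩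
  · have := hlt (hf₁ X) f hf
    lia
  · have := hlt (hf₂ X) f hf
    lia

end


/-! ### Discrete subcategories and their intersections -/

section

variable {K : Type w} [Field K] {T : Type u} [Category.{v} T] [HasZeroObject T] [HasShift T ℤ]
  [Preadditive T] [Linear K T] [∀ n : ℤ, (shiftFunctor T n).Additive] [Pretriangulated T]

/-- The subcategory generated by one object. -/
abbrev point (E : T) : ObjectProperty T := triGenerated (fun X => X = E)

lemma point_self (E : T) : point E E := le_triGenerated (fun X => X = E) E rfl

lemma point_le {P : ObjectProperty T} (hP : IsTriSubcat P) {E : T} (h : P E) : point E ≤ P :=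
  triGenerated_le hP (by rintro _ rfl; exact h)

lemma point_shift_iso {E F : T} {a : ℤ} (e : F ≅ E⟦a⟧) : point F = point E := by
  refine le_antisymm (point_le (isTriSubcat_triGenerated _) ?_)
    (point_le (isTriSubcat_triGenerated _) ?_)
  · exact (point E).prop_of_iso e.symm ((point E).le_shift a _ (point_self E))
  · exact (prop_shift_iff (point F) E a).1 ((point F).prop_of_iso e (point_self F))

variable (K) in
/-- Every object of `A` is a finite direct sum of shifts of exceptional objects from `S`, and any
two members of `S` generate `A`. -/
structure IsDiscrete (A S : ObjectProperty T) : Prop where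
  isTriSubcat : IsTriSubcat A
  exc : ∀ E, S E → IsExc K E
  le : S ≤ A
  finiteSum : ∀ X, A X → FiniteSum (shiftsOf S) X
  span_eq : ∀ E F, S E → S F → E ≠ F → span E F = A
  not_mem : ∀ E F, S E → S F → E ≠ F → ¬ point E F

lemma FiniteSum.restrict {S P : ObjectProperty T} (hP : IsTriSubcat P)
    [P.IsStableUnderRetracts] {X : T} (hX : FiniteSum (shiftsOf S) X) (h : P X) :
    FiniteSum (shiftsOf (S ⊓ P)) X := by
  have := hP.1
  induction hX with
  | zero hX => exact .zero hX
  | add hE _ e ih =>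
    obtain ⟨E, hE, n, ⟨i⟩⟩ := hE
    refine .add ⟨E, ⟨hE, ?_⟩, n, ⟨i⟩⟩ (ih ?_) e
    · exact (prop_shift_iff P E n).1 (P.prop_of_iso i
        (P.prop_of_retract ⟨biprod.inl ≫ e.inv, e.hom ≫ biprod.fst, by simp⟩ h))
    · exact P.prop_of_retract ⟨biprod.inr ≫ e.inv, e.hom ≫ biprod.snd, by simp⟩ h

lemma isTriSubcat_inf {P Q : ObjectProperty T} (hP : IsTriSubcat P) (hQ : IsTriSubcat Q) :
    IsTriSubcat (P ⊓ Q) := by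
  have := hP.1
  have := hP.2
  have := hQ.1
  have := hQ.2
  exact ⟨inferInstance, ⟨fun e h => ⟨P.prop_of_iso e h.1, Q.prop_of_iso e h.2⟩⟩⟩

lemma isTriSubcat_isZero : IsTriSubcat (IsZero : T → Prop) :=
  ⟨isZeroIsTriangulated, ⟨fun e h => h.of_iso e.symm⟩⟩

/-- The cases are zero, one or at least two members of `S` in `P`. Closure under retracts puts every
summand of an object of `A ⊓ P` into `P`, and two members already generate `A`. -/
lemma IsDiscrete.inf_eq {A S : ObjectProperty T} (h : IsDiscrete K A S) {P : ObjectProperty T}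
    (hP : IsTriSubcat P) [P.IsStableUnderRetracts] :
    (A ⊓ P = fun X => IsZero X) ∨ (∃ E, S E ∧ A ⊓ P = point E) ∨ A ≤ P := by
  by_cases h₂ : ∃ E F, (S ⊓ P) E ∧ (S ⊓ P) F ∧ E ≠ F
  · obtain ⟨E, F, hE, hF, hne⟩ := h₂
    exact Or.inr (Or.inr (h.span_eq E F hE.1 hF.1 hne ▸ span_le hP hE.2 hF.2))
  push Not at h₂
  have hAP := isTriSubcat_inf h.isTriSubcat hP
  have := hAP.1
  have := hAP.2
  by_cases h₁ : ∃ E, (S ⊓ P) E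
  · obtain ⟨E, hE⟩ := h₁
    refine Or.inr (Or.inl ⟨E, hE.1, le_antisymm (fun X hX => ?_)
      (point_le hAP ⟨h.le _ hE.1, hE.2⟩)⟩)
    refine ((h.finiteSum X hX.1).restrict hP hX.2).le (isTriSubcat_triGenerated _)
      (shiftsOf_le (isTriSubcat_triGenerated _) fun F hF => ?_)
    exact h₂ F E hF hE ▸ point_self F
  · push Not at h₁
    refine Or.inl (le_antisymm (fun X hX => ?_) fun X hX => prop_of_isZero _ hX)
    exact ((h.finiteSum X hX.1).restrict hP hX.2).le isTriSubcat_isZero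
      (shiftsOf_le isTriSubcat_isZero fun F hF => (h₁ F hF).elim)

lemma IsExc.not_isZero_shift {E : T} (hE : IsExc K E) (a : ℤ) : ¬ IsZero (E⟦a⟧) :=
  fun h => hE.id_shift_ne_zero a (h.eq_of_src _ _)

lemma IsExc.exists_smul_id {E : T} [∀ n : ℤ, (shiftFunctor T n).Linear K] (hE : IsExc K E)
    (f : E ⟶ E) : ∃ c : K, f = c • 𝟙 E := by
  obtain ⟨c, hc⟩ := hE.exists_smul 0 (f⟦0⟧')
  refine ⟨c, (shiftFunctor T (0 : ℤ)).map_injective ?_⟩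
  rw [hc, Functor.Linear.map_smul, CategoryTheory.Functor.map_id]

variable [∀ n : ℤ, (shiftFunctor T n).Linear K]

/-- Exceptional objects are indecomposable: the idempotent cut out by the retract is a scalar fixing
the nonzero map `R.i`, so it is 1. -/
lemma IsExc.iso_of_retract {E F : T} (hE : IsExc K E) (R : Retract F E) (hF : ¬ IsZero F) :
    Nonempty (E ≅ F) := by
  obtain ⟨c, hc⟩ := hE.exists_smul_id (R.r ≫ R.i)
  have hi : R.i = c • R.i := by
    calc R.i = R.i ≫ R.r ≫ R.i := by rw [← Category.assoc, R.retract, Category.id_comp]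
      _ = c • R.i := by rw [hc, Linear.comp_smul, Category.comp_id]
  have h0 : R.i ≠ 0 := fun h => hF ((IsZero.iff_id_eq_zero F).2 (by
    rw [← R.retract, h, zero_comp]))
  have h1 : c = 1 := by
    by_contra hne
    have h3 : (1 - c) • R.i = 0 := by rw [sub_smul, one_smul, ← hi, sub_self]
    rcases smul_eq_zero.1 h3 with h4 | h4
    · exact hne (sub_eq_zero.1 h4).symm
    · exact h0 h4
  exact ⟨⟨R.r, R.i, by rw [hc, h1, one_smul], R.retract⟩⟩

lemma IsDiscrete.exists_point_eq {A S : ObjectProperty T} (h : IsDiscrete K A S) {E : T}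
    (hE : IsExc K E) (hA : A E) : ∃ F, S F ∧ ∃ a : ℤ, Nonempty (E ≅ F⟦a⟧) := by
  cases h.finiteSum E hA with
  | zero hz => exact (hE.id_ne_zero (hz.eq_of_src _ _)).elim
  | add hF _ e =>
    obtain ⟨F, hF, n, ⟨i⟩⟩ := hF
    obtain ⟨j⟩ := hE.iso_of_retract (F := F⟦n⟧)
      ⟨i.inv ≫ biprod.inl ≫ e.inv, e.hom ≫ biprod.fst ≫ i.hom, by simp⟩
      ((h.exc F hF).not_isZero_shift n)
    exact ⟨F, hF, n, ⟨j⟩⟩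

variable [IsTriangulated T]

lemma isDiscrete_point {E : T} (hE : IsExc K E) (hf : ∀ X, HomFinite K E X) :
    IsDiscrete K (point E) (fun X => X = E) where
  isTriSubcat := isTriSubcat_triGenerated _
  exc := by rintro _ rfl; exact hE
  le := le_triGenerated _
  finiteSum X hX := (finiteSum_of_triGenerated hE (hf X) hX).mono
    (by rintro Y ⟨n, -, e⟩; exact ⟨E, rfl, n, e⟩)
  span_eq := by rintro _ _ rfl rfl h; exact (h rfl).elim
  not_mem := by rintro _ _ rfl rfl h; exact (h rfl).elim

lemma isDiscrete_isZero : IsDiscrete K (fun X : T => IsZero X) (fun _ => False) where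
  isTriSubcat := isTriSubcat_isZero
  exc _ h := h.elim
  le _ h := h.elim
  finiteSum _ hX := .zero hX
  span_eq _ _ h := h.elim
  not_mem _ _ h := h.elim

lemma point_eq_of_mem {E F : T} (hE : IsExc K E) (hf : ∀ X, HomFinite K E X) (hF : IsExc K F)
    (h : point E F) : point F = point E := by
  obtain ⟨_, rfl, a, ⟨e⟩⟩ := (isDiscrete_point hE hf).exists_point_eq hF h
  exact point_shift_iso e

/-- Otherwise `E₂` would belong to its own right orthogonal, since `E₁` does, and its identity would
vanish. -/
lemma ExcPair.not_point_left {E₁ E₂ : T} (hE : ExcPair K E₁ E₂) : ¬ point E₁ E₂ := fun h => by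
  have : rightPerp E₂ E₂ := h _ (isTriSubcat_rightPerp E₂) (by
    rintro _ rfl a f
    rw [← cancel_mono ((shiftFunctorZero T ℤ).inv.app _),
      hE.eq_zero a 0 (f ≫ (shiftFunctorZero T ℤ).inv.app _), zero_comp])
  have h0 := this 0 ((shiftFunctorZero T ℤ).hom.app E₂ ≫ 𝟙 E₂)
  rw [Preadditive.IsIso.comp_left_eq_zero] at h0
  exact hE.exc₂.id_ne_zero h0

lemma ExcPair.not_point_right {E₁ E₂ : T} (hE : ExcPair K E₁ E₂) : ¬ point E₂ E₁ := fun h =>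
  hE.exc₁.id_ne_zero (eq_zero_of_triGenerated h (by
    rintro _ rfl a f
    rw [← cancel_mono ((shiftFunctorZero T ℤ).inv.app _),
      hE.eq_zero a 0 (f ≫ (shiftFunctorZero T ℤ).inv.app _), zero_comp]) _)

/-- Nothing maps from `E₁` to `E₃` in any degree (`hA`), so a map out of `E₃` is determined by its
restriction to `E₂` (`hB`). A map from `E₂` to `E₃` lifts to `E₂`, because nothing maps from `E₂` to
`E₁` (`hC`). The graded endomorphisms of `E₃` are thus controlled by those of `E₂`. -/
lemma HeredPair.isExc_cone {E₁ E₂ E₃ : T} (hE : HeredPair K E₁ E₂) {h : E₁ ⟶ E₂}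
    {g : E₂ ⟶ E₃} {d : E₃ ⟶ E₁⟦(1 : ℤ)⟧} (hh : Triangle.mk h g d ∈ distTriang T) (h0 : h ≠ 0)
    (hspan : ∀ (a : ℤ) (f : E₁⟦a⟧ ⟶ E₂⟦a⟧), ∃ c : K, f = c • h⟦a⟧') : IsExc K E₃ := by
  have key (a : ℤ) : ∃ (u : E₁⟦a⟧ ⟶ E₂⟦a⟧) (v : E₂⟦a⟧ ⟶ E₃⟦a⟧) (w : E₃⟦a⟧ ⟶ E₁⟦a⟧⟦(1 : ℤ)⟧),
      Triangle.mk u v w ∈ distTriang T ∧ u ≠ 0 ∧ ∀ f : E₁⟦a⟧ ⟶ E₂⟦a⟧, ∃ c : K, f = c • u := by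
    have hu0 : a.negOnePow • h⟦a⟧' ≠ 0 := fun h' => by
      rw [smul_eq_zero_iff_eq, Functor.map_eq_zero_iff] at h'
      exact h0 h'
    refine ⟨a.negOnePow • h⟦a⟧', _, _, Triangle.shift_distinguished _ hh a, hu0, fun f => ?_⟩
    obtain ⟨c, hc⟩ := hspan a f
    rcases Int.even_or_odd a with ha | ha
    · exact ⟨c, by rw [hc, Int.negOnePow_even a ha, one_smul]⟩
    · exact ⟨-c, by rw [hc, Int.negOnePow_odd a ha]; simp [Units.smul_def]⟩
  -- A nonzero `f ≫ w` would be invertible and kill `u`. So `f` lifts to `E₂⟦b⟧`, where it is zero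
  -- or a multiple of `u`, and `u ≫ v = 0`.
  have hA (a b : ℤ) (f : E₁⟦a⟧ ⟶ E₃⟦b⟧) : f = 0 := by
    obtain ⟨u, v, w, hT, hu0, hu⟩ := key b
    have huv : u ≫ v = 0 := comp_distTriang_mor_zero₁₂ _ hT
    let i : E₁⟦b + 1⟧ ≅ E₁⟦b⟧⟦(1 : ℤ)⟧ := (shiftFunctorAdd T b 1).app E₁
    have hfw : f ≫ w = 0 := by
      by_contra hne
      have := (hE.exc₁.isIso ((f ≫ w) ≫ i.inv)
        (by rwa [Ne, Preadditive.IsIso.comp_right_eq_zero])).2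
      have : IsIso (f ≫ w) := IsIso.of_isIso_comp_right _ i.inv
      have hwu : w ≫ u⟦1⟧' = 0 := comp_distTriang_mor_zero₃₁ _ hT
      have h1 : (f ≫ w) ≫ u⟦1⟧' = 0 := by rw [Category.assoc, hwu, comp_zero]
      rw [Preadditive.IsIso.comp_left_eq_zero, Functor.map_eq_zero_iff] at h1
      exact hu0 h1
    obtain ⟨f', rfl⟩ : ∃ f' : E₁⟦a⟧ ⟶ E₂⟦b⟧, f = f' ≫ v := Triangle.coyoneda_exact₃ _ hT f hfw
    by_cases hab : a = b
    · subst hab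
      obtain ⟨c, rfl⟩ := hu f'
      rw [Linear.smul_comp, huv, smul_zero]
    · rw [hE.hom_eq_zero a b hab f', zero_comp]
  have hB (a b : ℤ) (v : E₂⟦a⟧ ⟶ E₃⟦a⟧) (u : E₁⟦a⟧ ⟶ E₂⟦a⟧) (w : E₃⟦a⟧ ⟶ E₁⟦a⟧⟦(1 : ℤ)⟧)
      (hT : Triangle.mk u v w ∈ distTriang T) (f : E₃⟦a⟧ ⟶ E₃⟦b⟧) (hf : v ≫ f = 0) : f = 0 := by
    obtain ⟨k, rfl⟩ : ∃ k : E₁⟦a⟧⟦(1 : ℤ)⟧ ⟶ E₃⟦b⟧, f = w ≫ k :=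
      Triangle.yoneda_exact₃ _ hT f hf
    have hk : k = 0 := by
      rw [← cancel_epi ((shiftFunctorAdd T a 1).hom.app E₁),
        hA (a + 1) b ((shiftFunctorAdd T a 1).hom.app E₁ ≫ k), comp_zero]
    rw [hk, comp_zero]
  have hC (a b : ℤ) (f : E₂⟦a⟧ ⟶ E₃⟦b⟧) (u : E₁⟦b⟧ ⟶ E₂⟦b⟧) (v : E₂⟦b⟧ ⟶ E₃⟦b⟧)
      (w : E₃⟦b⟧ ⟶ E₁⟦b⟧⟦(1 : ℤ)⟧) (hT : Triangle.mk u v w ∈ distTriang T) :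
      ∃ f' : E₂⟦a⟧ ⟶ E₂⟦b⟧, f = f' ≫ v := by
    refine Triangle.coyoneda_exact₃ _ hT f ?_
    change f ≫ w = 0
    rw [← cancel_mono ((shiftFunctorAdd T b 1).inv.app E₁),
      hE.eq_zero a (b + 1) ((f ≫ w) ≫ (shiftFunctorAdd T b 1).inv.app E₁), zero_comp]
  refine ⟨fun a b hab f => ?_, fun a f => ?_, fun h' => ?_⟩
  · obtain ⟨u, v, w, hT, -, -⟩ := key a
    obtain ⟨u', v', w', hT', -, -⟩ := key b
    obtain ⟨f', hf'⟩ := hC a b (v ≫ f) u' v' w' hT'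
    exact hB a b v u w hT f (by rw [hf', hE.exc₂.eq_zero a b hab f', zero_comp])
  · obtain ⟨u, v, w, hT, -, -⟩ := key a
    obtain ⟨f', hf'⟩ := hC a a (v ≫ f) u v w hT
    obtain ⟨c, rfl⟩ := hE.exc₂.exists_smul a f'
    refine ⟨c, sub_eq_zero.1 (hB a a v u w hT _ ?_)⟩
    rw [Preadditive.comp_sub, hf']
    simp
  · exact hE.not_isZero_cone hh ((IsZero.iff_id_eq_zero _).2 h')

/-- By the triangle on `h`, a triangulated subcategory containing two of the three objects contains
the third. This gives generation, and it reduces every coincidence of points to one between `E₁` and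
`E₂`. -/
lemma HeredPair.isDiscrete {E₁ E₂ E₃ : T} (hE : HeredPair K E₁ E₂)
    (hf : ∀ X Y : T, HomFinite K X Y) {h : E₁ ⟶ E₂}
    {g : E₂ ⟶ E₃} {d : E₃ ⟶ E₁⟦(1 : ℤ)⟧} (hh : Triangle.mk h g d ∈ distTriang T)
    (hspan : ∀ (a : ℤ) (f : E₁⟦a⟧ ⟶ E₂⟦a⟧), ∃ c : K, f = c • h⟦a⟧') :
    IsDiscrete K (span E₁ E₂) (tripleOf h E₃) := by
  have hexc : ∀ E, tripleOf h E₃ E → IsExc K E := by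
    rintro X (rfl | rfl | ⟨h0, rfl⟩)
    · exact hE.exc₁
    · exact hE.exc₂
    · exact hE.isExc_cone hh h0 hspan
  have htri {P : ObjectProperty T} (hP : IsTriSubcat P) :
      (P E₁ → P E₃ → P E₂) ∧ (P E₂ → P E₃ → P E₁) := by
    have := hP.1
    have := hP.2
    exact ⟨fun h₁ h₃ => P.ext_of_isTriangulatedClosed₂ _ hh h₁ h₃,
      fun h₂ h₃ => P.ext_of_isTriangulatedClosed₁ _ hh h₂ h₃⟩
  have hle : tripleOf h E₃ ≤ span E₁ E₂ :=
    tripleOf_le (isTriSubcat_triGenerated _) hh (span_left _ _) (span_right _ _)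
  have hpt (E : T) : IsTriSubcat (point E) := isTriSubcat_triGenerated _
  -- Membership in a point is symmetric among exceptional objects, so only one order of each pair
  -- needs an argument involving `E₃`.
  have hn {E F : T} (hE' : tripleOf h E₃ E) (hF : tripleOf h E₃ F) (h' : point E F) :
      point F E := by
    rw [point_eq_of_mem (hexc E hE') (fun X => hf E X) (hexc F hF) h']
    exact point_self E
  have h12 := hE.not_point_left
  have h21 := hE.not_point_right
  have h13 : ¬ point E₁ E₃ := fun h3 => h12 ((htri (hpt E₁)).1 (point_self _) h3)
  have h23 : ¬ point E₂ E₃ := fun h3 => h21 ((htri (hpt E₂)).2 (point_self _) h3)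
  refine ⟨isTriSubcat_triGenerated _, hexc, hle, fun X hX => hE.finiteSum (hf E₁) (hf E₂) hh
    hspan hX, fun E F hE' hF hne => ?_, fun E F hE' hF hne => ?_⟩
  · refine le_antisymm (span_le (isTriSubcat_triGenerated _) (hle _ hE') (hle _ hF)) ?_
    have ht := isTriSubcat_triGenerated (fun X => X = E ∨ X = F)
    have hl := span_left E F
    have hr := span_right E F
    apply span_le ht
    · rcases hE' with rfl | rfl | ⟨h0, rfl⟩ <;> rcases hF with rfl | rfl | ⟨h0', rfl⟩
      all_goals first | exact (hne rfl).elim | assumption | skip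
      · exact (htri ht).2 hl hr
      · exact (htri ht).2 hr hl
    · rcases hE' with rfl | rfl | ⟨h0, rfl⟩ <;> rcases hF with rfl | rfl | ⟨h0', rfl⟩
      all_goals first | exact (hne rfl).elim | assumption | skip
      · exact (htri ht).1 hl hr
      · exact (htri ht).1 hr hl
  · intro h'
    have h'' := hn hE' hF h'
    rcases hE' with rfl | rfl | ⟨h0, rfl⟩ <;> rcases hF with rfl | rfl | ⟨h0', rfl⟩
    all_goals first | exact (hne rfl).elim | contradiction

end


section

variable {K : Type w} [Field K] {T : Type u} [Category.{v} T] [HasZeroObject T] [HasShift T ℤ]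
  [Preadditive T] [Linear K T] [∀ n : ℤ, (shiftFunctor T n).Additive] [Pretriangulated T]

/-! ### Additive functions -/

/-- A function on objects that is additive on distinguished triangles. -/
def IsAdditiveFn (f : T → ℤ) : Prop :=
  ∀ D ∈ distTriang T, f D.obj₂ = f D.obj₁ + f D.obj₃

lemma IsAdditiveFn.map_zero {f : T → ℤ} (hf : IsAdditiveFn f) : f 0 = 0 := by
  have := hf _ (contractible_distinguished (0 : T))
  simpa using this

lemma IsAdditiveFn.map_iso {f : T → ℤ} (hf : IsAdditiveFn f) {X Y : T} (e : X ≅ Y) :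
    f X = f Y := by
  have := hf (Triangle.mk e.hom (0 : Y ⟶ 0) 0) ((Triangle.distinguished_iff_of_isZero₃ _
    (isZero_zero T)).2 (inferInstanceAs (IsIso e.hom)))
  simpa [hf.map_zero] using this.symm

lemma IsAdditiveFn.map_shift_one {f : T → ℤ} (hf : IsAdditiveFn f) (X : T) :
    f (X⟦(1 : ℤ)⟧) = - f X := by
  have : f (0 : T) = f X + f (X⟦(1 : ℤ)⟧) := hf _ (rot_of_distTriang _ (contractible_distinguished X))
  rw [hf.map_zero] at this
  lia

lemma IsAdditiveFn.map_shift {f : T → ℤ} (hf : IsAdditiveFn f) (X : T) (n : ℤ) :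
    f (X⟦n⟧) = n.negOnePow * f X := by
  induction n using Int.induction_on with
  | zero =>
    rw [hf.map_iso ((shiftFunctorZero T ℤ).app X)]
    simp
  | succ n ih =>
    rw [hf.map_iso ((shiftFunctorAdd T (n : ℤ) 1).app X)]
    simp [hf.map_shift_one, ih, Int.negOnePow_succ]
  | pred n ih =>
    have h := hf.map_iso ((shiftFunctorAdd' T (-(n : ℤ) - 1) 1 (-n) (by lia)).app X)
    simp only [Functor.comp_obj, hf.map_shift_one] at h
    rw [ih] at h
    rw [Int.negOnePow_sub, Int.negOnePow_one]
    simp only [mul_neg, mul_one, Units.val_neg]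
    linarith

/-- This allows an identity between additive functions to be verified on generators only. -/
lemma IsAdditiveFn.isTriSubcat_eq {f g : T → ℤ} (hf : IsAdditiveFn f) (hg : IsAdditiveFn g) :
    IsTriSubcat (fun X => f X = g X) := by
  have hiso : ObjectProperty.IsClosedUnderIsomorphisms (fun X : T => f X = g X) :=
    ⟨fun e h => by rw [← hf.map_iso e, ← hg.map_iso e, h]⟩
  refine ⟨?_, hiso⟩
  exact
    { exists_zero := ⟨0, isZero_zero T, by rw [hf.map_zero, hg.map_zero]⟩
      isStableUnderShiftBy := fun n => ⟨fun X hX => by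
        change f (X⟦n⟧) = g (X⟦n⟧)
        rw [hf.map_shift, hg.map_shift, hX]⟩
      toIsTriangulatedClosed₂ := .mk' fun D hD h₁ h₃ => by rw [hf D hD, hg D hD, h₁, h₃] }

variable (K) in
/-- The Euler characteristic of the graded space of morphisms from `E` to `X`. -/
noncomputable def euler (E X : T) : ℤ :=
  ∑ᶠ n : ℤ, (n.negOnePow : ℤ) * Module.finrank K (E⟦n⟧ ⟶ X)

lemma finrank_eq_of_exact {A B C : Type*} [AddCommGroup A] [Module K A] [AddCommGroup B]
    [Module K B] [AddCommGroup C] [Module K C] [FiniteDimensional K B] (u : A →ₗ[K] B)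
    (v : B →ₗ[K] C) (h : Function.Exact u v) : Module.finrank K B =
      Module.finrank K (LinearMap.range u) + Module.finrank K (LinearMap.range v) := by
  rw [← LinearMap.finrank_range_add_finrank_ker v, LinearMap.exact_iff.1 h, add_comm]

variable [∀ n : ℤ, (shiftFunctor T n).Linear K]

variable (K) in
/-- Shifting source and target of a morphism. -/
noncomputable def shiftBothEquiv (E X : T) (n : ℤ) : (E⟦n⟧ ⟶ X) ≃ₗ[K] (E⟦n + 1⟧ ⟶ X⟦(1 : ℤ)⟧) :=
  LinearEquiv.ofBijective
    (Linear.leftComp K (X⟦(1 : ℤ)⟧) ((shiftFunctorAdd T n 1).hom.app E) ∘ₗ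
      (shiftFunctor T (1 : ℤ)).mapLinearMap K) <| by
    rw [LinearMap.coe_comp]
    refine Function.Bijective.comp ⟨fun f g hfg => ?_, fun f => ?_⟩
      ⟨(shiftFunctor T (1 : ℤ)).map_injective, (shiftFunctor T (1 : ℤ)).map_surjective⟩
    · exact (cancel_epi ((shiftFunctorAdd T n 1).hom.app E)).1 hfg
    · exact ⟨(shiftFunctorAdd T n 1).inv.app E ≫ f, by simp⟩

/-- Every dimension in the long exact sequence is a sum of two consecutive ranks, and the ranks
cancel in the alternating sum. -/
lemma isAdditiveFn_euler {E : T} (hE : ∀ X, HomFinite K E X) : IsAdditiveFn (euler K E) := by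
  intro D hD
  have hfin (X : T) (n : ℤ) : FiniteDimensional K (E⟦n⟧ ⟶ X) := (hE X).1 n
  let ra (n : ℤ) : ℤ := Module.finrank K (LinearMap.range (Linear.rightComp K (E⟦n⟧) D.mor₁))
  let rb (n : ℤ) : ℤ := Module.finrank K (LinearMap.range (Linear.rightComp K (E⟦n⟧) D.mor₂))
  let rc (n : ℤ) : ℤ := Module.finrank K (LinearMap.range (Linear.rightComp K (E⟦n⟧) D.mor₃))
  have h₂ (n : ℤ) : (Module.finrank K (E⟦n⟧ ⟶ D.obj₂) : ℤ) = ra n + rb n := by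
    rw [finrank_eq_of_exact (Linear.rightComp K (E⟦n⟧) D.mor₁) (Linear.rightComp K (E⟦n⟧) D.mor₂)]
    · simp [ra, rb]
    · intro f
      refine ⟨fun hf => (D.coyoneda_exact₂ hD f hf).imp fun _ h => h.symm, ?_⟩
      rintro ⟨g, rfl⟩
      simp [comp_distTriang_mor_zero₁₂ D hD]
  have h₃ (n : ℤ) : (Module.finrank K (E⟦n⟧ ⟶ D.obj₃) : ℤ) = rb n + rc n := by
    rw [finrank_eq_of_exact (Linear.rightComp K (E⟦n⟧) D.mor₂) (Linear.rightComp K (E⟦n⟧) D.mor₃)]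
    · simp [rb, rc]
    · intro f
      refine ⟨fun hf => (D.coyoneda_exact₃ hD f hf).imp fun _ h => h.symm, ?_⟩
      rintro ⟨g, rfl⟩
      simp [comp_distTriang_mor_zero₂₃ D hD]
  -- The index is `n + 1` because the connecting map into `E⟦n + 1⟧ ⟶ D.obj₁⟦1⟧` becomes, after
  -- unshifting, a map into `E⟦n⟧ ⟶ D.obj₁`.
  have h₁ (n : ℤ) : (Module.finrank K (E⟦n⟧ ⟶ D.obj₁) : ℤ) = rc (n + 1) + ra n := by
    let e := shiftBothEquiv K E D.obj₁ n
    rw [finrank_eq_of_exact (e.symm.toLinearMap ∘ₗ Linear.rightComp K (E⟦n + 1⟧) D.mor₃)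
      (Linear.rightComp K (E⟦n⟧) D.mor₁)]
    · rw [LinearMap.range_comp, LinearEquiv.finrank_map_eq]
      simp [rc, ra]
    · intro f
      have he : e f = (shiftFunctorAdd T n 1).hom.app E ≫ f⟦(1 : ℤ)⟧' := rfl
      have key : e f ≫ D.mor₁⟦(1 : ℤ)⟧' = 0 ↔ f ≫ D.mor₁ = 0 := by
        rw [he, Category.assoc, ← CategoryTheory.Functor.map_comp,
          Preadditive.IsIso.comp_left_eq_zero, Functor.map_eq_zero_iff]
      change f ≫ D.mor₁ = 0 ↔ _
      rw [← key]
      constructor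
      · intro h
        obtain ⟨g, hg⟩ := D.coyoneda_exact₁ hD (e f) h
        exact ⟨g, by rw [LinearMap.comp_apply]; exact e.symm_apply_eq.2 hg.symm⟩
      · rintro ⟨g, hg⟩
        have : e f = g ≫ D.mor₃ := (e.symm_apply_eq.1 hg).symm
        rw [this, Category.assoc, comp_distTriang_mor_zero₃₁ D hD, comp_zero]
  have hs₂ := (hE D.obj₂).2
  have hs₃ := (hE D.obj₃).2
  have hra : (Function.support fun n => (n.negOnePow : ℤ) * ra n).Finite :=
    hs₂.subset fun n hn => by
      simp only [Function.mem_support, ne_eq, mul_eq_zero, not_or] at hn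
      have := h₂ n
      change Module.finrank K (E⟦n⟧ ⟶ D.obj₂) ≠ 0
      lia
  have hrb : (Function.support fun n => (n.negOnePow : ℤ) * rb n).Finite :=
    hs₂.subset fun n hn => by
      simp only [Function.mem_support, ne_eq, mul_eq_zero, not_or] at hn
      have := h₂ n
      change Module.finrank K (E⟦n⟧ ⟶ D.obj₂) ≠ 0
      lia
  have hrc : (Function.support fun n => (n.negOnePow : ℤ) * rc n).Finite :=
    hs₃.subset fun n hn => by
      simp only [Function.mem_support, ne_eq, mul_eq_zero, not_or] at hn
      have := h₃ n
      change Module.finrank K (E⟦n⟧ ⟶ D.obj₃) ≠ 0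
      lia
  have hshift (n : ℤ) : (n.negOnePow : ℤ) * rc (n + 1) =
      -(((n + 1).negOnePow : ℤ) * rc (n + 1)) := by
    rw [Int.negOnePow_succ]
    simp
  have hrc' : (Function.support fun n => (n.negOnePow : ℤ) * rc (n + 1)).Finite := by
    refine (hrc.preimage (f := fun n => n + 1) (add_left_injective 1).injOn).subset fun n hn => ?_
    simpa [Function.mem_support] using hn
  -- Reindexing by one reverses the sign, so the two occurrences of `rc` cancel.
  have hsum : ∑ᶠ n : ℤ, (n.negOnePow : ℤ) * rc (n + 1) =
      -∑ᶠ n : ℤ, (n.negOnePow : ℤ) * rc n := by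
    rw [finsum_congr hshift, finsum_neg_distrib]
    exact congrArg _ (finsum_comp_equiv (Equiv.addRight (1 : ℤ))
      (f := fun n => (n.negOnePow : ℤ) * rc n))
  simp only [euler, h₁, h₂, h₃, mul_add]
  rw [finsum_add_distrib hra hrb, finsum_add_distrib hrb hrc, finsum_add_distrib hrc' hra, hsum]
  ring

lemma euler_eq_zero {E X : T} (h : rightPerp E X) : euler K E X = 0 := by
  rw [euler, ← finsum_zero]
  refine finsum_congr fun n => ?_
  have : Subsingleton (E⟦n⟧ ⟶ X) := ⟨fun f g => (h n f).trans (h n g).symm⟩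
  rw [Module.finrank_zero_of_subsingleton]
  simp

lemma euler_eq_of_concentrated {E X : T} (a : ℤ) (h : ∀ n, n ≠ a → ∀ f : E⟦n⟧ ⟶ X, f = 0) :
    euler K E X = a.negOnePow * Module.finrank K (E⟦a⟧ ⟶ X) := by
  refine finsum_eq_single _ a fun n hn => ?_
  have : Subsingleton (E⟦n⟧ ⟶ X) := ⟨fun f g => (h n hn f).trans (h n hn g).symm⟩
  rw [Module.finrank_zero_of_subsingleton]
  simp

lemma IsExc.euler_self {E : T} (hE : IsExc K E) : euler K E E = 1 := by
  let z : E⟦(0 : ℤ)⟧ ≅ E := (shiftFunctorZero T ℤ).app E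
  rw [euler_eq_of_concentrated 0 fun n hn f => ?_]
  · have : Module.finrank K (E⟦(0 : ℤ)⟧ ⟶ E) = 1 := by
      refine (finrank_eq_one_iff_of_nonzero' z.hom fun h => ?_).2 fun f => ?_
      · exact hE.id_ne_zero (by rw [← z.inv_hom_id, h, comp_zero])
      · obtain ⟨c, hc⟩ := hE.exists_smul 0 (f ≫ z.inv)
        exact ⟨c, by rw [← cancel_mono z.inv, hc]; simp⟩
    simp [this]
  · rw [← cancel_mono z.inv, hE.eq_zero n 0 hn (f ≫ z.inv), zero_comp]

/-- All summands have the same shift, so the Euler characteristic is plus or minus a dimension and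
nothing can cancel. -/
lemma FiniteSum.isZero_of_euler {E X : T} (hE : IsExc K E) (hf : HomFinite K E X) {a : ℤ}
    (hX : FiniteSum (shiftsIn E {a}) X) (h : euler K E X = 0) : IsZero X := by
  have hv (n : ℤ) (hn : n ≠ a) (f : E⟦n⟧ ⟶ X) : f = 0 := by
    refine hX.to_eq_zero ?_ f
    rintro E' ⟨_, rfl, ⟨i⟩⟩ f
    rw [← cancel_mono i.hom, hE.eq_zero n _ hn (f ≫ i.hom), zero_comp]
  rw [euler_eq_of_concentrated a hv] at h
  have h0 : Module.finrank K (E⟦a⟧ ⟶ X) = 0 := by simpa using h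
  have := hf.1 a
  have := Module.finrank_zero_iff.1 h0
  refine (hX.mono (shiftsIn_mono E (Set.subset_univ _))).isZero_of_rightPerp fun n f => ?_
  by_cases hn : n = a
  · subst hn
    exact Subsingleton.elim _ _
  · exact hv n hn f

variable [IsTriangulated T]

/-- In the span of an exceptional pair, the Euler characteristics of the morphisms from the members
of another exceptional pair jointly detect those from the members of the given pair. -/
lemma ExcPair.euler_eq_zero {E₁ E₂ F₁ F₂ : T} (hE : ExcPair K E₁ E₂) (hF : ExcPair K F₁ F₂)
    (hf : ∀ X Y : T, HomFinite K X Y) (h₁ : span E₁ E₂ F₁) (h₂ : span E₁ E₂ F₂) {X : T}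
    (hX : span E₁ E₂ X) (hX₁ : rightPerp F₁ X) (hX₂ : rightPerp F₂ X) :
    euler K E₁ X = 0 ∧ euler K E₂ X = 0 := by
  have hperp {A B : T} (h : ∀ (a b : ℤ) (f : B⟦a⟧ ⟶ A⟦b⟧), f = 0) : rightPerp B A := fun n f => by
    rw [← cancel_mono ((shiftFunctorZero T ℤ).inv.app A), zero_comp]
    exact h n 0 _
  have h21 : euler K E₂ E₁ = 0 := LinTri.euler_eq_zero (hperp hE.eq_zero)
  have hF21 : euler K F₂ F₁ = 0 := LinTri.euler_eq_zero (hperp hF.eq_zero)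
  -- On the span an additive function is a combination of the Euler characteristics against `E₁` and
  -- `E₂`; the coefficients solve the unitriangular system given by the values at `E₁` and `E₂`.
  have key (f : T → ℤ) (hfa : IsAdditiveFn f) (Y : T) (hY : span E₁ E₂ Y) :
      f Y = f E₁ * euler K E₁ Y + (f E₂ - euler K E₁ E₂ * f E₁) * euler K E₂ Y := by
    have hg : IsAdditiveFn fun Y : T => f E₁ * euler K E₁ Y +
        (f E₂ - euler K E₁ E₂ * f E₁) * euler K E₂ Y := fun D hD => by
      simp only [isAdditiveFn_euler (hf E₁) D hD, isAdditiveFn_euler (hf E₂) D hD]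
      ring
    refine hY _ (hfa.isTriSubcat_eq hg) ?_
    rintro _ (rfl | rfl)
    · simp [hE.exc₁.euler_self, h21]
    · simp only [hE.exc₂.euler_self]
      ring
  have k₁ := key _ (isAdditiveFn_euler (hf F₁))
  have k₂ := key _ (isAdditiveFn_euler (hf F₂))
  generalize euler K F₁ E₁ = p₁ at k₁
  generalize euler K F₁ E₂ - euler K E₁ E₂ * p₁ = q₁ at k₁
  generalize euler K F₂ E₁ = p₂ at k₂
  generalize euler K F₂ E₂ - euler K E₁ E₂ * p₂ = q₂ at k₂
  have a11 := k₁ F₁ h₁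
  have a22 := k₂ F₂ h₂
  have a21 := k₂ F₁ h₁
  rw [hF.exc₁.euler_self] at a11
  rw [hF.exc₂.euler_self] at a22
  rw [hF21] at a21
  have b₁ := k₁ X hX
  have b₂ := k₂ X hX
  rw [LinTri.euler_eq_zero hX₁] at b₁
  rw [LinTri.euler_eq_zero hX₂] at b₂
  -- The matrix of the `pᵢ`, `qᵢ` times the matrix of Euler characteristics of `Eᵢ` against `Fⱼ` is
  -- the Gram matrix of the pair `F₁`, `F₂`, which is unitriangular.
  have hdet : (p₁ * q₂ - p₂ * q₁) *
      (euler K E₁ F₁ * euler K E₂ F₂ - euler K E₁ F₂ * euler K E₂ F₁) = 1 := by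
    linear_combination (-(p₁ * euler K E₁ F₁ + q₁ * euler K E₂ F₁)) * a22 - a11 +
      (p₁ * euler K E₁ F₂ + q₁ * euler K E₂ F₂) * a21
  have hne : p₁ * q₂ - p₂ * q₁ ≠ 0 := left_ne_zero_of_mul_eq_one hdet
  constructor
  · refine (mul_eq_zero.1 (?_ : (p₁ * q₂ - p₂ * q₁) * euler K E₁ X = 0)).resolve_left hne
    linear_combination (-q₂) * b₁ + q₁ * b₂
  · refine (mul_eq_zero.1 (?_ : (p₁ * q₂ - p₂ * q₁) * euler K E₂ X = 0)).resolve_left hne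
    linear_combination p₂ * b₁ - p₁ * b₂

lemma shiftsIn_hom_eq_zero {E₁ E₂ A B : T} {J J' : Set ℤ} (hJ : Disjoint J J')
    (h : ∀ (a b : ℤ), a ≠ b → ∀ f : E₁⟦a⟧ ⟶ E₂⟦b⟧, f = 0) (hA : FiniteSum (shiftsIn E₁ J) A)
    (hB : FiniteSum (shiftsIn E₂ J') B) (f : A ⟶ B) : f = 0 := by
  refine hA.from_eq_zero ?_ f
  rintro E ⟨n, hn, ⟨i⟩⟩ f
  refine hB.to_eq_zero ?_ f
  rintro E' ⟨m, hm, ⟨j⟩⟩ f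
  rw [← cancel_epi i.inv, ← cancel_mono j.hom, h n m (fun h => Set.disjoint_left.1 hJ hn (h ▸ hm))
    ((i.inv ≫ f) ≫ j.hom), comp_zero, zero_comp]

/-- An exceptional pair in the span of a hereditary exceptional pair generates it. -/
lemma HeredPair.isZero_of_rightPerp {E₁ E₂ F₁ F₂ : T} (hE : HeredPair K E₁ E₂)
    (hF : ExcPair K F₁ F₂) (hf : ∀ X Y : T, HomFinite K X Y) (h₁ : span E₁ E₂ F₁)
    (h₂ : span E₁ E₂ F₂) {X : T} (hX : span E₁ E₂ X) (hX₁ : rightPerp F₁ X)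
    (hX₂ : rightPerp F₂ X) : IsZero X := by
  obtain ⟨A, B, φ, ψ, δ, hT, hA, hB⟩ := hE.exists_triangle (hf E₁) (hf E₂) hX
  -- With no maps between different shifts, `φ` is block diagonal, so the cone of its degree-`a`
  -- block is a retract of `X`. This retract inherits both orthogonalities and has zero Euler
  -- characteristics, which empties the block.
  have key (a : ℤ) : ∃ A₁ A₂ B₁ B₂, IsZero A₁ ∧ IsZero B₁ ∧ FiniteSum (shiftsIn E₁ {a}ᶜ) A₂ ∧
      FiniteSum (shiftsIn E₂ {a}ᶜ) B₂ ∧ Nonempty (A ≅ A₁ ⊞ A₂) ∧ Nonempty (B ≅ B₁ ⊞ B₂) := by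
    obtain ⟨A₁, A₂, hA₁, hA₂, ⟨i⟩⟩ := hA.split {a}
    obtain ⟨B₁, B₂, hB₁, hB₂, ⟨j⟩⟩ := hB.split {a}
    let φ₁ : A₁ ⟶ B₁ := biprod.inl ≫ i.inv ≫ φ ≫ j.hom ≫ biprod.fst
    obtain ⟨X₁, ψ₁, δ₁, hT₁⟩ := distinguished_cocone_triangle φ₁
    have z₁ : biprod.inl ≫ i.inv ≫ φ ≫ j.hom ≫ biprod.snd = 0 :=
      shiftsIn_hom_eq_zero disjoint_compl_right hE.hom_eq_zero hA₁ hB₂ _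
    have z₂ : biprod.inr ≫ i.inv ≫ φ ≫ j.hom ≫ biprod.fst = 0 :=
      shiftsIn_hom_eq_zero disjoint_compl_left hE.hom_eq_zero hA₂ hB₁ _
    obtain ⟨R⟩ := exists_retract_cone hT₁ hT (biprod.inl ≫ i.inv) (biprod.inl ≫ j.inv)
      (i.hom ≫ biprod.fst) (j.hom ≫ biprod.fst)
      (by
        rw [← cancel_mono j.hom]
        ext
        · simp [φ₁]
        · simp [z₁])
      (by
        rw [← cancel_epi i.inv]
        ext
        · simp [φ₁]
        · simp [z₂])
      (by simp) (by simp)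
    have hperp {F : T} (h : rightPerp F X) : rightPerp F X₁ := fun n f => by
      have := h n (f ≫ R.i)
      rw [← Category.comp_id f, ← R.retract, ← Category.assoc, this, zero_comp]
    have hA₁' := hA₁.mono (shiftsIn_mono E₁ (Set.subset_univ _))
    have hB₁' := hB₁.mono (shiftsIn_mono E₂ (Set.subset_univ _))
    have hX₁s : span E₁ E₂ X₁ := (span E₁ E₂).ext_of_isTriangulatedClosed₃ _ hT₁
      (finiteSum_span_left hA₁') (finiteSum_span_right hB₁')
    obtain ⟨x₁, x₂⟩ := hE.toExcPair.euler_eq_zero hF hf h₁ h₂ hX₁s (hperp hX₁) (hperp hX₂)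
    have e₁ : euler K E₁ B₁ = euler K E₁ A₁ + euler K E₁ X₁ := isAdditiveFn_euler (hf E₁) _ hT₁
    have e₂ : euler K E₂ B₁ = euler K E₂ A₁ + euler K E₂ X₁ := isAdditiveFn_euler (hf E₂) _ hT₁
    -- `E₂` does not see `A₁`, so this equation kills `B₁`; the equation for `E₁` then kills `A₁`.
    rw [euler_eq_zero (hE.rightPerp_of_finiteSum hA₁'), x₂] at e₂
    have hB₁z : IsZero B₁ := hB₁.isZero_of_euler hE.exc₂ (hf _ _) (by lia)
    rw [euler_eq_zero (fun n f => hB₁z.eq_of_tgt _ _), x₁] at e₁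
    exact ⟨A₁, A₂, B₁, B₂, hA₁.isZero_of_euler hE.exc₁ (hf _ _) (by lia), hB₁z, hA₂, hB₂,
      ⟨i⟩, ⟨j⟩⟩
  have hAz : IsZero A := by
    by_contra h
    obtain ⟨a, f, hf⟩ := hA.exists_ne_zero h
    obtain ⟨A₁, A₂, B₁, B₂, hA₁, hB₁, hA₂, hB₂, ⟨i⟩, ⟨j⟩⟩ := key a
    refine hf ?_
    rw [← cancel_mono i.hom, zero_comp]
    ext
    · exact hA₁.eq_of_tgt _ _
    · rw [zero_comp]
      exact shiftsIn_hom_eq_zero (J := {a}) disjoint_compl_right hE.exc₁.eq_zero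
        (.add ⟨a, rfl, ⟨Iso.refl _⟩⟩ (.zero (isZero_zero T)) (isoBiprodZero (isZero_zero T)))
        hA₂ _
  have hBz : IsZero B := by
    by_contra h
    obtain ⟨a, f, hf⟩ := hB.exists_ne_zero h
    obtain ⟨A₁, A₂, B₁, B₂, hA₁, hB₁, hA₂, hB₂, ⟨i⟩, ⟨j⟩⟩ := key a
    refine hf ?_
    rw [← cancel_mono j.hom, zero_comp]
    ext
    · exact hB₁.eq_of_tgt _ _
    · rw [zero_comp]
      exact shiftsIn_hom_eq_zero (J := {a}) disjoint_compl_right hE.exc₂.eq_zero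
        (.add ⟨a, rfl, ⟨Iso.refl _⟩⟩ (.zero (isZero_zero T)) (isoBiprodZero (isZero_zero T)))
        hB₂ _
  exact Triangle.isZero₃_of_isZero₁₂ _ hT hAz hBz

/-- The smaller span is right admissible, so it suffices that its right orthogonal inside the larger
one is zero. The number of maps `E₁ ⟶ E₂` plays no role, so the larger curve may have any genus. -/
lemma HeredPair.span_eq {E₁ E₂ F₁ F₂ : T} (hE : HeredPair K E₁ E₂) (hF : ExcPair K F₁ F₂)
    (hf : ∀ X Y : T, HomFinite K X Y) (h : span F₁ F₂ ≤ span E₁ E₂) :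
    span F₁ F₂ = span E₁ E₂ := by
  refine le_antisymm h ((hF.rightAdmissible (hf _) (hf _)).le_of_perp
    (isTriSubcat_triGenerated _) (isTriSubcat_triGenerated _) h fun Z hZ hZ' => ?_)
  refine hE.isZero_of_rightPerp hF hf (h _ (span_left _ _)) (h _ (span_right _ _)) hZ
    (fun n f => hZ' _ ?_ f) (fun n f => hZ' _ ?_ f)
  · exact (span F₁ F₂).le_shift n _ (span_left _ _)
  · exact (span F₁ F₂).le_shift n _ (span_right _ _)

end


section

variable {K : Type w} [Field K] {T : Type u} [Category.{v} T] [HasZeroObject T] [HasShift T ℤ]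
  [Preadditive T] [Linear K T] [∀ n : ℤ, (shiftFunctor T n).Additive] [Pretriangulated T]
  {D : Type u'} [Category.{v'} D] [HasZeroObject D] [HasShift D ℤ]
  [Preadditive D] [Linear K D] [∀ n : ℤ, (shiftFunctor D n).Additive] [Pretriangulated D]

/-! ### Exact functors -/

section bijective

variable (F : D ⥤ T) [F.Additive]

lemma map_bijective_of_iso {X X' Y Y' : D} (e : X ≅ X') (e' : Y ≅ Y')
    (h : Function.Bijective (F.map : (X ⟶ Y) → _)) :
    Function.Bijective (F.map : (X' ⟶ Y') → _) := by
  constructor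
  · intro f g hfg
    have := h.1 (a₁ := e.hom ≫ f ≫ e'.inv) (a₂ := e.hom ≫ g ≫ e'.inv) (by simp [hfg])
    simpa using this
  · intro f
    obtain ⟨g, hg⟩ := h.2 (F.map e.hom ≫ f ≫ F.map e'.inv)
    refine ⟨e.inv ≫ g ≫ e'.hom, ?_⟩
    rw [F.map_comp, F.map_comp, hg]
    simp only [Category.assoc, ← F.mapIso_hom, ← F.mapIso_inv, Iso.inv_hom_id, Category.comp_id,
      Iso.inv_hom_id_assoc]

lemma map_bijective_of_isZero_left {X Y : D} (hX : IsZero X) :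
    Function.Bijective (F.map : (X ⟶ Y) → _) :=
  ⟨fun _ _ _ => hX.eq_of_src _ _, fun _ => ⟨0, (F.map_isZero hX).eq_of_src _ _⟩⟩

lemma map_bijective_of_isZero_right {X Y : D} (hY : IsZero Y) :
    Function.Bijective (F.map : (X ⟶ Y) → _) :=
  ⟨fun _ _ _ => hY.eq_of_tgt _ _, fun _ => ⟨0, (F.map_isZero hY).eq_of_tgt _ _⟩⟩

lemma map_bijective_biprod_left {X₁ X₂ Y : D} (h₁ : Function.Bijective (F.map : (X₁ ⟶ Y) → _))
    (h₂ : Function.Bijective (F.map : (X₂ ⟶ Y) → _)) :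
    Function.Bijective (F.map : (X₁ ⊞ X₂ ⟶ Y) → _) := by
  constructor
  · intro f g hfg
    ext
    · exact h₁.1 (by simp [hfg])
    · exact h₂.1 (by simp [hfg])
  · intro f
    obtain ⟨f₁, hf₁⟩ := h₁.2 (F.map biprod.inl ≫ f)
    obtain ⟨f₂, hf₂⟩ := h₂.2 (F.map biprod.inr ≫ f)
    refine ⟨biprod.desc f₁ f₂, ?_⟩
    have : F.map (𝟙 (X₁ ⊞ X₂)) ≫ f = f := by simp
    rw [← this, ← biprod.total, F.map_add, biprod.desc_eq, F.map_add]
    simp [hf₁, hf₂]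

lemma map_bijective_biprod_right {X Y₁ Y₂ : D} (h₁ : Function.Bijective (F.map : (X ⟶ Y₁) → _))
    (h₂ : Function.Bijective (F.map : (X ⟶ Y₂) → _)) :
    Function.Bijective (F.map : (X ⟶ Y₁ ⊞ Y₂) → _) := by
  constructor
  · intro f g hfg
    ext
    · exact h₁.1 (by simp [hfg])
    · exact h₂.1 (by simp [hfg])
  · intro f
    obtain ⟨f₁, hf₁⟩ := h₁.2 (f ≫ F.map biprod.fst)
    obtain ⟨f₂, hf₂⟩ := h₂.2 (f ≫ F.map biprod.snd)
    refine ⟨biprod.lift f₁ f₂, ?_⟩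
    have : f ≫ F.map (𝟙 (Y₁ ⊞ Y₂)) = f := by simp
    rw [← this, ← biprod.total, F.map_add, biprod.lift_eq, F.map_add]
    simp [hf₁, hf₂]

lemma map_bijective_of_finiteSum {S : ObjectProperty D}
    (h : ∀ X Y, S X → S Y → Function.Bijective (F.map : (X ⟶ Y) → _)) {X Y : D}
    (hX : FiniteSum S X) (hY : FiniteSum S Y) : Function.Bijective (F.map : (X ⟶ Y) → _) := by
  induction hX with
  | zero hX => exact map_bijective_of_isZero_left F hX
  | add hE _ e ih =>
    refine map_bijective_of_iso F e.symm (Iso.refl _) (map_bijective_biprod_left F ?_ ih)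
    clear ih
    induction hY with
    | zero hY => exact map_bijective_of_isZero_right F hY
    | add hE' _ e ih =>
      exact map_bijective_of_iso F (Iso.refl _) e.symm
        (map_bijective_biprod_right F (h _ _ hE hE') ih)

end bijective

variable (F : D ⥤ T) [F.CommShift ℤ] [F.IsTriangulated]

/-- Source and target are both zero for `a ≠ b` and spanned by the identity for `a = b`. -/
lemma map_bijective_shift {E : D} (F : D ⥤ T) [F.CommShift ℤ] [F.IsTriangulated] [F.Linear K]
    (hE : IsExc K E) (hFE : IsExc K (F.obj E)) (a b : ℤ) :
    Function.Bijective (F.map : (E⟦a⟧ ⟶ E⟦b⟧) → _) := by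
  let i (n : ℤ) : F.obj (E⟦n⟧) ≅ (F.obj E)⟦n⟧ := (F.commShiftIso n).app E
  constructor
  · refine (injective_iff_map_eq_zero F.mapAddHom).2 fun f hf => ?_
    by_cases hab : a = b
    · subst hab
      obtain ⟨c, rfl⟩ := hE.exists_smul a f
      have h1 : c • 𝟙 (F.obj (E⟦a⟧)) = 0 := by simpa using hf
      rcases smul_eq_zero.1 h1 with h2 | h2
      · rw [h2, zero_smul]
      · refine (hFE.id_shift_ne_zero a ?_).elim
        rw [← (i a).inv_hom_id, ← Category.id_comp (i a).hom, h2, zero_comp, comp_zero]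
    · exact hE.eq_zero a b hab f
  · intro f
    by_cases hab : a = b
    · subst hab
      obtain ⟨c, hc⟩ := hFE.exists_smul a ((i a).inv ≫ f ≫ (i a).hom)
      refine ⟨c • 𝟙 _, ?_⟩
      rw [← cancel_epi (i a).inv, ← cancel_mono (i a).hom, Category.assoc, Category.assoc, hc]
      simp
    · refine ⟨0, ?_⟩
      have := hFE.eq_zero a b hab ((i a).inv ≫ f ≫ (i b).hom)
      rw [Preadditive.IsIso.comp_left_eq_zero, Preadditive.IsIso.comp_right_eq_zero] at this
      rw [this, Functor.map_zero]

/-- An exact functor sending a generating exceptional object to an exceptional object is fully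
faithful. -/
lemma fullyFaithful_of_isExc {E : D} [F.Linear K] (hE : IsExc K E) (hFE : IsExc K (F.obj E))
    (hgen : ∀ X, FiniteSum (shiftsIn E Set.univ) X) : F.Full ∧ F.Faithful := by
  have key (X Y : D) : Function.Bijective (F.map : (X ⟶ Y) → _) := by
    refine map_bijective_of_finiteSum F ?_ (hgen X) (hgen Y)
    rintro X Y ⟨a, -, ⟨e⟩⟩ ⟨b, -, ⟨e'⟩⟩
    exact map_bijective_of_iso F e.symm e'.symm (map_bijective_shift F hE hFE a b)
  exact ⟨⟨fun f => (key _ _).2 f⟩, ⟨fun h => (key _ _).1 h⟩⟩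

lemma isTriSubcat_essImage [F.Full] : IsTriSubcat F.essImage := ⟨inferInstance, inferInstance⟩

lemma isTriSubcat_inverseImage {P : ObjectProperty T} (hP : IsTriSubcat P) :
    IsTriSubcat (P.inverseImage F) := by
  have := hP.1
  have := hP.2
  exact ⟨inferInstance, inferInstance⟩

/-- The essential image of a full exact functor is triangulated, which gives one inclusion.
Conversely the preimage of ⟨S'⟩ is triangulated and contains the generators `S`, hence is
everything. -/
lemma triGenerated_map_eq_essImage [F.Full] (S : ObjectProperty D)
    (S' : ObjectProperty T) (h : ∀ X, S X → S' (F.obj X)) (h' : S' ≤ F.essImage)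
    (hgen : ∀ X, triGenerated S X) : triGenerated S' = F.essImage := by
  refine le_antisymm (triGenerated_le (isTriSubcat_essImage F) h') ?_
  rintro Y ⟨X, ⟨e⟩⟩
  refine (triGenerated S').prop_of_iso e ?_
  exact hgen X _ (isTriSubcat_inverseImage F (isTriSubcat_triGenerated S'))
    fun X hX => le_triGenerated S' _ (h X hX)

lemma span_map_eq_essImage [F.Full] {E₁ E₂ : D} (hgen : ∀ X, span E₁ E₂ X) :
    span (F.obj E₁) (F.obj E₂) = F.essImage :=
  triGenerated_map_eq_essImage F _ _ (by rintro _ (rfl | rfl) <;> simp)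
    (by rintro _ (rfl | rfl) <;> exact F.obj_mem_essImage _) hgen

lemma point_map_eq_essImage [F.Full] {E : D} (hgen : ∀ X, point E X) :
    point (F.obj E) = F.essImage :=
  triGenerated_map_eq_essImage F _ _ (by rintro _ rfl; rfl)
    (by rintro _ rfl; exact F.obj_mem_essImage _) hgen

lemma exists_map_shift [F.Full] {X Y : D} {a b : ℤ} (f : (F.obj X)⟦a⟧ ⟶ (F.obj Y)⟦b⟧) :
    ∃ g : X⟦a⟧ ⟶ Y⟦b⟧, f = (F.commShiftIso a).inv.app X ≫ F.map g ≫ (F.commShiftIso b).hom.app Y := by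
  obtain ⟨g, hg⟩ := F.map_surjective
    ((F.commShiftIso a).hom.app X ≫ f ≫ (F.commShiftIso b).inv.app Y)
  exact ⟨g, by simp [hg]⟩

lemma IsExc.map [F.Linear K] [F.Full] [F.Faithful] {E : D} (hE : IsExc K E) :
    IsExc K (F.obj E) where
  eq_zero a b hab f := by
    obtain ⟨g, rfl⟩ := exists_map_shift F f
    rw [hE.eq_zero a b hab g]
    simp
  exists_smul a f := by
    obtain ⟨g, rfl⟩ := exists_map_shift F f
    obtain ⟨c, rfl⟩ := hE.exists_smul a g
    exact ⟨c, by simp⟩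
  id_ne_zero h := hE.id_ne_zero (F.map_injective (by rw [F.map_id, h, Functor.map_zero]))

lemma HeredPair.map [F.Linear K] [F.Full] [F.Faithful] {E₁ E₂ : D} (hE : HeredPair K E₁ E₂) :
    HeredPair K (F.obj E₁) (F.obj E₂) where
  exc₁ := hE.exc₁.map F
  exc₂ := hE.exc₂.map F
  eq_zero a b f := by
    obtain ⟨g, rfl⟩ := exists_map_shift F f
    rw [hE.eq_zero a b g]
    simp
  hom_eq_zero a b hab f := by
    obtain ⟨g, rfl⟩ := exists_map_shift F f
    rw [hE.hom_eq_zero a b hab g]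
    simp

lemma exists_smul_map [F.Linear K] [F.Full] {E₁ E₂ : D} {h : E₁ ⟶ E₂}
    (hspan : ∀ (a : ℤ) (f : E₁⟦a⟧ ⟶ E₂⟦a⟧), ∃ c : K, f = c • h⟦a⟧') (a : ℤ)
    (f : (F.obj E₁)⟦a⟧ ⟶ (F.obj E₂)⟦a⟧) : ∃ c : K, f = c • (F.map h)⟦a⟧' := by
  obtain ⟨g, rfl⟩ := exists_map_shift F f
  obtain ⟨c, rfl⟩ := hspan a g
  refine ⟨c, ?_⟩
  simp [F.commShiftIso_hom_naturality]

end

/-- The subcategories of type `J` are the essential images of the fully faithful exact linear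
functors from members of `J`. -/
lemma mem_subcatsOfType_iff {K : Type w} [Field K] {T : Type u} [Category.{v} T] [HasZeroObject T]
    [HasShift T ℤ] [Preadditive T] [Linear K T] [∀ n : ℤ, (shiftFunctor T n).Additive]
    [Pretriangulated T] {J : Set (LinTriCat.{w, w + 1, w + 1} K)} {B : ObjectProperty T} :
    B ∈ subcatsOfType K T J ↔ ∃ A ∈ J, ∃ (F : A.carrier ⥤ T) (_ : F.CommShift ℤ),
      F.IsTriangulated ∧ F.Linear K ∧ F.Full ∧ F.Faithful ∧ B = F.essImage := by
  constructor
  · rintro ⟨hB, hB', A, hA, F, _, hF, hF', hF''⟩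
    refine ⟨A, hA, F ⋙ B.ι, inferInstance, inferInstance, ⟨fun {X Y} f r => ?_⟩, inferInstance,
      inferInstance, ?_⟩
    · rw [Functor.comp_map, Functor.Linear.map_smul]
      rfl
    · ext X
      constructor
      · intro hX
        exact ⟨F.objPreimage ⟨X, hX⟩, ⟨B.ι.mapIso (F.objObjPreimageIso ⟨X, hX⟩)⟩⟩
      · rintro ⟨Y, ⟨e⟩⟩
        exact B.prop_of_iso e (F.obj Y).2
  · rintro ⟨A, hA, F, _, hF, hF', _, _, rfl⟩
    refine ⟨inferInstance, inferInstance, A, hA, F.essImage.lift F F.obj_mem_essImage,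
      inferInstance, inferInstance, ⟨fun {X Y} f r => ?_⟩, ?_⟩
    · apply F.essImage.ι.map_injective
      exact Functor.Linear.map_smul (F := F) f r
    · exact
        { faithful := inferInstance
          full := inferInstance
          essSurj := ⟨fun Y => by
            obtain ⟨X, ⟨e⟩⟩ := Y.2
            exact ⟨X, ⟨F.essImage.fullyFaithfulι.preimageIso e⟩⟩⟩ }


/-! ### Fully faithful functors: comparing finiteness and orthogonality -/

section reflect

variable {K : Type w} [Field K] {T : Type u} [Category.{v} T] [HasZeroObject T] [HasShift T ℤ]
  [Preadditive T] [Linear K T] [∀ n : ℤ, (shiftFunctor T n).Additive] [Pretriangulated T]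
  {D : Type u'} [Category.{v'} D] [HasZeroObject D] [HasShift D ℤ]
  [Preadditive D] [Linear K D] [∀ n : ℤ, (shiftFunctor D n).Additive] [Pretriangulated D]
  (F : D ⥤ T) [F.CommShift ℤ] [F.Additive] [F.Linear K] [F.Full] [F.Faithful]

/-- The action of a fully faithful functor commuting with shifts on morphisms from a shifted
object. -/
noncomputable def mapShiftEquiv (X Y : D) (n : ℤ) :
    (X⟦n⟧ ⟶ Y) ≃ₗ[K] ((F.obj X)⟦n⟧ ⟶ F.obj Y) :=
  (LinearEquiv.ofBijective (F.mapLinearMap K) ⟨F.map_injective, F.map_surjective⟩).trans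
    (Linear.homCongr K ((F.commShiftIso n).app X) (Iso.refl _))

lemma homFinite_of_map {E X : D} (h : HomFinite K (F.obj E) (F.obj X)) : HomFinite K E X := by
  refine ⟨fun n => ?_, ?_⟩
  · have := h.1 n
    exact (mapShiftEquiv F E X n).symm.finiteDimensional
  · have := h.2
    simp_rw [← (mapShiftEquiv (K := K) F E X _).finrank_eq] at this
    exact this

lemma rightPerp_map {E X : D} (h : rightPerp E X) : rightPerp (F.obj E) (F.obj X) := by
  intro n f
  have := h n ((F.commShiftIso n).hom.app E ≫ f |> F.preimage)
  rw [← cancel_epi ((F.commShiftIso n).hom.app E), comp_zero, ← F.map_preimage (_ ≫ f), this,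
    Functor.map_zero]

lemma map_shift_eq_zero {E X : D} {a b : ℤ}
    (h : ∀ f : (F.obj E)⟦a⟧ ⟶ (F.obj X)⟦b⟧, f = 0) (f : E⟦a⟧ ⟶ X⟦b⟧) : f = 0 := by
  have := h ((F.commShiftIso a).inv.app E ≫ F.map f ≫ (F.commShiftIso b).hom.app X)
  rw [Preadditive.IsIso.comp_left_eq_zero, Preadditive.IsIso.comp_right_eq_zero] at this
  exact F.map_injective (by rw [this, Functor.map_zero])

end reflect

section homFinite

variable {K : Type w} [Field K] {T : Type u} [Category.{v} T] [HasZeroObject T] [HasShift T ℤ]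
  [Preadditive T] [Linear K T] [∀ n : ℤ, (shiftFunctor T n).Additive] [Pretriangulated T]

lemma HomFinite.of_distTriang {E X Y Z : T} {f : X ⟶ Y} {g : Y ⟶ Z} {h : Z ⟶ X⟦(1 : ℤ)⟧}
    (hT : Triangle.mk f g h ∈ distTriang T) (hX : HomFinite K E X) (hZ : HomFinite K E Z) :
    HomFinite K E Y := by
  have key (n : ℤ) : FiniteDimensional K (E⟦n⟧ ⟶ Y) ∧
      Module.finrank K (E⟦n⟧ ⟶ Y) ≤ Module.finrank K (E⟦n⟧ ⟶ X) + Module.finrank K (E⟦n⟧ ⟶ Z) := by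
    have := hX.1 n
    have := hZ.1 n
    let u := Linear.rightComp K (E⟦n⟧) f
    let v := Linear.rightComp K (E⟦n⟧) g
    have hker : LinearMap.ker v ≤ LinearMap.range u := fun x hx => by
      obtain ⟨t, ht⟩ : ∃ t : E⟦n⟧ ⟶ X, x = t ≫ f := Triangle.coyoneda_exact₂ _ hT x hx
      exact ⟨t, ht.symm⟩
    have : FiniteDimensional K (LinearMap.ker v) := Submodule.finiteDimensional_of_le hker
    have : FiniteDimensional K ((E⟦n⟧ ⟶ Y) ⧸ LinearMap.ker v) :=
      v.quotKerEquivRange.symm.finiteDimensional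
    have : FiniteDimensional K (E⟦n⟧ ⟶ Y) := Module.Finite.of_submodule_quotient (LinearMap.ker v)
    refine ⟨this, ?_⟩
    rw [← v.finrank_range_add_finrank_ker, add_comm]
    exact add_le_add ((Submodule.finrank_mono hker).trans u.finrank_range_le)
      (Submodule.finrank_le _)
  refine ⟨fun n => (key n).1, (hX.2.union hZ.2).subset fun n hn => ?_⟩
  by_contra h
  simp only [Set.mem_union, Set.mem_ofPred_eq, ne_eq, not_or, not_not] at h hn
  have := (key n).2
  lia

end homFinite

/-! ### Projective objects in the bounded derived category -/

section derived

variable {K : Type w} [Field K] {C : Type u} [Category.{v} C] [Abelian C] [Linear K C]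
  [HasDerivedCategory.{v'} C]

open DerivedCategory

/-- A shift of an object placed in degree `0` is placed in the opposite degree. -/
noncomputable def shiftSingleIso (P : C) (n : ℤ) :
    ((singleFunctor C 0).obj P)⟦n⟧ ≅ (singleFunctor C (-n)).obj P :=
  ((singleFunctors C).shiftIso n (-n) 0 (by lia)).app P

lemma hom_eq_zero_of_isLE {P : C} [Projective P] {X : DerivedCategory C} {n m : ℤ} (h : m < n)
    [X.IsLE m] (f : (singleFunctor C n).obj P ⟶ X) : f = 0 := by
  obtain ⟨L, _, ⟨e⟩⟩ := X.exists_iso_Q_obj_of_isLE m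
  rw [← cancel_mono e.hom, zero_comp]
  exact from_singleFunctor_obj_eq_zero_of_projective (L := L) (f ≫ e.hom) m h

lemma hom_eq_zero_of_isGE {P : C} {X : DerivedCategory C} {n m : ℤ} (h : n < m)
    [X.IsGE m] (f : (singleFunctor C n).obj P ⟶ X) : f = 0 :=
  TStructure.t.zero f n m h

lemma homFinite_singleFunctor {P : C} [Projective P] (hP : ∀ M : C, FiniteDimensional K (P ⟶ M))
    (X : DerivedCategory C) (a : ℤ) [X.IsGE a] [X.IsLE a] :
    HomFinite K ((singleFunctor C 0).obj P) X := by
  obtain ⟨M, ⟨e⟩⟩ := X.exists_iso_singleFunctor_obj_of_isGE_of_isLE a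
  have h0 (n : ℤ) (hn : -n ≠ a) : ∀ f : ((singleFunctor C 0).obj P)⟦n⟧ ⟶ X, f = 0 := by
    intro f
    rw [← cancel_epi (shiftSingleIso P n).inv, comp_zero]
    rcases lt_or_gt_of_ne hn with h | h
    · exact hom_eq_zero_of_isGE h _
    · exact hom_eq_zero_of_isLE h _
  have hfin (n : ℤ) : FiniteDimensional K (((singleFunctor C 0).obj P)⟦n⟧ ⟶ X) := by
    by_cases hn : -n = a
    · subst hn
      have := hP M
      let e' := (LinearEquiv.ofBijective ((singleFunctor C (-n)).mapLinearMap K)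
        ⟨(singleFunctor C (-n)).map_injective, (singleFunctor C (-n)).map_surjective⟩ :
        (P ⟶ M) ≃ₗ[K] _)
      exact (e'.trans (Linear.homCongr K (shiftSingleIso P n).symm e.symm)).finiteDimensional
    · have : Subsingleton (((singleFunctor C 0).obj P)⟦n⟧ ⟶ X) :=
        ⟨fun f g => by rw [h0 n hn f, h0 n hn g]⟩
      infer_instance
  refine ⟨hfin, (Set.finite_singleton (-a)).subset fun n hn => ?_⟩
  by_contra h
  have : Subsingleton (((singleFunctor C 0).obj P)⟦n⟧ ⟶ X) :=
    ⟨fun f g => by rw [h0 n (by simp at h; lia) f, h0 n (by simp at h; lia) g]⟩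
  exact hn Module.finrank_zero_of_subsingleton

/-- The outer bounds pass to the pieces by rotation: `M⟦-1⟧` lives in degrees at least `b + 2`, and
`L⟦1⟧` in degrees at most `b - 1`. -/
lemma exists_truncation (X : DerivedCategory C) (a b : ℤ) (hab : a ≤ b) [X.IsGE a] [X.IsLE (b + 1)] :
    ∃ (L M : DerivedCategory C) (f : L ⟶ X) (g : X ⟶ M) (h : M ⟶ L⟦(1 : ℤ)⟧),
      Triangle.mk f g h ∈ distTriang _ ∧ L.IsGE a ∧ L.IsLE b ∧ M.IsGE (b + 1) ∧ M.IsLE (b + 1) := by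
  obtain ⟨L, M, hL, hM, f, g, h, hT⟩ := TStructure.t.exists_triangle X b (b + 1) rfl
  have hL' : TStructure.t.IsLE L b := ⟨hL⟩
  have hM' : TStructure.t.IsGE M (b + 1) := ⟨hM⟩
  refine ⟨L, M, f, g, h, hT, ?_, hL', hM', ?_⟩
  · refine TStructure.t.isGE₂ _ (inv_rot_of_distTriang _ hT) a ?_ ‹_›
    have := TStructure.t.isGE_shift M (b + 1) (-1) (b + 2)
    exact TStructure.t.isGE_of_ge (M⟦(-1 : ℤ)⟧) a (b + 2)
  · refine TStructure.t.isLE₂ _ (rot_of_distTriang _ hT) (b + 1) ‹_› ?_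
    have := TStructure.t.isLE_shift L b 1 (b - 1)
    exact TStructure.t.isLE_of_le (L⟦(1 : ℤ)⟧) (b - 1) (b + 1)

/-- Induction on the number of degrees supporting `X`, cutting off the top one each time. -/
lemma homFinite_of_projective {P : C} [Projective P]
    (hP : ∀ M : C, FiniteDimensional K (P ⟶ M)) (X : DerivedCategory C)
    (hX : TStructure.t.bounded X) : HomFinite K ((singleFunctor C 0).obj P) X := by
  obtain ⟨⟨a, ha⟩, ⟨b, hb⟩⟩ := hX
  obtain ⟨N, hN⟩ : ∃ N : ℕ, b ≤ a + N := ⟨(b - a).toNat, by lia⟩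
  have hb' : X.IsLE (a + N) := TStructure.t.isLE_of_le X b _ hN
  clear hN hb
  induction N generalizing X with
  | zero =>
    rw [Nat.cast_zero, add_zero] at hb'
    exact homFinite_singleFunctor hP X a
  | succ N ih =>
    rw [Nat.cast_succ, ← add_assoc] at hb'
    obtain ⟨L, M, f, g, h, hT, _, _, _, _⟩ := exists_truncation X a (a + N) (by lia)
    exact .of_distTriang hT (ih L ‹_› ‹_›) (homFinite_singleFunctor hP M (a + N + 1))

/-- A bounded complex receiving no morphism from the shifts of a family of projective objects
which detects zero objects is zero. -/
lemma isZero_of_rightPerp_projective {ι : Type*} {P : ι → C} [∀ i, Projective (P i)]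
    (hP : ∀ M : C, (∀ i (f : P i ⟶ M), f = 0) → IsZero M) (X : DerivedCategory C)
    (hX : TStructure.t.bounded X) (h : ∀ i, rightPerp ((singleFunctor C 0).obj (P i)) X) :
    IsZero X := by
  obtain ⟨⟨a, ha⟩, ⟨b, hb⟩⟩ := hX
  -- Counting from `a - 1` makes the base case an object both below and above the gap, hence zero.
  -- Each step shows that the top piece vanishes and lowers the upper bound.
  obtain ⟨N, hN⟩ : ∃ N : ℕ, b ≤ a - 1 + N := ⟨(b - a + 1).toNat, by lia⟩
  have hb' : X.IsLE (a - 1 + N) := TStructure.t.isLE_of_le X b _ hN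
  clear hN hb
  induction N with
  | zero =>
    rw [Nat.cast_zero, add_zero] at hb'
    exact TStructure.t.isZero X (a - 1) a
  | succ N ih =>
    refine ih ?_
    rw [Nat.cast_succ, ← add_assoc] at hb'
    set c := a - 1 + N with hc
    obtain ⟨L, M, hL, hM, f, g, h', hT⟩ := TStructure.t.exists_triangle X c (c + 1) rfl
    have hL' : TStructure.t.IsLE L c := ⟨hL⟩
    have hM' : M.IsGE (c + 1) := ⟨hM⟩
    have hL1 : (L⟦(1 : ℤ)⟧).IsLE (c - 1) := TStructure.t.isLE_shift L c 1 (c - 1)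
    have hL2 : (L⟦(1 : ℤ)⟧).IsLE (c + 1) :=
      TStructure.t.isLE_of_le (L⟦(1 : ℤ)⟧) (c - 1) (c + 1)
    have hM1 : M.IsLE (c + 1) :=
      TStructure.t.isLE₂ _ (rot_of_distTriang _ hT) (c + 1) hb' hL2
    obtain ⟨M', ⟨e⟩⟩ := M.exists_iso_singleFunctor_obj_of_isGE_of_isLE (c + 1)
    have hM0 : IsZero M' := by
      refine hP _ fun i φ => (singleFunctor C (c + 1)).map_injective ?_
      rw [Functor.map_zero, ← cancel_mono e.inv, zero_comp]
      set ψ : (singleFunctor C (c + 1)).obj (P i) ⟶ M :=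
        (singleFunctor C (c + 1)).map φ ≫ e.inv
      -- A map from the projective to the top piece lifts to `X`, as the obstruction lands in
      -- `L⟦1⟧`, in strictly lower degrees; the lift vanishes by orthogonality.
      obtain ⟨t, ht⟩ : ∃ t : (singleFunctor C (c + 1)).obj (P i) ⟶ X, ψ = t ≫ g :=
        Triangle.coyoneda_exact₃ _ hT ψ
          (hom_eq_zero_of_isLE (X := L⟦(1 : ℤ)⟧) (m := c - 1) (by lia) _)
      have i' := shiftSingleIso (P i) (-(c + 1))
      rw [neg_neg] at i'
      have h0 := h i _ (i'.hom ≫ t)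
      rw [Preadditive.IsIso.comp_left_eq_zero] at h0
      rw [ht, h0, zero_comp]
    have hM0' : IsZero M := ((singleFunctor C (c + 1)).map_isZero hM0).of_iso e
    have : IsIso f := (Triangle.isZero₃_iff_isIso₁ _ hT).1 hM0'
    exact TStructure.t.isLE_of_iso (asIso f) c

variable (C) in
/-- The object of the bounded derived category given by an object in degree `0`. -/
noncomputable def boundedSingle : C ⥤ Bounded C :=
  TStructure.t.bounded.lift (singleFunctor C 0)
    fun _ => ⟨⟨0, inferInstanceAs (IsGE _ 0)⟩, ⟨0, inferInstanceAs (IsLE _ 0)⟩⟩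

lemma homFinite_boundedSingle {P : C} [Projective P]
    (hP : ∀ M : C, FiniteDimensional K (P ⟶ M)) (X : Bounded C) :
    HomFinite K ((boundedSingle C).obj P) X :=
  homFinite_of_map (Bounded.ι (C := C)) (homFinite_of_projective hP X.1 X.2)

lemma isZero_of_rightPerp_boundedSingle {ι : Type*} {P : ι → C} [∀ i, Projective (P i)]
    (hP : ∀ M : C, (∀ i (f : P i ⟶ M), f = 0) → IsZero M) (X : Bounded C)
    (h : ∀ i, rightPerp ((boundedSingle C).obj (P i)) X) : IsZero X := by
  have := isZero_of_rightPerp_projective hP X.1 X.2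
    fun i => rightPerp_map (Bounded.ι (C := C)) (h i)
  rw [IsZero.iff_id_eq_zero] at this ⊢
  exact (Bounded.ι (C := C)).map_injective this

lemma singleFunctor_hom_eq_zero {P M : C} [Projective P] {a b : ℤ} (hab : a ≠ b)
    (f : ((singleFunctor C 0).obj P)⟦a⟧ ⟶ ((singleFunctor C 0).obj M)⟦b⟧) : f = 0 := by
  rw [← cancel_epi (shiftSingleIso P a).inv, ← cancel_mono (shiftSingleIso M b).hom, comp_zero,
    zero_comp]
  rcases lt_or_gt_of_ne hab with h | h
  · exact hom_eq_zero_of_isLE (m := -b) (by lia) _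
  · exact hom_eq_zero_of_isGE (m := -b) (by lia) _

lemma boundedSingle_hom_eq_zero {P M : C} [Projective P] {a b : ℤ} (hab : a ≠ b)
    (f : ((boundedSingle C).obj P)⟦a⟧ ⟶ ((boundedSingle C).obj M)⟦b⟧) : f = 0 :=
  map_shift_eq_zero (Bounded.ι (C := C)) (singleFunctor_hom_eq_zero hab) f

lemma boundedSingle_exists_hom {P M : C} (a : ℤ)
    (f : ((boundedSingle C).obj P)⟦a⟧ ⟶ ((boundedSingle C).obj M)⟦a⟧) :
    ∃ g : P ⟶ M, f = ((boundedSingle C).map g)⟦a⟧' := by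
  obtain ⟨f', rfl⟩ := (shiftFunctor (Bounded C) a).map_surjective f
  obtain ⟨g, hg⟩ := (singleFunctor C 0).map_surjective ((Bounded.ι (C := C)).map f')
  refine ⟨g, ?_⟩
  congr 1
  exact (Bounded.ι (C := C)).map_injective hg.symm

instance : (boundedSingle C).Additive := ⟨fun {_ _ f g} =>
  (Bounded.ι (C := C)).map_injective ((singleFunctor C 0).map_add (f := f) (g := g))⟩

instance : (boundedSingle C).Linear K := ⟨fun f r =>
  (Bounded.ι (C := C)).map_injective (Functor.Linear.map_smul (F := singleFunctor C 0) f r)⟩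

instance : (boundedSingle C).Faithful := ⟨fun h =>
  (singleFunctor C 0).map_injective (congrArg (Bounded.ι (C := C)).map h)⟩

lemma isExc_boundedSingle {P : C} [Projective P] (h : ∀ f : P ⟶ P, ∃ c : K, f = c • 𝟙 P)
    (h0 : 𝟙 P ≠ 0) : IsExc K ((boundedSingle C).obj P) where
  eq_zero a b hab := boundedSingle_hom_eq_zero hab
  exists_smul a f := by
    obtain ⟨g, rfl⟩ := boundedSingle_exists_hom a f
    obtain ⟨c, rfl⟩ := h g
    exact ⟨c, by simp⟩
  id_ne_zero h' := h0 ((boundedSingle C).map_injective (by simpa using h'))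

lemma heredPair_boundedSingle {P Q : C} [Projective P] [Projective Q]
    (hP : ∀ f : P ⟶ P, ∃ c : K, f = c • 𝟙 P) (hP0 : 𝟙 P ≠ 0)
    (hQ : ∀ f : Q ⟶ Q, ∃ c : K, f = c • 𝟙 Q) (hQ0 : 𝟙 Q ≠ 0)
    (hQP : ∀ f : Q ⟶ P, f = 0) :
    HeredPair K ((boundedSingle C).obj P) ((boundedSingle C).obj Q) where
  exc₁ := isExc_boundedSingle hP hP0
  exc₂ := isExc_boundedSingle hQ hQ0
  eq_zero a b f := by
    by_cases hab : a = b
    · subst hab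
      obtain ⟨g, rfl⟩ := boundedSingle_exists_hom a f
      rw [hQP g, Functor.map_zero, Functor.map_zero]
    · exact boundedSingle_hom_eq_zero hab f
  hom_eq_zero a b hab := boundedSingle_hom_eq_zero hab

lemma exists_smul_boundedSingle {P Q : C} {h : P ⟶ Q} (hh : ∀ f : P ⟶ Q, ∃ c : K, f = c • h)
    (a : ℤ) (f : ((boundedSingle C).obj P)⟦a⟧ ⟶ ((boundedSingle C).obj Q)⟦a⟧) :
    ∃ c : K, f = c • ((boundedSingle C).map h)⟦a⟧' := by
  obtain ⟨g, rfl⟩ := boundedSingle_exists_hom a f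
  obtain ⟨c, rfl⟩ := hh g
  exact ⟨c, by simp⟩

/-- The approximation leaves a remainder orthogonal to both projectives, and together they detect
zero objects. -/
lemma span_boundedSingle {P Q : C} [Projective P] [Projective Q]
    (hE : ExcPair K ((boundedSingle C).obj P) ((boundedSingle C).obj Q))
    (hP : ∀ M : C, FiniteDimensional K (P ⟶ M)) (hQ : ∀ M : C, FiniteDimensional K (Q ⟶ M))
    (hz : ∀ M : C, (∀ f : P ⟶ M, f = 0) → (∀ f : Q ⟶ M, f = 0) → IsZero M) (X : Bounded C) :
    span ((boundedSingle C).obj P) ((boundedSingle C).obj Q) X := by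
  obtain ⟨B, Z₂, A, Z, f₂, g₂, δ₂, f₁, g₁, δ₁, hT₂, hT₁, hA, hB, hZ₁, hZ₂⟩ :=
    hE.exists_approximation (homFinite_boundedSingle hP) (homFinite_boundedSingle hQ) X
  have : ∀ i : Bool, Projective (bif i then P else Q) := by rintro (_ | _) <;> assumption
  have hZ : IsZero Z := isZero_of_rightPerp_boundedSingle (P := fun i : Bool => bif i then P else Q)
    (fun M hM => hz M (hM true) (hM false)) Z (by rintro (_ | _) <;> assumption)
  have : IsIso f₁ := (Triangle.isZero₃_iff_isIso₁ _ hT₁).1 hZ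
  have hZ₂' := hA.of_iso (asIso f₁)
  exact (span _ _).ext_of_isTriangulatedClosed₂ _ hT₂ (finiteSum_span_right hB)
    (finiteSum_span_left hZ₂')

lemma finiteSum_boundedSingle {P : C} [Projective P]
    (hE : IsExc K ((boundedSingle C).obj P)) (hP : ∀ M : C, FiniteDimensional K (P ⟶ M))
    (hz : ∀ M : C, (∀ f : P ⟶ M, f = 0) → IsZero M) (X : Bounded C) :
    FiniteSum (shiftsIn ((boundedSingle C).obj P) Set.univ) X := by
  obtain ⟨Y, Z, f, g, δ, hT, hY, hZ⟩ := exists_approximation hE X (homFinite_boundedSingle hP X)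
  have hZ : IsZero Z := isZero_of_rightPerp_boundedSingle (P := fun _ : Unit => P)
    (fun M hM => hz M (hM ())) Z fun _ => hZ
  have : IsIso f := (Triangle.isZero₃_iff_isIso₁ _ hT).1 hZ
  exact hY.of_iso (asIso f)

end derived


/-! ### Projective representations of quivers -/

section

variable {K : Type w} [Field K] {Q : Type} [Quiver.{0} Q]

lemma rep_map_id_apply (M : QuiverRep K Q) (x : Paths Q) (m : M.obj x) :
    (M.map (𝟙 x)).hom.hom m = m := by
  rw [M.map_id]
  rfl

lemma rep_hom_naturality_apply {M N : QuiverRep K Q} (f : M ⟶ N) {x y : Paths Q} (p : x ⟶ y)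
    (m : M.obj x) :
    (f.app y).hom.hom ((M.map p).hom.hom m) = (N.map p).hom.hom ((f.app x).hom.hom m) :=
  congr($(f.naturality p).hom.hom m)

lemma linearMap_finsupp_ext {α V : Type*} [AddCommGroup V] [Module K V] {f g : (α →₀ K) →ₗ[K] V}
    (h : ∀ a, f (Finsupp.single a 1) = g (Finsupp.single a 1)) : f = g :=
  Finsupp.lhom_ext' fun a => LinearMap.ext_ring (h a)

variable (K) in
/-- The representation spanned by the paths starting at a vertex. -/
noncomputable def pathRep (v : Paths Q) [∀ x : Paths Q, Finite (v ⟶ x)] : QuiverRep K Q where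
  obj x := FGModuleCat.of K ((v ⟶ x) →₀ K)
  map f := FGModuleCat.ofHom (Finsupp.lmapDomain K K (· ≫ f))
  map_id x := by
    refine FGModuleCat.hom_ext (linearMap_finsupp_ext fun p => ?_)
    change Finsupp.mapDomain (· ≫ 𝟙 x) (Finsupp.single p 1) = Finsupp.single p 1
    simp
  map_comp f g := by
    refine FGModuleCat.hom_ext (linearMap_finsupp_ext fun p => ?_)
    change Finsupp.mapDomain (· ≫ f ≫ g) (Finsupp.single p 1) =
      Finsupp.mapDomain (· ≫ g) (Finsupp.mapDomain (· ≫ f) (Finsupp.single p 1))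
    simp

variable (v : Paths Q) [∀ x : Paths Q, Finite (v ⟶ x)]

/-- The morphism from the path representation given by a vector. -/
noncomputable def pathRepDesc {M : QuiverRep K Q} (m : M.obj v) : pathRep K v ⟶ M where
  app x := FGModuleCat.ofHom (Finsupp.linearCombination K fun p : v ⟶ x => (M.map p).hom.hom m)
  naturality x y f := by
    refine FGModuleCat.hom_ext (linearMap_finsupp_ext fun p => ?_)
    change Finsupp.linearCombination K (fun p : v ⟶ y => (M.map p).hom.hom m)
        (Finsupp.mapDomain (· ≫ f) (Finsupp.single p 1)) = (M.map f).hom.hom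
      (Finsupp.linearCombination K (fun p : v ⟶ x => (M.map p).hom.hom m) (Finsupp.single p 1))
    simp

/-- The vector given by a morphism from the path representation. -/
noncomputable def pathRepEval (M : QuiverRep K Q) : (pathRep K v ⟶ M) →ₗ[K] M.obj v where
  toFun f := (f.app v).hom.hom (Finsupp.single (𝟙 v) (1 : K))
  map_add' _ _ := rfl
  map_smul' _ _ := rfl

lemma pathRepEval_desc {M : QuiverRep K Q} (m : M.obj v) :
    pathRepEval v M (pathRepDesc v m) = m := by
  refine (Finsupp.linearCombination_single K (1 : K) (𝟙 v)).trans ?_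
  rw [one_smul, rep_map_id_apply]

/-- Yoneda: every path is the image of the trivial path at `v` under its own action, so the value
there determines the morphism. -/
lemma pathRepEval_injective (M : QuiverRep K Q) : Function.Injective (pathRepEval v M) := by
  intro f g hfg
  refine NatTrans.ext (funext fun x => FGModuleCat.hom_ext (linearMap_finsupp_ext fun p => ?_))
  have h (f : pathRep K v ⟶ M) : (f.app x).hom.hom (Finsupp.single p (1 : K)) =
      (M.map p).hom.hom (pathRepEval v M f) := by
    refine Eq.trans ?_ (rep_hom_naturality_apply f p (Finsupp.single (𝟙 v) (1 : K)))
    congr 1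
    refine Eq.trans ?_ (Finsupp.mapDomain_single).symm
    rw [Category.id_comp]
  exact (h f).trans ((congrArg _ hfg).trans (h g).symm)

lemma pathRepEval_comp {M N : QuiverRep K Q} (f : pathRep K v ⟶ M) (g : M ⟶ N) :
    pathRepEval v N (f ≫ g) = (g.app v).hom.hom (pathRepEval v M f) := rfl

instance (M : QuiverRep K Q) : FiniteDimensional K (pathRep K v ⟶ M) :=
  Module.Finite.of_injective (pathRepEval v M) (pathRepEval_injective v M)

lemma fgModuleCat_surjective_of_epi {V W : FGModuleCat.{w} K} (f : V ⟶ W) [Epi f] :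
    Function.Surjective f.hom.hom :=
  (ModuleCat.epi_iff_surjective ((forget₂ (FGModuleCat K) (ModuleCat K)).map f)).1 inferInstance

instance : Projective (pathRep K v) where
  factors {M N} f e he := by
    have : Epi (e.app v) := inferInstance
    obtain ⟨m, hm⟩ := fgModuleCat_surjective_of_epi (e.app v) (pathRepEval v _ f)
    refine ⟨pathRepDesc v m, pathRepEval_injective v _ ?_⟩
    rw [pathRepEval_comp, pathRepEval_desc, hm]

lemma isZero_of_pathRep [∀ v x : Paths Q, Finite (v ⟶ x)] (M : QuiverRep K Q)
    (h : ∀ (v : Paths Q) (f : pathRep K v ⟶ M), f = 0) : IsZero M := by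
  rw [IsZero.iff_id_eq_zero]
  refine NatTrans.ext (funext fun x => FGModuleCat.hom_ext (LinearMap.ext fun m => ?_))
  change m = 0
  rw [← pathRepEval_desc x m, h x (pathRepDesc x m), map_zero]

/-- By Yoneda the morphisms from the projective at `v` to that at `w` are spanned by the paths from
`w` to `v`; the direction is reversed. -/
lemma pathRep_hom_eq_zero {v w : Paths Q} [∀ x : Paths Q, Finite (v ⟶ x)]
    [∀ x : Paths Q, Finite (w ⟶ x)] [IsEmpty (w ⟶ v)] (f : pathRep K v ⟶ pathRep K w) : f = 0 :=
  pathRepEval_injective v _ (Subsingleton.elim (α := (w ⟶ v) →₀ K) _ _)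

lemma pathRep_exists_smul {v w : Paths Q} [∀ x : Paths Q, Finite (v ⟶ x)]
    [∀ x : Paths Q, Finite (w ⟶ x)] (p : w ⟶ v) (hp : ∀ q : w ⟶ v, q = p) :
    ∃ h : pathRep K v ⟶ pathRep K w, h ≠ 0 ∧ ∀ f : pathRep K v ⟶ pathRep K w, ∃ c : K, f = c • h := by
  let m : (pathRep K w).obj v := Finsupp.single p (1 : K)
  have hm : pathRepEval v _ (pathRepDesc v m) = m := pathRepEval_desc v m
  refine ⟨pathRepDesc v m, fun h => ?_, fun f => ?_⟩
  · rw [h, map_zero] at hm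
    exact one_ne_zero (Finsupp.single_eq_zero.1 hm.symm)
  · obtain ⟨x, hx⟩ : ∃ x : (w ⟶ v) →₀ K, x = pathRepEval v _ f := ⟨_, rfl⟩
    refine ⟨x p, pathRepEval_injective v _ ?_⟩
    rw [map_smul, hm, ← hx]
    refine Finsupp.ext fun q => ?_
    obtain rfl := hp q
    exact (by simp : x q = (x q • Finsupp.single q (1 : K)) q)

lemma pathRep_id_ne_zero : 𝟙 (pathRep K v) ≠ 0 := fun h => by
  have := congrArg (pathRepEval v _) h
  rw [map_zero] at this
  exact one_ne_zero (Finsupp.single_eq_zero.1 this)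

lemma pathRep_exists_smul_id (hp : ∀ q : v ⟶ v, q = 𝟙 v) (f : pathRep K v ⟶ pathRep K v) :
    ∃ c : K, f = c • 𝟙 (pathRep K v) := by
  obtain ⟨h, -, hh⟩ := pathRep_exists_smul (K := K) (𝟙 v) hp
  obtain ⟨a, ha⟩ := hh f
  obtain ⟨b, hb⟩ := hh (𝟙 _)
  have hb0 : b ≠ 0 := fun h0 => pathRep_id_ne_zero (K := K) v (by rw [hb, h0, zero_smul])
  exact ⟨a * b⁻¹, by rw [hb, smul_smul, mul_assoc, inv_mul_cancel₀ hb0, mul_one, ha]⟩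

end

/-! ### The Kronecker quivers -/

section

variable (n : ℕ)

/-- The source of the Kronecker quiver. -/
abbrev kSource : Paths (KroneckerVertex n) := KroneckerVertex.source

/-- The target of the Kronecker quiver. -/
abbrev kTarget : Paths (KroneckerVertex n) := KroneckerVertex.target

lemma kSource_path_eq (p : kSource n ⟶ kSource n) : p = 𝟙 _ := by
  change Quiver.Path (V := KroneckerVertex n) .source .source at p
  cases p with
  | nil => rfl
  | cons q e =>
    change KroneckerArrow n _ _ at e
    cases e

lemma kTarget_isEmpty : IsEmpty (kTarget n ⟶ kSource n) := by
  refine ⟨fun p => ?_⟩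
  change Quiver.Path (V := KroneckerVertex n) .target .source at p
  cases p with
  | cons q e =>
    change KroneckerArrow n _ _ at e
    cases e

lemma kTarget_path_eq (p : kTarget n ⟶ kTarget n) : p = 𝟙 _ := by
  change Quiver.Path (V := KroneckerVertex n) .target .target at p
  cases p with
  | nil => rfl
  | cons q e =>
    change KroneckerArrow n _ _ at e
    cases e
    exact (kTarget_isEmpty n).elim q

lemma kSource_path_exists (p : kSource n ⟶ kTarget n) :
    ∃ i, p = (Paths.of (KroneckerVertex n)).map (KroneckerArrow.arrow i) := by
  change Quiver.Path (V := KroneckerVertex n) .source .target at p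
  cases p with
  | cons q e =>
    change KroneckerArrow n _ _ at e
    cases e with
    | arrow i =>
      obtain rfl := kSource_path_eq n q
      exact ⟨i, rfl⟩

instance (v x : Paths (KroneckerVertex n)) : Finite (v ⟶ x) := by
  rcases v with _ | _ <;> rcases x with _ | _
  · exact @Finite.of_subsingleton _ ⟨fun p q => (kSource_path_eq n p).trans (kSource_path_eq n q).symm⟩
  · exact Finite.of_surjective _ fun p => (kSource_path_exists n p).imp fun _ h => h.symm
  · exact @Finite.of_subsingleton _ (@IsEmpty.instSubsingleton _ (kTarget_isEmpty n))
  · exact @Finite.of_subsingleton _ ⟨fun p q => (kTarget_path_eq n p).trans (kTarget_path_eq n q).symm⟩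

lemma emptyQuiver_path_eq {v : Paths (Quiver.Empty Unit)} (p : v ⟶ v) : p = 𝟙 _ := by
  change Quiver.Path (V := Quiver.Empty Unit) v v at p
  cases p with
  | nil => rfl
  | cons q e => exact e.elim

instance (v x : Paths (Quiver.Empty Unit)) : Finite (v ⟶ x) :=
  @Finite.of_subsingleton _ ⟨fun p q => (emptyQuiver_path_eq p).trans (emptyQuiver_path_eq q).symm⟩

end


/-! ### Realising points as copies of D^b(A₁) -/

section

variable {K : Type w} [Field K] {Q : Type} [Quiver.{0} Q]

open MonoidalCategory

/-- The functor sending a vector space to its tensor product with a representation. -/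
noncomputable def tensorRep (M : QuiverRep K Q) : FGModuleCat.{w} K ⥤ QuiverRep K Q :=
  curriedTensor (FGModuleCat.{w} K) ⋙ (Functor.whiskeringLeft _ _ _).obj M

instance (M : QuiverRep K Q) : (tensorRep M).Additive where
  map_add {V W f g} := by
    ext x : 2
    exact MonoidalPreadditive.add_whiskerRight f g

instance (M : QuiverRep K Q) : (tensorRep M).Linear K where
  map_smul f r := by
    ext x : 2
    exact MonoidalLinear.smul_whiskerRight r f (M.obj x)

/-- Tensoring the unit gives back the representation. -/
noncomputable def tensorRepUnitIso (M : QuiverRep K Q) :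
    (tensorRep M).obj (𝟙_ (FGModuleCat K)) ≅ M :=
  NatIso.ofComponents (fun x => λ_ (M.obj x)) (fun f => leftUnitor_naturality (M.map f))

instance (V : FGModuleCat.{w} K) : Projective V where
  factors {X Y} f e he := by
    obtain ⟨s, hs⟩ := e.hom.hom.exists_rightInverse_of_surjective
      (LinearMap.range_eq_top.2 (fgModuleCat_surjective_of_epi e))
    refine ⟨FGModuleCat.ofHom (s ∘ₗ f.hom.hom), FGModuleCat.hom_ext (LinearMap.ext fun x => ?_)⟩
    exact congr($hs (f.hom.hom x))

/-- An additive functor from a category all of whose objects are projective is exact. -/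
lemma exact_of_projective {C : Type u} [Category.{v} C] [Abelian C] {D : Type u'} [Category.{v'} D]
    [Abelian D] (hC : ∀ X : C, Projective X) (F : C ⥤ D) [F.Additive] :
    PreservesFiniteLimits F ∧ PreservesFiniteColimits F :=
  (F.exact_tfae.out 0 3).1 fun (S : ShortComplex C) (hS : S.ShortExact) =>
    have := hC S.X₃
    (hS.splittingOfProjective.map F).shortExact

instance (M : QuiverRep K Q) : PreservesFiniteLimits (tensorRep M) :=
  (exact_of_projective (fun _ => inferInstance) _).1

instance (M : QuiverRep K Q) : PreservesFiniteColimits (tensorRep M) :=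
  (exact_of_projective (fun _ => inferInstance) _).2

/-- The vertex of the quiver `A₁`. -/
abbrev a₁Vertex : Paths (Quiver.Empty Unit) := ()

/-- The functor from representations of `A₁` to representations of `Q` given by a
representation. -/
noncomputable abbrev a₁Functor (M : QuiverRep K Q) :
    QuiverRep K (Quiver.Empty Unit) ⥤ QuiverRep K Q :=
  (evaluation _ _).obj a₁Vertex ⋙ tensorRep M

instance (M : QuiverRep K Q) : (a₁Functor M).Additive := inferInstance
instance (M : QuiverRep K Q) : (a₁Functor M).Linear K where
  map_smul f r := Functor.Linear.map_smul (F := tensorRep M) (f.app a₁Vertex) r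
instance (M : QuiverRep K Q) : PreservesFiniteLimits (a₁Functor M) := inferInstance
instance (M : QuiverRep K Q) : PreservesFiniteColimits (a₁Functor M) := inferInstance

variable (K) in
/-- The simple representation of `A₁`. -/
noncomputable abbrev a₁Rep : QuiverRep K (Quiver.Empty Unit) := pathRep K a₁Vertex

/-- The functor `a₁Functor M` sends the simple representation to `M`. -/
noncomputable def a₁FunctorIso (M : QuiverRep K Q) : (a₁Functor M).obj (a₁Rep K) ≅ M :=
  have : Subsingleton (a₁Vertex ⟶ a₁Vertex) :=
    ⟨fun p q => (emptyQuiver_path_eq p).trans (emptyQuiver_path_eq q).symm⟩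
  (tensorRep M).mapIso (LinearEquiv.toFGModuleCatIso
    (Finsupp.uniqueLinearEquiv K K (𝟙 a₁Vertex))) ≪≫ tensorRepUnitIso M

variable (K) in
/-- The generator of `D^b(A₁)`. -/
noncomputable abbrev a₁Object : DerivedCategory.Bounded (QuiverRep K (Quiver.Empty Unit)) :=
  (boundedSingle _).obj (a₁Rep K)

lemma isExc_a₁Object : IsExc K (a₁Object K) :=
  isExc_boundedSingle (pathRep_exists_smul_id _ emptyQuiver_path_eq) (pathRep_id_ne_zero _)

lemma finiteSum_a₁Object (X : DerivedCategory.Bounded (QuiverRep K (Quiver.Empty Unit))) :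
    FiniteSum (shiftsIn (a₁Object K) Set.univ) X :=
  finiteSum_boundedSingle isExc_a₁Object (fun _ => inferInstance)
    (fun M hM => isZero_of_pathRep M fun _ => hM) X

-- The functor is derived from the exact functor `a₁Functor M`. It lands in bounded objects because
-- every object of the source is a finite sum of shifts of the generator, whose image is `M`.
open DerivedCategory in
lemma exists_functor_from_DbA₁ (M : QuiverRep K Q) :
    ∃ (F : Bounded (QuiverRep K (Quiver.Empty Unit)) ⥤ Bounded (QuiverRep K Q))
      (_ : F.CommShift ℤ), F.IsTriangulated ∧ F.Linear K ∧
        Nonempty (F.obj (a₁Object K) ≅ (boundedSingle _).obj M) := by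
  let G : Bounded (QuiverRep K (Quiver.Empty Unit)) ⥤ DerivedCategory (QuiverRep K Q) :=
    Bounded.ι ⋙ (a₁Functor M).mapDerivedCategory
  let e : G.obj (a₁Object K) ≅ (singleFunctor _ 0).obj M :=
    ((a₁Functor M).mapDerivedCategorySingleFunctor 0).app (a₁Rep K) ≪≫
      (singleFunctor _ 0).mapIso (a₁FunctorIso M)
  have hb : IsTriSubcat (TStructure.t (C := QuiverRep K Q)).bounded :=
    ⟨inferInstance, inferInstance⟩
  have hb' := isTriSubcat_inverseImage G hb
  have hG : ∀ X, TStructure.t.bounded (G.obj X) := fun X =>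
    (finiteSum_a₁Object X).le hb' (shiftsIn_le hb'
      (TStructure.t.bounded.prop_of_iso e.symm ((boundedSingle _).obj M).2) _)
  refine ⟨TStructure.t.bounded.lift G hG, inferInstance, inferInstance, ⟨fun f r => ?_⟩, ⟨?_⟩⟩
  · exact Bounded.ι.map_injective (Functor.Linear.map_smul (F := G) f r)
  · exact TStructure.t.bounded.fullyFaithfulι.preimageIso e

end

section

variable {K : Type w} [Field K] {Q : Type} [Quiver.{0} Q]
  {T : Type u} [Category.{v} T] [HasZeroObject T] [HasShift T ℤ]
  [Preadditive T] [Linear K T] [∀ n : ℤ, (shiftFunctor T n).Additive] [Pretriangulated T]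

/-- A linear exact functor taking the generator to an exceptional object is automatically fully
faithful, and its essential image is the point. -/
lemma point_mem_of_functor {E : T} (hE : IsExc K E)
    (F : DerivedCategory.Bounded (QuiverRep K (Quiver.Empty Unit)) ⥤ T) [F.CommShift ℤ] [F.IsTriangulated] [F.Linear K]
    (e : F.obj (a₁Object K) ≅ E) : point E ∈ subcatsOfType K T {DbA₁ K} := by
  have hFE := hE.of_iso e.symm
  obtain ⟨_, _⟩ := fullyFaithful_of_isExc F isExc_a₁Object hFE finiteSum_a₁Object
  have h := point_map_eq_essImage F (E := a₁Object K) fun X => (finiteSum_a₁Object X).triGenerated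
  have h' : point E = point (F.obj (a₁Object K)) :=
    point_shift_iso (a := 0) (e.symm ≪≫ ((shiftFunctorZero T ℤ).app _).symm)
  exact mem_subcatsOfType_iff.2 ⟨DbA₁ K, rfl, F, ‹_›, ‹_›, ‹_›, ‹_›, ‹_›, h'.trans h⟩

/-- An abstract exceptional object of `T` comes with no functor out of D^b(A₁). One coming from a
representation does, namely the functor built from `M` followed by `F`. -/
lemma point_map_boundedSingle_mem {F : DerivedCategory.Bounded (QuiverRep K Q) ⥤ T} [F.CommShift ℤ] [F.IsTriangulated]
    [F.Linear K] {M : QuiverRep K Q} (hM : IsExc K (F.obj ((boundedSingle _).obj M))) :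
    point (F.obj ((boundedSingle _).obj M)) ∈ subcatsOfType K T {DbA₁ K} := by
  obtain ⟨G, _, _, _, ⟨e⟩⟩ := exists_functor_from_DbA₁ (K := K) M
  have : (G ⋙ F).Linear K := inferInstance
  exact point_mem_of_functor hM (G ⋙ F) (F.mapIso e)

end


/-! ### Direct sums of triangulated categories -/

section

variable {K : Type w} [Field K] {C : Type u} [Category.{v} C] [HasZeroObject C] [HasShift C ℤ]
  [Preadditive C] [Linear K C] [∀ n : ℤ, (shiftFunctor C n).Additive] [Pretriangulated C]
  {D : Type u'} [Category.{v'} D] [HasZeroObject D] [HasShift D ℤ]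
  [Preadditive D] [Linear K D] [∀ n : ℤ, (shiftFunctor D n).Additive] [Pretriangulated D]

lemma prod_shiftFunctorZero_inv_app (X : C × D) :
    ((shiftFunctorZero (C × D) ℤ).inv.app X) =
      ((shiftFunctorZero C ℤ).inv.app X.1, (shiftFunctorZero D ℤ).inv.app X.2) := by
  rfl

lemma prod_shiftFunctorAdd_inv_app (a b : ℤ) (X : C × D) :
    ((shiftFunctorAdd (C × D) a b).inv.app X) =
      ((shiftFunctorAdd C a b).inv.app X.1, (shiftFunctorAdd D a b).inv.app X.2) := by
  rfl

variable (C D) in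
/-- The inclusion of the first summand. -/
noncomputable def prodInl : C ⥤ C × D where
  obj X := (X, 0)
  map f := (f, 𝟙 _)

variable (C D) in
/-- The inclusion of the second summand. -/
noncomputable def prodInr : D ⥤ C × D where
  obj X := (0, X)
  map f := (𝟙 _, f)

lemma isZero_shift_zero (n : ℤ) : IsZero ((0 : C)⟦n⟧) :=
  (shiftFunctor C n).map_isZero (isZero_zero C)

noncomputable instance : (prodInl C D).CommShift ℤ where
  commShiftIso n := NatIso.ofComponents
    (fun X => Iso.prod (Iso.refl (X⟦n⟧)) ((isZero_zero D).iso (isZero_shift_zero n)))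
    (fun f => Prod.ext ((Category.comp_id _).trans (Category.id_comp _).symm)
      ((isZero_zero D).eq_of_src _ _))
  commShiftIso_zero := by
    ext X
    · simp [prod_shiftFunctorZero_inv_app]
      simp [prodInl]
    · exact (isZero_zero D).eq_of_src _ _
  commShiftIso_add a b := by
    ext X
    · simp [prod_shiftFunctorAdd_inv_app]
      simp [prodInl]
      change 𝟙 _ = (shiftFunctorAdd C a b).hom.app X ≫ (shiftFunctor C b).map (𝟙 (X⟦a⟧)) ≫
        (shiftFunctorAdd C a b).inv.app X
      simp
    · exact (isZero_zero D).eq_of_src _ _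

noncomputable instance : (prodInr C D).CommShift ℤ where
  commShiftIso n := NatIso.ofComponents
    (fun X => Iso.prod ((isZero_zero C).iso (isZero_shift_zero n)) (Iso.refl (X⟦n⟧)))
    (fun f => Prod.ext ((isZero_zero C).eq_of_src _ _)
      ((Category.comp_id _).trans (Category.id_comp _).symm))
  commShiftIso_zero := by
    ext X
    · exact (isZero_zero C).eq_of_src _ _
    · simp [prod_shiftFunctorZero_inv_app]
      simp [prodInr]
  commShiftIso_add a b := by
    ext X
    · exact (isZero_zero C).eq_of_src _ _
    · simp [prod_shiftFunctorAdd_inv_app]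
      simp [prodInr]
      change 𝟙 _ = (shiftFunctorAdd D a b).hom.app X ≫ (shiftFunctor D b).map (𝟙 (X⟦a⟧)) ≫
        (shiftFunctorAdd D a b).inv.app X
      simp

instance : (prodInl C D).IsTriangulated where
  map_distinguished T hT := by
    refine ⟨isomorphic_distinguished _ hT _ (Triangle.isoMk _ _ (Iso.refl _) (Iso.refl _)
      (Iso.refl _) ?_ ?_ ?_), isomorphic_distinguished _ (contractible_distinguished (0 : D)) _
        (Triangle.isoMk _ _ (Iso.refl _) (Iso.refl _) (Iso.refl _) ?_ ?_ ?_)⟩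
    · exact (Category.comp_id _).trans (Category.id_comp _).symm
    · exact (Category.comp_id _).trans (Category.id_comp _).symm
    · change (T.mor₃ ≫ 𝟙 _) ≫ (shiftFunctor C (1 : ℤ)).map (𝟙 _) = 𝟙 _ ≫ T.mor₃
      simp
    · exact (isZero_zero D).eq_of_src _ _
    · exact (isZero_zero D).eq_of_src _ _
    · exact (isZero_zero D).eq_of_src _ _

instance : (prodInr C D).IsTriangulated where
  map_distinguished T hT := by
    refine ⟨isomorphic_distinguished _ (contractible_distinguished (0 : C)) _
        (Triangle.isoMk _ _ (Iso.refl _) (Iso.refl _) (Iso.refl _) ?_ ?_ ?_),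
      isomorphic_distinguished _ hT _ (Triangle.isoMk _ _ (Iso.refl _) (Iso.refl _)
      (Iso.refl _) ?_ ?_ ?_)⟩
    · exact (isZero_zero C).eq_of_src _ _
    · exact (isZero_zero C).eq_of_src _ _
    · exact (isZero_zero C).eq_of_src _ _
    · exact (Category.comp_id _).trans (Category.id_comp _).symm
    · exact (Category.comp_id _).trans (Category.id_comp _).symm
    · change (T.mor₃ ≫ 𝟙 _) ≫ (shiftFunctor D (1 : ℤ)).map (𝟙 _) = 𝟙 _ ≫ T.mor₃
      simp

instance : (prodInl C D).Linear K where
  map_smul _ _ := Prod.ext rfl ((isZero_zero D).eq_of_src _ _)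

instance : (prodInr C D).Linear K where
  map_smul _ _ := Prod.ext ((isZero_zero C).eq_of_src _ _) rfl

instance : (prodInl C D).Full where
  map_surjective f := ⟨f.1, Prod.ext rfl ((isZero_zero D).eq_of_src _ _)⟩

instance : (prodInl C D).Faithful where
  map_injective h := congrArg Prod.fst h

instance : (prodInr C D).Full where
  map_surjective f := ⟨f.2, Prod.ext ((isZero_zero C).eq_of_src _ _) rfl⟩

instance : (prodInr C D).Faithful where
  map_injective h := congrArg Prod.snd h

lemma prodInl_prodInr_eq_zero {X : C} {Y : D} {a b : ℤ}
    (f : ((prodInl C D).obj X)⟦a⟧ ⟶ ((prodInr C D).obj Y)⟦b⟧) : f = 0 :=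
  Prod.ext ((isZero_shift_zero b).eq_of_tgt _ _) ((isZero_shift_zero a).eq_of_src _ _)

lemma prodInr_prodInl_eq_zero {X : C} {Y : D} {a b : ℤ}
    (f : ((prodInr C D).obj Y)⟦a⟧ ⟶ ((prodInl C D).obj X)⟦b⟧) : f = 0 :=
  Prod.ext ((isZero_shift_zero a).eq_of_src _ _) ((isZero_shift_zero b).eq_of_tgt _ _)

lemma heredPair_prod {E : C} {E' : D} (hE : IsExc K E) (hE' : IsExc K E') :
    HeredPair K ((prodInl C D).obj E) ((prodInr C D).obj E') where
  exc₁ := hE.map _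
  exc₂ := hE'.map _
  eq_zero _ _ := prodInr_prodInl_eq_zero
  hom_eq_zero _ _ _ := prodInl_prodInr_eq_zero

lemma span_prod {E : C} {E' : D} (hE : ∀ X, point E X) (hE' : ∀ X, point E' X) (X : C × D) :
    span ((prodInl C D).obj E) ((prodInr C D).obj E') X := by
  have hs := isTriSubcat_triGenerated
    (fun X => X = (prodInl C D).obj E ∨ X = (prodInr C D).obj E')
  have h₁ := point_le (isTriSubcat_inverseImage (prodInl C D) hs) (span_left _ _) _ (hE X.1)
  have h₂ := point_le (isTriSubcat_inverseImage (prodInr C D) hs) (span_right _ _) _ (hE' X.2)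
  -- The split triangle from the first summand of `X` to the second is contractible in each
  -- component.
  refine (span _ _).ext_of_isTriangulatedClosed₂ (Triangle.mk
    (show (prodInl C D).obj X.1 ⟶ X from (𝟙 _, 0)) (show X ⟶ (prodInr C D).obj X.2 from (0, 𝟙 _)) 0)
    ⟨?_, ?_⟩ h₁ h₂
  · exact contractible_distinguished X.1
  · exact contractible_distinguished₁ X.2

end


/-! ### Bounded derived categories of the Kronecker quivers -/

section

variable (K : Type w) [Field K] (n : ℕ)

/-- The projective representation at the target, as an object of the derived category. -/
noncomputable abbrev kTargetObj :
    DerivedCategory.Bounded (QuiverRep K (KroneckerVertex n)) :=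
  (boundedSingle _).obj (pathRep K (kTarget n))

/-- The projective representation at the source, as an object of the derived category. -/
noncomputable abbrev kSourceObj :
    DerivedCategory.Bounded (QuiverRep K (KroneckerVertex n)) :=
  (boundedSingle _).obj (pathRep K (kSource n))

lemma kSource_kTarget_hom_eq_zero (f : pathRep K (kSource n) ⟶ pathRep K (kTarget n)) : f = 0 :=
  have := kTarget_isEmpty n
  pathRep_hom_eq_zero f

/-- The target comes first: by the reversal in Yoneda, the arrows give maps from the projective at
the target to that at the source, and there are none back. -/
lemma heredPair_kronecker : HeredPair K (kTargetObj K n) (kSourceObj K n) :=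
  heredPair_boundedSingle (pathRep_exists_smul_id _ (kTarget_path_eq n)) (pathRep_id_ne_zero _)
    (pathRep_exists_smul_id _ (kSource_path_eq n)) (pathRep_id_ne_zero _)
    (kSource_kTarget_hom_eq_zero K n)

lemma isZero_kronecker (M : QuiverRep K (KroneckerVertex n))
    (h : ∀ f : pathRep K (kTarget n) ⟶ M, f = 0) (h' : ∀ f : pathRep K (kSource n) ⟶ M, f = 0) :
    IsZero M :=
  isZero_of_pathRep M (by rintro (_ | _); exacts [h', h])

lemma span_kronecker (X : DerivedCategory.Bounded (QuiverRep K (KroneckerVertex n))) :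
    span (kTargetObj K n) (kSourceObj K n) X :=
  span_boundedSingle (heredPair_kronecker K n).toExcPair (fun _ => inferInstance)
    (fun _ => inferInstance) (isZero_kronecker K n) X

/-- The connecting map of the short exact sequence lives in the derived category and is moved to the
bounded one by full faithfulness of `ι`. -/
lemma exists_cokernel_triangle {C : Type u} [Category.{v} C] [Abelian C] [HasDerivedCategory.{v'} C]
    {P Q : C} (h : P ⟶ Q) [Mono h] :
    ∃ d, Triangle.mk ((boundedSingle C).map h) ((boundedSingle C).map (cokernel.π h)) d ∈
      distTriang (DerivedCategory.Bounded C) := by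
  have hS : (ShortComplex.mk h (cokernel.π h) (cokernel.condition h)).ShortExact :=
    { exact := ShortComplex.exact_cokernel h }
  let ι := DerivedCategory.Bounded.ι (C := C)
  let δ : ι.obj ((boundedSingle C).obj (cokernel h)) ⟶ (ι.obj ((boundedSingle C).obj P))⟦(1 : ℤ)⟧ :=
    hS.singleδ
  refine ⟨ι.preimage (δ ≫ (ι.commShiftIso (1 : ℤ)).inv.app _), ?_⟩
  refine isomorphic_distinguished _ hS.singleTriangle_distinguished _ ?_
  refine Triangle.isoMk _ _ (Iso.refl _) (Iso.refl _) (Iso.refl _) ?_ ?_ ?_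
  · exact (Category.comp_id _).trans (Category.id_comp _).symm
  · exact (Category.comp_id _).trans (Category.id_comp _).symm
  · have key : ι.map (ι.preimage (δ ≫ (ι.commShiftIso (1 : ℤ)).inv.app _)) ≫
        (ι.commShiftIso (1 : ℤ)).hom.app _ = δ := by
      rw [ι.map_preimage, Category.assoc, Iso.inv_hom_id_app]
      exact Category.comp_id _
    exact (congrArg₂ (· ≫ ·) key (CategoryTheory.Functor.map_id _ _)).trans
      ((Category.comp_id δ).trans (Category.id_comp δ).symm)

/-- The nonzero morphism between the indecomposable projective representations of `A₂`. -/
lemma exists_kronecker_one : ∃ h : pathRep K (kTarget 1) ⟶ pathRep K (kSource 1), h ≠ 0 ∧ Mono h ∧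
    ∀ f : pathRep K (kTarget 1) ⟶ pathRep K (kSource 1), ∃ c : K, f = c • h := by
  obtain ⟨h, h0, hh⟩ := pathRep_exists_smul (K := K) (v := kTarget 1) (w := kSource 1)
    ((Paths.of (KroneckerVertex 1)).map (KroneckerArrow.arrow 0)) fun q => by
      obtain ⟨i, rfl⟩ := kSource_path_exists 1 q
      rw [Subsingleton.elim i 0]
  refine ⟨h, h0, ?_, hh⟩
  -- The kernel receives no nonzero map from either projective: from the target one such a map is a
  -- scalar `c` with `c • h = 0`, and from the source one there are no maps at all.
  refine Preadditive.mono_of_isZero_kernel h (isZero_kronecker K 1 _ (fun f => ?_) fun f => ?_)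
  · rw [← cancel_mono (kernel.ι h), zero_comp]
    obtain ⟨c, hc⟩ := pathRep_exists_smul_id _ (kTarget_path_eq 1) (f ≫ kernel.ι h)
    have h1 : c • h = 0 := by
      rw [← Category.id_comp h, ← Linear.smul_comp, ← hc, Category.assoc, kernel.condition,
        comp_zero]
    rw [hc, (smul_eq_zero.1 h1).resolve_right h0, zero_smul]
  · rw [← cancel_mono (kernel.ι h), zero_comp]
    exact kSource_kTarget_hom_eq_zero K 1 _

end

/-! ### Subcategories of discrete type -/

section

variable {K : Type w} [Field K] {T : Type u} [Category.{v} T] [HasZeroObject T] [HasShift T ℤ]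
  [Preadditive T] [Linear K T] [∀ n : ℤ, (shiftFunctor T n).Additive] [Pretriangulated T]

lemma subcatsOfType_mono {J J' : Set (LinTriCat.{w, w + 1, w + 1} K)} (h : J ⊆ J') :
    subcatsOfType K T J ⊆ subcatsOfType K T J' :=
  fun _ ⟨hB, hB', A, hA, e⟩ => ⟨hB, hB', A, h hA, e⟩

lemma exists_of_mem_subcatsOfType {J : Set (LinTriCat.{w, w + 1, w + 1} K)} {B : ObjectProperty T}
    (h : B ∈ subcatsOfType K T J) : ∃ A ∈ J, B ∈ subcatsOfType K T {A} := by
  obtain ⟨hB, hB', A, hA, e⟩ := h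
  exact ⟨A, hA, hB, hB', A, rfl, e⟩

lemma exists_functor_of_mem {A : LinTriCat.{w, w + 1, w + 1} K} {B : ObjectProperty T}
    (h : B ∈ subcatsOfType K T {A}) : ∃ (F : A.carrier ⥤ T) (_ : F.CommShift ℤ),
      F.IsTriangulated ∧ F.Linear K ∧ F.Full ∧ F.Faithful ∧ B = F.essImage := by
  obtain ⟨A', hA, h'⟩ := mem_subcatsOfType_iff.1 h
  obtain rfl : A' = A := hA
  exact h'

open DerivedCategory in
lemma exists_functor_of_mem_Db {Q : Type} [Quiver.{0} Q] {B : ObjectProperty T}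
    (h : B ∈ subcatsOfType K T {Db K Q}) :
    ∃ (F : Bounded (QuiverRep K Q) ⥤ T) (_ : F.CommShift ℤ),
      F.IsTriangulated ∧ F.Linear K ∧ F.Full ∧ F.Faithful ∧ B = F.essImage :=
  exists_functor_of_mem h

lemma exists_heredPair {n : ℕ} {B : ObjectProperty T}
    (h : B ∈ subcatsOfType K T {Db K (KroneckerVertex n)}) :
    ∃ E₁ E₂ : T, HeredPair K E₁ E₂ ∧ B = span E₁ E₂ := by
  obtain ⟨F, _, _, _, _, _, rfl⟩ := exists_functor_of_mem_Db h
  exact ⟨_, _, (heredPair_kronecker K n).map F, (span_map_eq_essImage F (span_kronecker K n)).symm⟩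

lemma exists_isExc {B : ObjectProperty T} (h : B ∈ subcatsOfType K T {DbA₁ K}) :
    ∃ E : T, IsExc K E ∧ B = point E := by
  obtain ⟨F, _, _, _, _, _, rfl⟩ := exists_functor_of_mem_Db h
  exact ⟨_, isExc_a₁Object.map F,
    (point_map_eq_essImage F fun X => (finiteSum_a₁Object X).triGenerated).symm⟩

lemma eq_isZero_of_mem {B : ObjectProperty T} (h : B ∈ subcatsOfType K T {trivialCat K}) :
    B = fun X => IsZero X := by
  obtain ⟨F, _, _, _, _, _, rfl⟩ := exists_functor_of_mem h
  have hz (X : (trivialCat K).carrier) : IsZero X := by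
    have h0 : IsZero X.1 := X.2
    rw [IsZero.iff_id_eq_zero] at h0 ⊢
    exact (ObjectProperty.ι _).map_injective h0
  ext X
  constructor
  · rintro ⟨Y, ⟨e⟩⟩
    exact (F.map_isZero (hz Y)).of_iso e.symm
  · intro hX
    exact ⟨0, ⟨(F.map_isZero (hz 0)).iso hX⟩⟩

end


/-! ### The types on the list are discrete -/

section

variable {K : Type w} [Field K] {T : Type u} [Category.{v} T] [HasZeroObject T] [HasShift T ℤ]
  [Preadditive T] [Linear K T] [∀ n : ℤ, (shiftFunctor T n).Additive]
  [∀ n : ℤ, (shiftFunctor T n).Linear K] [Pretriangulated T] [IsTriangulated T]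

lemma isZero_mem {J : Set (LinTriCat.{w, w + 1, w + 1} K)} (hJ : trivialCat K ∈ J) :
    (fun X : T => IsZero X) ∈ subcatsOfType K T J := by
  have hz (X : (trivialCat K).carrier) : IsZero X := by
    have h0 : IsZero X.1 := X.2
    rw [IsZero.iff_id_eq_zero] at h0 ⊢
    exact (ObjectProperty.ι _).map_injective h0
  have h0 (n : ℤ) : IsZero ((0 : T)⟦n⟧) := (shiftFunctor T n).map_isZero (isZero_zero T)
  let F : (trivialCat K).carrier ⥤ T := (Functor.const _).obj 0
  let _ : F.CommShift ℤ :=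
    { commShiftIso n := NatIso.ofComponents (fun _ => (isZero_zero T).iso (h0 n))
        (fun _ => (isZero_zero T).eq_of_src _ _)
      commShiftIso_zero := by
        ext X
        exact (isZero_zero T).eq_of_src _ _
      commShiftIso_add a b := by
        ext X
        exact (isZero_zero T).eq_of_src _ _ }
  have hF : F.IsTriangulated :=
    ⟨fun D _ => isomorphic_distinguished _ (contractible_distinguished (0 : T)) _
      (Triangle.isoMk _ _ (Iso.refl _) (Iso.refl _) (Iso.refl _)
        ((isZero_zero T).eq_of_src _ _) ((isZero_zero T).eq_of_src _ _)
        ((isZero_zero T).eq_of_src _ _))⟩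
  refine mem_subcatsOfType_iff.2 ⟨_, hJ, F, inferInstance, hF,
    ⟨fun _ _ => (isZero_zero T).eq_of_src _ _⟩,
    ⟨fun _ => ⟨0, (isZero_zero T).eq_of_src _ _⟩⟩, ⟨fun _ => (hz _).eq_of_src _ _⟩, ?_⟩
  ext X
  constructor
  · intro hX
    exact ⟨0, ⟨(isZero_zero T).iso hX⟩⟩
  · rintro ⟨Y, ⟨e⟩⟩
    exact (isZero_zero T).of_iso e.symm

variable (K) in
/-- `A` is of discrete type with indecomposable objects `S`, each of which generates a subcategory
equivalent to `D^b(A₁)`. -/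
structure IsPointed (A S : ObjectProperty T) : Prop extends IsDiscrete K A S where
  retracts : A.IsStableUnderRetracts
  mem : ∀ E, S E → point E ∈ subcatsOfType K T {DbA₁ K}

lemma isPointed_isZero : IsPointed K (fun X : T => IsZero X) (fun _ => False) where
  toIsDiscrete := isDiscrete_isZero
  retracts := ⟨fun r h => (IsZero.iff_id_eq_zero _).2 (by
    rw [← r.retract, h.eq_of_src r.r 0, comp_zero])⟩
  mem _ h := h.elim

variable (hf : ∀ X Y : T, HomFinite K X Y)
include hf

lemma exists_isPointed_DbA₁ {A : ObjectProperty T} (h : A ∈ subcatsOfType K T {DbA₁ K}) :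
    ∃ S, IsPointed K A S := by
  obtain ⟨E, hE, rfl⟩ := exists_isExc h
  refine ⟨_, isDiscrete_point hE (hf E), ?_, ?_⟩
  · exact (rightAdmissible_of_isExc hE (hf E)).isStableUnderRetracts (isTriSubcat_triGenerated _)
  · rintro _ rfl
    exact h

lemma HeredPair.isPointed {E₁ E₂ E₃ : T} (hE : HeredPair K E₁ E₂) {h : E₁ ⟶ E₂}
    {g : E₂ ⟶ E₃} {d : E₃ ⟶ E₁⟦(1 : ℤ)⟧} (hh : Triangle.mk h g d ∈ distTriang T)
    (hspan : ∀ (a : ℤ) (f : E₁⟦a⟧ ⟶ E₂⟦a⟧), ∃ c : K, f = c • h⟦a⟧')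
    (hmem : ∀ E, tripleOf h E₃ E → point E ∈ subcatsOfType K T {DbA₁ K}) :
    IsPointed K (span E₁ E₂) (tripleOf h E₃) where
  toIsDiscrete := hE.isDiscrete hf hh hspan
  retracts := (hE.toExcPair.rightAdmissible (hf _) (hf _)).isStableUnderRetracts
    (isTriSubcat_triGenerated _)
  mem := hmem

/-- For `h = 0` the cone is dropped from `tripleOf`, so only `E₁` and `E₂` remain. -/
lemma HeredPair.isPointed_of_eq_zero {E₁ E₂ : T} (hE : HeredPair K E₁ E₂)
    (hz : ∀ (a : ℤ) (f : E₁⟦a⟧ ⟶ E₂⟦a⟧), f = 0)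
    (h₁ : point E₁ ∈ subcatsOfType K T {DbA₁ K}) (h₂ : point E₂ ∈ subcatsOfType K T {DbA₁ K}) :
    ∃ S, IsPointed K (span E₁ E₂) S := by
  obtain ⟨E₃, g, d, hh⟩ := distinguished_cocone_triangle (0 : E₁ ⟶ E₂)
  refine ⟨_, hE.isPointed hf hh (fun a f => ⟨0, by rw [hz a f, zero_smul]⟩) ?_⟩
  rintro E (rfl | rfl | ⟨h, -⟩)
  exacts [h₁, h₂, (h rfl).elim]

lemma exists_isPointed_zero {A : ObjectProperty T}
    (h : A ∈ subcatsOfType K T {Db K (KroneckerVertex 0)}) : ∃ S, IsPointed K A S := by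
  obtain ⟨F, _, _, _, _, _, rfl⟩ := exists_functor_of_mem_Db h
  have hE := (heredPair_kronecker K 0).map F
  rw [← span_map_eq_essImage F (span_kronecker K 0)]
  refine hE.isPointed_of_eq_zero hf (fun a f => ?_) (point_map_boundedSingle_mem hE.exc₁)
    (point_map_boundedSingle_mem hE.exc₂)
  obtain ⟨g, rfl⟩ := exists_map_shift F f
  obtain ⟨g, rfl⟩ := boundedSingle_exists_hom a g
  have : IsEmpty (kSource 0 ⟶ kTarget 0) := ⟨fun p => (kSource_path_exists 0 p).choose.elim0⟩
  rw [pathRep_hom_eq_zero g]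
  simp

/-- The map between the two projectives is mono, so its cone is its cokernel in degree zero. Hence
the third point also comes from a representation and `point_map_boundedSingle_mem` applies to it. -/
lemma exists_isPointed_one {A : ObjectProperty T}
    (h : A ∈ subcatsOfType K T {Db K (KroneckerVertex 1)}) :
    ∃ E₁ E₂ E₃ : T, E₁ ≠ E₂ ∧ E₁ ≠ E₃ ∧ E₂ ≠ E₃ ∧
      IsPointed K A (fun X => X = E₁ ∨ X = E₂ ∨ X = E₃) := by
  obtain ⟨F, _, _, _, _, _, rfl⟩ := exists_functor_of_mem_Db h
  obtain ⟨h, h0, _, hh⟩ := exists_kronecker_one K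
  obtain ⟨d, hd⟩ := exists_cokernel_triangle h
  have hT := F.map_distinguished _ hd
  have hE := (heredPair_kronecker K 1).map F
  have hspan := exists_smul_map F (exists_smul_boundedSingle hh)
  have h0' : F.map ((boundedSingle _).map h) ≠ 0 := fun h' =>
    h0 ((boundedSingle _).map_injective (F.map_injective (by simpa using h')))
  have hc := hE.isExc_cone hT h0' hspan
  have hp := hE.isPointed hf hT hspan (by
    rintro E (rfl | rfl | ⟨-, rfl⟩)
    · exact point_map_boundedSingle_mem hE.exc₁
    · exact point_map_boundedSingle_mem hE.exc₂
    · exact point_map_boundedSingle_mem hc)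
  have ht : tripleOf (F.map ((boundedSingle _).map h)) (F.obj ((boundedSingle _).obj (cokernel h))) =
      fun X => X = F.obj (kTargetObj K 1) ∨ X = F.obj (kSourceObj K 1) ∨
        X = F.obj ((boundedSingle _).obj (cokernel h)) := by
    ext X
    simp [tripleOf, h0']
  have hpt (E : T) := isTriSubcat_triGenerated (fun X => X = E)
  have hpt' (E : T) := (hpt E).1
  have hpt'' (E : T) := (hpt E).2
  rw [span_map_eq_essImage F (span_kronecker K 1)] at hp
  refine ⟨_, _, _, fun h => ?_, fun h => ?_, fun h => ?_, ht ▸ hp⟩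
  · exact hE.not_point_left (h ▸ point_self _)
  · refine hE.not_point_left ((point _).ext_of_isTriangulatedClosed₂ _ hT (point_self _) ?_)
    exact h ▸ point_self _
  · refine hE.not_point_right ((point _).ext_of_isTriangulatedClosed₁ _ hT (point_self _) ?_)
    exact h ▸ point_self _

lemma exists_isPointed_directSum {A : ObjectProperty T}
    (h : A ∈ subcatsOfType K T {(DbA₁ K).directSum (DbA₁ K)}) : ∃ S, IsPointed K A S := by
  let B := DerivedCategory.Bounded (QuiverRep K (Quiver.Empty Unit))
  obtain ⟨F, _, _, _, _, _, rfl⟩ : ∃ (F : B × B ⥤ T) (_ : F.CommShift ℤ),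
      F.IsTriangulated ∧ F.Linear K ∧ F.Full ∧ F.Faithful ∧ A = F.essImage :=
    exists_functor_of_mem h
  have hgen (X : B) : point (a₁Object K) X := (finiteSum_a₁Object X).triGenerated
  have hE := (heredPair_prod (isExc_a₁Object (K := K)) (isExc_a₁Object (K := K))).map F
  rw [← span_map_eq_essImage F (span_prod hgen hgen)]
  refine hE.isPointed_of_eq_zero hf (fun a f => ?_)
    (point_mem_of_functor hE.exc₁ (prodInl B B ⋙ F) (Iso.refl _))
    (point_mem_of_functor hE.exc₂ (prodInr B B ⋙ F) (Iso.refl _))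
  obtain ⟨g, rfl⟩ := exists_map_shift F f
  rw [prodInl_prodInr_eq_zero g]
  simp

end


/-! ### Counting derived points and intersecting subcategories -/

section

variable {K : Type w} [Field K] {T : Type u} [Category.{v} T] [HasZeroObject T] [HasShift T ℤ]
  [Preadditive T] [Linear K T] [∀ n : ℤ, (shiftFunctor T n).Additive]
  [∀ n : ℤ, (shiftFunctor T n).Linear K] [Pretriangulated T] [IsTriangulated T]

lemma isDerivedPoint_iff {P : ObjectProperty T} :
    IsDerivedPoint K P ↔ ∃ E : T, IsExc K E ∧ P = point E :=
  ⟨fun ⟨E, hE, h⟩ => ⟨E, isExc_of_isExceptional hE, h⟩, fun ⟨E, hE, h⟩ => ⟨E, hE.isExceptional, h⟩⟩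

lemma IsDiscrete.exists_eq_point {A S : ObjectProperty T} (h : IsDiscrete K A S) {E : T}
    (hE : IsExc K E) (hA : point E ≤ A) : ∃ F, S F ∧ point E = point F := by
  obtain ⟨F, hF, a, ⟨e⟩⟩ := h.exists_point_eq hE (hA _ (point_self E))
  exact ⟨F, hF, point_shift_iso e⟩

lemma triGenerated_point_sup_point (E F : T) : triGenerated (point E ⊔ point F) = span E F := by
  have h₁ := isTriSubcat_triGenerated (fun X => X = E ∨ X = F)
  have h₂ := isTriSubcat_triGenerated (point E ⊔ point F)
  refine le_antisymm (triGenerated_le h₁ (sup_le (point_le h₁ (span_left E F))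
    (point_le h₁ (span_right E F)))) (span_le h₂ ?_ ?_)
  · exact le_triGenerated _ _ (le_sup_left (a := point E) (b := point F) _ (point_self E))
  · exact le_triGenerated _ _ (le_sup_right (a := point E) (b := point F) _ (point_self F))

/-- The derived points contained in a subcategory of discrete type. -/
lemma IsPointed.setOf_isDerivedPoint {A S : ObjectProperty T} (h : IsPointed K A S) :
    {P | IsDerivedPoint K P ∧ P ≤ A} = {P | ∃ E, S E ∧ P = point E} := by
  ext P
  constructor
  · rintro ⟨hP, hPA⟩
    obtain ⟨E, hE, rfl⟩ := isDerivedPoint_iff.1 hP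
    exact h.exists_eq_point hE hPA
  · rintro ⟨E, hE, rfl⟩
    exact ⟨isDerivedPoint_iff.2 ⟨E, h.exc E hE, rfl⟩, point_le h.isTriSubcat (h.le _ hE)⟩

lemma IsPointed.setOf_mem_subcatsOfType {A S : ObjectProperty T} (h : IsPointed K A S) :
    {P ∈ subcatsOfType K T {DbA₁ K} | P ≤ A} = {P | ∃ E, S E ∧ P = point E} := by
  ext P
  constructor
  · rintro ⟨hP, hPA⟩
    obtain ⟨E, hE, rfl⟩ := exists_isExc hP
    exact h.exists_eq_point hE hPA
  · rintro ⟨E, hE, rfl⟩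
    exact ⟨h.mem E hE, point_le h.isTriSubcat (h.le _ hE)⟩

lemma IsPointed.triGenerated_sup {A S : ObjectProperty T} (h : IsPointed K A S)
    {P Q : ObjectProperty T} (hP : IsDerivedPoint K P) (hQ : IsDerivedPoint K Q) (hPA : P ≤ A)
    (hQA : Q ≤ A) (hne : P ≠ Q) : triGenerated (P ⊔ Q) = A := by
  have hP' : P ∈ {P | IsDerivedPoint K P ∧ P ≤ A} := ⟨hP, hPA⟩
  have hQ' : Q ∈ {P | IsDerivedPoint K P ∧ P ≤ A} := ⟨hQ, hQA⟩
  rw [h.setOf_isDerivedPoint] at hP' hQ'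
  obtain ⟨E, hE, rfl⟩ := hP'
  obtain ⟨F, hF, rfl⟩ := hQ'
  rw [triGenerated_point_sup_point]
  exact h.span_eq E F hE hF fun h => hne (h ▸ rfl)

lemma IsPointed.ncard_points {E₁ E₂ E₃ : T} {A : ObjectProperty T} (h₁₂ : E₁ ≠ E₂) (h₁₃ : E₁ ≠ E₃)
    (h₂₃ : E₂ ≠ E₃) (h : IsPointed K A (fun X => X = E₁ ∨ X = E₂ ∨ X = E₃)) :
    {P : ObjectProperty T | ∃ E, (E = E₁ ∨ E = E₂ ∨ E = E₃) ∧ P = point E}.ncard = 3 := by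
  have hne {E F : T} (hE : E = E₁ ∨ E = E₂ ∨ E = E₃) (hF : F = E₁ ∨ F = E₂ ∨ F = E₃)
      (hEF : E ≠ F) : point E ≠ point F := fun h' =>
    h.not_mem E F hE hF hEF (h' ▸ point_self F)
  refine Set.ncard_eq_three.2 ⟨point E₁, point E₂, point E₃, hne (by simp) (by simp) h₁₂,
    hne (by simp) (by simp) h₁₃, hne (by simp) (by simp) h₂₃, ?_⟩
  ext P
  simp

lemma IsPointed.inf_eq {A S : ObjectProperty T} (h : IsPointed K A S) {P : ObjectProperty T}
    (hP : IsTriSubcat P) (hP' : P.IsStableUnderRetracts) :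
    (A ⊓ P = fun X => IsZero X) ∨
      (IsDerivedPoint K (A ⊓ P) ∧ A ⊓ P ∈ subcatsOfType K T {DbA₁ K}) ∨ A ≤ P := by
  rcases h.toIsDiscrete.inf_eq hP with h' | ⟨E, hE, h'⟩ | h'
  · exact Or.inl h'
  · refine Or.inr (Or.inl ?_)
    rw [h']
    exact ⟨isDerivedPoint_iff.2 ⟨E, h.exc E hE, rfl⟩, h.mem E hE⟩
  · exact Or.inr (Or.inr h')

variable (hf : ∀ X Y : T, HomFinite K X Y)
include hf

lemma exists_isPointed_of_ncCurve {l : ℤ} (hl : -1 ≤ l) (hl' : l ≤ 0) {A : ObjectProperty T}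
    (hA : A ∈ ncCurves K T l) : ∃ S, IsPointed K A S := by
  obtain rfl | rfl : l = -1 ∨ l = 0 := by lia
  · exact exists_isPointed_zero hf hA
  · obtain ⟨_, _, _, _, _, _, h⟩ := exists_isPointed_one hf hA
    exact ⟨_, h⟩

/-- Only `A` has to be discrete; of `B` just closure under retracts is used to intersect. The
remaining case `A ≤ B` contradicts `A ≠ B` by `HeredPair.span_eq`. -/
lemma ncCurve_inf {l₁ l₂ : ℤ} (hl : -1 ≤ l₁) (hl' : l₁ ≤ 0) {A B : ObjectProperty T}
    (hA : A ∈ ncCurves K T l₁) (hB : B ∈ ncCurves K T l₂) (hne : A ≠ B) :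
    (A ⊓ B = fun X => IsZero X) ∨
      (IsDerivedPoint K (A ⊓ B) ∧ A ⊓ B ∈ subcatsOfType K T {DbA₁ K}) := by
  obtain ⟨S, hS⟩ := exists_isPointed_of_ncCurve hf hl hl' hA
  obtain ⟨E₁, E₂, hE, rfl⟩ := exists_heredPair hB
  have ht := isTriSubcat_triGenerated (fun X => X = E₁ ∨ X = E₂)
  rcases hS.inf_eq ht ((hE.toExcPair.rightAdmissible (hf _) (hf _)).isStableUnderRetracts ht)
    with h | h | h
  · exact Or.inl h
  · exact Or.inr h
  · obtain ⟨F₁, F₂, hF, rfl⟩ := exists_heredPair hA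
    exact (hne (hE.span_eq hF.toExcPair hf h)).elim

/-- Every type allowed in `J` is discrete and closed under retracts, so the intersection is zero, a
point or `A` itself, and each of these has a type in `J`. -/
lemma inf_mem_subcatsOfType {J : Set (LinTriCat.{w, w + 1, w + 1} K)}
    (h₀ : trivialCat K ∈ J) (h₁ : DbA₁ K ∈ J)
    (hJ : J ⊆ {trivialCat K, DbA₁ K, (DbA₁ K).directSum (DbA₁ K), DbA₂ K})
    {A B : ObjectProperty T} (hA : A ∈ subcatsOfType K T J) (hB : B ∈ subcatsOfType K T J) :
    A ⊓ B ∈ subcatsOfType K T J := by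
  have hpt {A : ObjectProperty T} (hA : A ∈ subcatsOfType K T J) : ∃ S, IsPointed K A S := by
    obtain ⟨C, hC, hA⟩ := exists_of_mem_subcatsOfType hA
    rcases hJ hC with rfl | rfl | rfl | rfl
    · rw [eq_isZero_of_mem hA]
      exact ⟨_, isPointed_isZero⟩
    · exact exists_isPointed_DbA₁ hf hA
    · exact exists_isPointed_directSum hf hA
    · obtain ⟨_, _, _, _, _, _, h⟩ := exists_isPointed_one hf hA
      exact ⟨_, h⟩
  obtain ⟨S, hS⟩ := hpt hA
  obtain ⟨S', hS'⟩ := hpt hB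
  rcases hS.inf_eq hS'.isTriSubcat hS'.retracts with h | h | h
  · rw [h]
    exact isZero_mem h₀
  · exact subcatsOfType_mono (Set.singleton_subset_iff.2 h₁) h.2
  · rwa [inf_eq_left.2 h]

end

end LinTri

theorem mainTheorem11 (K : Type w) [Field K]
    (T : Type u) [Category.{v} T] [HasZeroObject T] [HasShift T ℤ] [Preadditive T] [Linear K T]
    [∀ n : ℤ, (shiftFunctor T n).Additive] [∀ n : ℤ, (shiftFunctor T n).Linear K]
    [Pretriangulated T] [IsTriangulated T] (hT : IsProperCat K T) :
    -- a curve of genus 0 contains exactly three derived points, and any two of them span it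
    (∀ A ∈ ncCurves K T 0,
      {P ∈ subcatsOfType K T {DbA₁ K} | P ≤ A}.ncard = 3 ∧
      {P | IsDerivedPoint K P ∧ P ≤ A} = {P ∈ subcatsOfType K T {DbA₁ K} | P ≤ A} ∧
      ∀ P Q : ObjectProperty T, IsDerivedPoint K P → IsDerivedPoint K Q → P ≤ A → Q ≤ A →
        P ≠ Q → triGenerated (P ⊔ Q) = A) ∧
    -- two different curves, one of genus at most 0, meet trivially or in a single derived point
    (∀ l₁ l₂ : ℤ, -1 ≤ l₁ → -1 ≤ l₂ → (l₁ ≤ 0 ∨ l₂ ≤ 0) →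
      ∀ A ∈ ncCurves K T l₁, ∀ B ∈ ncCurves K T l₂, A ≠ B →
        (A ⊓ B = fun X => IsZero X) ∨
        (IsDerivedPoint K (A ⊓ B) ∧ A ⊓ B ∈ subcatsOfType K T {DbA₁ K})) ∧
    -- intersections are greatest lower bounds
    (∀ J : Set (LinTriCat.{w, w + 1, w + 1} K),
      (J = {trivialCat K, DbA₁ K, DbA₂ K} ∨
        J = {trivialCat K, DbA₁ K, (DbA₁ K).directSum (DbA₁ K), DbA₂ K}) →
      ∀ x y : subcatsOfType K T J, ∃ h : x.1 ⊓ y.1 ∈ subcatsOfType K T J,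
        IsGLB {x, y} (⟨x.1 ⊓ y.1, h⟩ : subcatsOfType K T J)) := by
  have hf : ∀ X Y : T, LinTri.HomFinite K X Y := hT.homFinite
  refine ⟨fun A hA => ?_, fun l₁ l₂ h₁ h₂ h A hA B hB hne => ?_, fun J hJ x y => ?_⟩
  · obtain ⟨E₁, E₂, E₃, h₁₂, h₁₃, h₂₃, h⟩ := LinTri.exists_isPointed_one hf hA
    refine ⟨?_, ?_, fun P Q hP hQ hPA hQA hne => h.triGenerated_sup hP hQ hPA hQA hne⟩
    · rw [h.setOf_mem_subcatsOfType]
      exact h.ncard_points h₁₂ h₁₃ h₂₃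
    · rw [h.setOf_mem_subcatsOfType, h.setOf_isDerivedPoint]
  · rcases h with h | h
    · exact LinTri.ncCurve_inf hf h₁ h hA hB hne
    · rw [inf_comm]
      exact LinTri.ncCurve_inf hf h₂ h hB hA hne.symm
  · have hmem : x.1 ⊓ y.1 ∈ subcatsOfType K T J := by
      rcases hJ with rfl | rfl
      · refine LinTri.inf_mem_subcatsOfType hf (by simp) (by simp) ?_ x.2 y.2
        rintro C (rfl | rfl | rfl) <;> simp
      · exact LinTri.inf_mem_subcatsOfType hf (by simp) (by simp) subset_rfl x.2 y.2
    refine ⟨hmem, ?_, fun z hz => ?_⟩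
    · rintro z (hz | hz)
      · exact hz ▸ (inf_le_left : x.1 ⊓ y.1 ≤ x.1)
      · exact hz ▸ (inf_le_right : x.1 ⊓ y.1 ≤ y.1)
    · have hx : z.1 ≤ x.1 := hz (Or.inl rfl)
      have hy : z.1 ≤ y.1 := hz (Or.inr rfl)
      exact (le_inf hx hy : z.1 ≤ x.1 ⊓ y.1)
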